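/- Let $p\ge 3$ be a prime, $\mathbf F_q$ a finite field of characteristic $p$, $\mathbf Z_q=W(\mathbf F_q)$ its ring of Witt vectors, $\mathbf Q_q=\operatorname{Frac}\mathbf Z_q$, and $a\mapsto a^\sigma$ the Witt vector Frobenius. Let $g\ge 1$, $N\ge 1$ be integers with $p>(2N-1)(2g+1)$, and let $Q\in\mathbf Z_q[x]$ be monic of degree $2g+1$ whose reduction $\overline Q\in\mathbf F_q[x]$ has no multiple roots. Let $A^\dagger$ be the weak completion of $A=\mathbf Z_q[x,y,y^{-1}]/(y^2-Q(x))$, that is, the ring of series $\sum_{i\ge0,\,j\in\mathbf Z}a_{i,j}x^iy^j$ with $a_{i,j}\in\mathbf Z_q$ and $v_p(a_{i,j})\to\infty$ at least linearly in $\max(i,|j|)$, modulo $y^2=Q(x)$. Its differentials over $\mathbf Q_q$ are the expressions $f\,dx/y$ with $f\in A^\dagger\otimes\mathbf Q_q$, and $2y\,dy=Q'(x)\,dx$. Two differentials $\omega,\eta$ are cohomologous if $\omega-\eta=df$ for some $f\in A^\dagger\otimes\mathbf Q_q$. A reduction of $\omega$ is a differential $B(x)\,dx/y$ cohomologous to $\omega$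 with $B\in\mathbf Q_q[x]$ of degree at most $2g-1$. Frobenius is lifted to an endomorphism $\sigma$ of $A^\dagger$ that acts on $\mathbf Z_q$ as the Witt vector Frobenius, with $$x^\sigma=x^p,\qquad (y^{-1})^\sigma=y^{-p}\sum_{k\ge0}\binom{-1/2}{k}\frac{(Q(x)^\sigma-Q(x)^p)^k}{y^{2pk}},\qquad y^\sigma=((y^{-1})^\sigma)^{-1},$$ and to differentials by $\sigma(f\,dh)=f^\sigma d(h^\sigma)$. Let $C_{j,r}\in\mathbf Z_q$ be the coefficient of $x^r$ in $Q(x)^j$. For $0\le j<N$ and $r\ge0$ put $$B_{j,r}=p\,C_{j,r}^\sigma\sum_{k=j}^{N-1}(-1)^{k+j}\binom{-1/2}{k}\binom kj ,$$ and for $0\le i<2g$ put $$T_i=\sum_{j=0}^{N-1}\ \sum_{r=0}^{(2g+1)j}B_{j,r}\,x^{p(i+r+1)-1}\,y^{-p(2j+1)+1}\,dx/y .$$ Then: (1) $B_{j,r}\in\mathbf Z_q$ for all $0\le j<N$ and all $r$. (2) The set of pairs $(j,r)$ indexing the sum $T_i$, which depends only on $g$ and $N$ and not on $p$, has at most $2N^2g$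 elements, so $T_i$ has $O(N^2g)$ terms. (3) For every $0\le i<2g$, each of $T_i$ and $\sigma(x^i\,dx/y)$ has exactly one reduction, say $R_i(x)\,dx/y$ and $S_i(x)\,dx/y$, and these agree modulo $p^N$: every coefficient of $R_i-S_i$ lies in $p^N\mathbf Z_q$. -/

import Mathlib

open scoped Polynomial
open scoped WithZero

set_option linter.unusedSectionVars false

noncomputable section

namespace HyperellipticMW

section Overconvergent

open MvPowerSeries WithZero

variable {K : Type*} [Field K] {v : Valuation K ℤᵐ⁰} {ι κ : Type*}

/-- `M * ord(a_s) ≥ |s| - D` for all coefficients `a_s` of `f`, where `v = exp (-ord)`. -/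
def GrowthBound (v : Valuation K ℤᵐ⁰) (M : ℕ) (D : ℤ) (f : MvPowerSeries ι K) : Prop :=
  ∀ s : ι →₀ ℕ, v (coeff s f) ^ M ≤ exp (D - (s.degree : ℤ))

/-- A power series is overconvergent if the valuations `ord(a_s)` of its coefficients tend to
infinity at least linearly in `|s|`: `ord(a_s) ≥ (|s| - D) / M` for some `M > 0` and some `D`,
where `v = exp (-ord)`. -/
def IsOverconvergent (v : Valuation K ℤᵐ⁰) (f : MvPowerSeries ι K) : Prop :=
  ∃ (M : ℕ) (D : ℤ), 0 < M ∧ GrowthBound v M D f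

/-- All coefficients are integral. -/
def IsIntegralSeries (v : Valuation K ℤᵐ⁰) (f : MvPowerSeries ι K) : Prop :=
  ∀ s : ι →₀ ℕ, v (coeff s f) ≤ 1

theorem GrowthBound.mono {M : ℕ} {D E : ℤ} {f : MvPowerSeries ι K} (h : GrowthBound v M D f)
    (hDE : D ≤ E) : GrowthBound v M E f := fun s =>
  (h s).trans (exp_le_exp.2 (by lia))

theorem GrowthBound.scale {M : ℕ} {D : ℤ} {f : MvPowerSeries ι K} (h : GrowthBound v M D f)
    {t : ℕ} (ht : 0 < t) : GrowthBound v (M * t) (t * D) f := fun s => by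
  rw [pow_mul]
  refine (pow_le_pow_left₀ zero_le (h s) t).trans ?_
  rw [← exp_nsmul, exp_le_exp, nsmul_eq_mul, mul_sub]
  have : (s.degree : ℤ) ≤ t * (s.degree : ℤ) := by
    have h1 : (1 : ℤ) ≤ t := by exact_mod_cast ht
    have h2 : (0 : ℤ) ≤ s.degree := by positivity
    nlinarith
  linarith

theorem GrowthBound.add {M : ℕ} {D : ℤ} {f g : MvPowerSeries ι K}
    (hf : GrowthBound v M D f) (hg : GrowthBound v M D g) : GrowthBound v M D (f + g) := fun s => by
  rw [map_add]
  rcases le_total (v (coeff s f)) (v (coeff s g)) with h | h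
  · exact (pow_le_pow_left₀ zero_le ((Valuation.map_add _ _ _).trans (max_le h le_rfl)) M).trans
      (hg s)
  · exact (pow_le_pow_left₀ zero_le ((Valuation.map_add _ _ _).trans (max_le le_rfl h)) M).trans
      (hf s)

theorem val_sum_pow_le {α : Type*} (S : Finset α) (F : α → K) (M : ℕ) (hM : 0 < M) (B : ℤ)
    (h : ∀ i ∈ S, v (F i) ^ M ≤ exp B) : v (∑ i ∈ S, F i) ^ M ≤ exp B := by
  classical
  induction S using Finset.induction_on with
  | empty => simp [hM.ne']
  | insert a S ha ih =>
    rw [Finset.sum_insert ha]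
    have h1 := h a (Finset.mem_insert_self _ _)
    have h2 := ih fun i hi => h i (Finset.mem_insert_of_mem hi)
    rcases le_total (v (F a)) (v (∑ i ∈ S, F i)) with h' | h'
    · exact (pow_le_pow_left₀ zero_le
        ((Valuation.map_add _ _ _).trans (max_le h' le_rfl)) M).trans h2
    · exact (pow_le_pow_left₀ zero_le
        ((Valuation.map_add _ _ _).trans (max_le le_rfl h')) M).trans h1

theorem val_finsum_pow_le {α : Type*} (F : α → K) (M : ℕ) (hM : 0 < M) (B : ℤ)
    (h : ∀ i, v (F i) ^ M ≤ exp B) : v (∑ᶠ i, F i) ^ M ≤ exp B := by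
  by_cases hF : (Function.support F).Finite
  · rw [finsum_eq_sum F hF]
    exact val_sum_pow_le _ _ M hM B fun i _ => h i
  · rw [finsum_of_infinite_support hF]
    simp [hM.ne']

theorem GrowthBound.mul {M : ℕ} (hM : 0 < M) {D E : ℤ} {f g : MvPowerSeries ι K}
    (hf : GrowthBound v M D f) (hg : GrowthBound v M E g) : GrowthBound v M (D + E) (f * g) := fun s => by
  classical
  rw [coeff_mul]
  refine val_sum_pow_le _ _ M hM _ fun i hi => ?_
  rw [map_mul, mul_pow]
  refine (mul_le_mul' (hf i.1) (hg i.2)).trans ?_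
  rw [← exp_add, exp_le_exp, ← Finset.HasAntidiagonal.mem_antidiagonal.1 hi, map_add]
  push_cast
  linarith

theorem GrowthBound.C {M : ℕ} (hM : 0 < M) {c : K} (hc : v c ≤ 1) :
    GrowthBound v M 0 (MvPowerSeries.C (σ := ι) c) := fun s => by
  classical
  rw [coeff_C]
  split_ifs with h
  · subst h
    simpa using pow_le_one₀ zero_le hc
  · simp [hM.ne']

theorem GrowthBound.one {M : ℕ} (hM : 0 < M) : GrowthBound v M 0 (1 : MvPowerSeries ι K) := by
  rw [← map_one MvPowerSeries.C]
  exact GrowthBound.C hM (by simp)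

theorem GrowthBound.pow {M : ℕ} (hM : 0 < M) {D : ℤ} {f : MvPowerSeries ι K}
    (hf : GrowthBound v M D f) (n : ℕ) : GrowthBound v M (n * D) (f ^ n) := by
  induction n with
  | zero => simpa using GrowthBound.one hM
  | succ n ih =>
    rw [pow_succ]
    refine (ih.mul hM hf).mono (le_of_eq ?_)
    push_cast
    ring

theorem GrowthBound.prod {α : Type*} {M : ℕ} (hM : 0 < M) {D : α → ℤ}
    {f : α → MvPowerSeries ι K} (S : Finset α)
    (hf : ∀ i ∈ S, GrowthBound v M (D i) (f i)) : GrowthBound v M (∑ i ∈ S, D i) (∏ i ∈ S, f i) := by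
  classical
  induction S using Finset.induction_on with
  | empty => simpa using GrowthBound.one hM
  | insert a S ha ih =>
    rw [Finset.sum_insert ha, Finset.prod_insert ha]
    exact (hf a (Finset.mem_insert_self _ _)).mul hM
      (ih fun i hi => hf i (Finset.mem_insert_of_mem hi))

theorem IsIntegralSeries.one : IsIntegralSeries v (1 : MvPowerSeries ι K) := fun s => by
  classical
  rw [coeff_one]
  split_ifs <;> simp

theorem IsIntegralSeries.X (i : ι) :
    IsIntegralSeries v (MvPowerSeries.X i : MvPowerSeries ι K) := fun s => by
  classical
  rw [coeff_X]
  split_ifs <;> simp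

theorem IsIntegralSeries.mul {f g : MvPowerSeries ι K}
    (hf : IsIntegralSeries v f) (hg : IsIntegralSeries v g) : IsIntegralSeries v (f * g) := fun s => by
  classical
  rw [coeff_mul]
  refine Valuation.map_sum_le _ fun i _ => ?_
  rw [map_mul]
  exact mul_le_one' (hf _) (hg _)

theorem IsIntegralSeries.pow {f : MvPowerSeries ι K}
    (hf : IsIntegralSeries v f) (n : ℕ) : IsIntegralSeries v (f ^ n) := by
  induction n with
  | zero => simpa using IsIntegralSeries.one
  | succ n ih => rw [pow_succ]; exact ih.mul hf

theorem GrowthBound.isIntegralSeries {M : ℕ} (hM : 0 < M) {f : MvPowerSeries ι K}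
    (hf : GrowthBound v M 0 f) : IsIntegralSeries v f := fun s => by
  have h1 : v (coeff s f) ^ M ≤ 1 := by
    refine (hf s).trans ?_
    rw [← exp_zero, exp_le_exp]
    simp
  exact (pow_le_one_iff hM.ne').1 h1

theorem GrowthBound.X {M : ℕ} (hM : 0 < M) (i : ι) :
    GrowthBound v M 1 (MvPowerSeries.X i : MvPowerSeries ι K) := fun s => by
  classical
  rw [coeff_X]
  split_ifs with h
  · subst h
    simp
  · simp [hM.ne']

theorem IsOverconvergent.exists_common {f g : MvPowerSeries ι K}
    (hf : IsOverconvergent v f) (hg : IsOverconvergent v g) :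
    ∃ (M : ℕ) (D : ℤ), 0 < M ∧ GrowthBound v M D f ∧ GrowthBound v M D g := by
  obtain ⟨M, D, hM, h⟩ := hf
  obtain ⟨L, E, hL, h'⟩ := hg
  refine ⟨M * L, max (L * D) (M * E), Nat.mul_pos hM hL,
    (h.scale hL).mono (le_max_left _ _), ?_⟩
  rw [mul_comm M L]
  exact (h'.scale hM).mono (le_max_right _ _)

theorem IsOverconvergent.add {f g : MvPowerSeries ι K}
    (hf : IsOverconvergent v f) (hg : IsOverconvergent v g) : IsOverconvergent v (f + g) := by
  obtain ⟨M, D, hM, h, h'⟩ := hf.exists_common hg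
  exact ⟨M, D, hM, h.add h'⟩

theorem IsOverconvergent.mul {f g : MvPowerSeries ι K}
    (hf : IsOverconvergent v f) (hg : IsOverconvergent v g) : IsOverconvergent v (f * g) := by
  obtain ⟨M, D, hM, h, h'⟩ := hf.exists_common hg
  exact ⟨M, D + D, hM, h.mul hM h'⟩

theorem IsOverconvergent.one : IsOverconvergent v (1 : MvPowerSeries ι K) :=
  ⟨1, 0, one_pos, GrowthBound.one one_pos⟩

theorem IsOverconvergent.pow {f : MvPowerSeries ι K} (hf : IsOverconvergent v f) (n : ℕ) :
    IsOverconvergent v (f ^ n) := by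
  induction n with
  | zero => simpa using IsOverconvergent.one
  | succ n ih => rw [pow_succ]; exact ih.mul hf

theorem IsOverconvergent.C (c : K) : IsOverconvergent v (MvPowerSeries.C (σ := ι) c) := by
  classical
  refine ⟨1, log (v c), one_pos, fun s => ?_⟩
  rw [coeff_C]
  split_ifs with h
  · subst h
    rcases eq_or_ne c 0 with rfl | hc
    · simp
    · simp [exp_log ((Valuation.ne_zero_iff (v)).2 hc)]
  · simp

theorem IsOverconvergent.X (i : ι) :
    IsOverconvergent v (MvPowerSeries.X i : MvPowerSeries ι K) :=
  ⟨1, 1, one_pos, GrowthBound.X one_pos i⟩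

theorem IsOverconvergent.map {f : MvPowerSeries ι K} (hf : IsOverconvergent v f) (φ : K →+* K)
    (hφ : ∀ a, v (φ a) ≤ v a) : IsOverconvergent v (MvPowerSeries.map φ f) := by
  obtain ⟨M, D, hM, h⟩ := hf
  refine ⟨M, D, hM, fun s => ?_⟩
  rw [coeff_map]
  exact (pow_le_pow_left₀ zero_le (hφ _) M).trans (h s)

theorem val_natCast_le_one (n : ℕ) : v (n : K) ≤ 1 := by
  induction n with
  | zero => simp
  | succ n ih =>
    push_cast
    exact (Valuation.map_add _ _ _).trans (max_le ih (by simp))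

theorem IsOverconvergent.pderiv {f : MvPowerSeries ι K} (hf : IsOverconvergent v f) (i : ι) :
    IsOverconvergent v (MvPowerSeries.pderiv K i f) := by
  obtain ⟨M, D, hM, h⟩ := hf
  refine ⟨M, D, hM, fun s => ?_⟩
  rw [coeff_pderiv, map_mul]
  have h1 : v ((s i : K) + 1) ≤ 1 := by
    exact_mod_cast val_natCast_le_one (v := v) (s i + 1)
  refine (pow_le_pow_left₀ zero_le (mul_le_of_le_one_right' h1) M).trans ((h _).trans ?_)
  rw [exp_le_exp, map_add]
  push_cast
  have : (0 : ℤ) ≤ ((Finsupp.single i (1 : ℕ)).degree : ℤ) := Int.natCast_nonneg _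
  linarith

/-- Substituting integral overconvergent series without constant term into an overconvergent
series gives an overconvergent series. -/
theorem IsOverconvergent.subst [Finite ι] {f : MvPowerSeries ι K} (hf : IsOverconvergent v f)
    {G : ι → MvPowerSeries κ K} (hG : HasSubst G) (hGo : ∀ i, IsOverconvergent v (G i))
    (hGi : ∀ i, IsIntegralSeries v (G i)) : IsOverconvergent v (MvPowerSeries.subst G f) := by
  classical
  have := Fintype.ofFinite ι
  obtain ⟨M, D, hM, hf⟩ := hf
  choose A B hA hB using hGo
  -- a common bound for the `G i`
  obtain ⟨L, E, hL, hE, hLE⟩ : ∃ (L E : ℕ), 0 < L ∧ 0 < E ∧ ∀ i, GrowthBound v L (E : ℤ) (G i) := by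
    refine ⟨∏ i, A i, ∑ i, ((∏ j, A j) * (B i).natAbs) + 1,
      Finset.prod_pos fun i _ => hA i, Nat.succ_pos _, fun i => ?_⟩
    have h1 : A i * ∏ j ∈ Finset.univ.erase i, A j = ∏ j, A j :=
      Finset.mul_prod_erase _ _ (Finset.mem_univ i)
    have h2 : 0 < ∏ j ∈ Finset.univ.erase i, A j := Finset.prod_pos fun i _ => hA i
    rw [← h1]
    refine ((hB i).scale h2).mono ?_
    have h3 : (∏ j, A j) * (B i).natAbs ≤ ∑ i, ((∏ j, A j) * (B i).natAbs) :=
      Finset.single_le_sum (f := fun i => (∏ j, A j) * (B i).natAbs)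
        (fun _ _ => Nat.zero_le _) (Finset.mem_univ i)
    rw [h1]
    have h4 : (∏ j ∈ Finset.univ.erase i, A j) ≤ ∏ j, A j := by
      rw [← h1]; exact Nat.le_mul_of_pos_left _ (hA i)
    have h5 : ((∏ j ∈ Finset.univ.erase i, A j : ℕ) : ℤ) * B i ≤
        ((∏ j ∈ Finset.univ.erase i, A j : ℕ) : ℤ) * ((B i).natAbs : ℤ) :=
      mul_le_mul_of_nonneg_left Int.le_natAbs (Int.natCast_nonneg _)
    have h6 : (∏ j ∈ Finset.univ.erase i, A j) * (B i).natAbs ≤ (∏ j, A j) * (B i).natAbs :=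
      Nat.mul_le_mul_right _ h4
    refine h5.trans ?_
    exact_mod_cast (h6.trans h3).trans (Nat.le_succ _)
  -- the slope may be relaxed at no cost in the constant, because the `G i` are integral
  have hG' : ∀ i, GrowthBound v (M * (L * E)) (E : ℤ) (G i) := fun i s => by
    rw [show M * (L * E) = L * (M * E) by ring, pow_mul]
    refine (pow_le_of_le_one zero_le (pow_le_one₀ zero_le (hGi i s))
      (Nat.mul_pos hM hE).ne').trans (hLE i s)
  have hLE' : 0 < L * E := Nat.mul_pos hL hE
  have hP : 0 < M * (L * E) := Nat.mul_pos hM hLE'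
  refine ⟨M * (L * E), ((L * E : ℕ) : ℤ) * D, hP, fun e => ?_⟩
  rw [coeff_subst hG]
  refine val_finsum_pow_le _ _ hP _ fun d => ?_
  have h1 : GrowthBound v (M * (L * E)) ((d.degree : ℤ) * E) (d.prod fun s n => G s ^ n) := by
    rw [Finsupp.prod]
    refine (GrowthBound.prod hP (D := fun i => (d i : ℤ) * E) _
      fun i _ => (hG' i).pow hP (d i)).mono (le_of_eq ?_)
    rw [Finsupp.degree_apply, ← Finset.sum_mul]
    push_cast
    rfl
  rw [smul_eq_mul, map_mul, mul_pow]
  have h2 : v (coeff d f) ^ (M * (L * E)) ≤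
      exp (((L * E : ℕ) : ℤ) * (D - (d.degree : ℤ))) := by
    rw [pow_mul]
    refine (pow_le_pow_left₀ zero_le (hf d) _).trans (le_of_eq ?_)
    rw [← exp_nsmul, nsmul_eq_mul]
  refine (mul_le_mul' h2 (h1 e)).trans ?_
  rw [← exp_add, exp_le_exp]
  have h3 : (1 : ℤ) ≤ L := by exact_mod_cast hL
  have h4 : (0 : ℤ) ≤ (d.degree : ℤ) * E := by positivity
  push_cast
  nlinarith

end Overconvergent

section Binomial

open WithZero

variable {K : Type*} [Field K] {v : Valuation K ℤᵐ⁰}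

variable (K) in
/-- The binomial series `(1 + X)^r = ∑ₙ binom(r, n) Xⁿ` with `r ∈ ℚ`, as a series over `K`. -/
def binomSeries (r : ℚ) : PowerSeries K := PowerSeries.mk fun n => ((Ring.choose r n : ℚ) : K)

theorem binomSeries_eq_map [CharZero K] (r : ℚ) :
    binomSeries K r = PowerSeries.map (algebraMap ℚ K) (PowerSeries.binomialSeries ℚ r) := by
  ext n
  simp [binomSeries]

theorem binomSeries_half_sq [CharZero K] : binomSeries K (1 / 2) ^ 2 = 1 + PowerSeries.X := by
  rw [binomSeries_eq_map, ← map_pow, pow_two, ← PowerSeries.binomialSeries_add, add_halves]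
  have := PowerSeries.binomialSeries_nat (R := ℚ) (A := ℚ) 1
  rw [Nat.cast_one, pow_one] at this
  rw [this]
  simp

theorem binomSeries_half_mul [CharZero K] :
    binomSeries K (1 / 2) * binomSeries K (-1 / 2) = 1 := by
  rw [binomSeries_eq_map, binomSeries_eq_map, ← map_mul, ← PowerSeries.binomialSeries_add,
    show (1 / 2 : ℚ) + -1 / 2 = 0 by norm_num, PowerSeries.binomialSeries_zero, map_one]

theorem binomSeries_coeff_zero (r : ℚ) : PowerSeries.coeff 0 (binomSeries K r) = 1 := by
  simp [binomSeries]

theorem val_binomSeries_half_le_one [CharZero K] (h2 : v 2 = 1) (n : ℕ) :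
    v (PowerSeries.coeff n (binomSeries K (1 / 2))) ≤ 1 := by
  induction n using Nat.strong_induction_on with
  | _ n ih =>
    rcases Nat.eq_zero_or_pos n with rfl | hn
    · rw [binomSeries_coeff_zero, map_one]
    have h := congrArg (PowerSeries.coeff n) (binomSeries_half_sq (K := K))
    rw [pow_two, PowerSeries.coeff_mul] at h
    set c := fun m => PowerSeries.coeff m (binomSeries K (1 / 2)) with hc
    have hc0 : c 0 = 1 := binomSeries_coeff_zero _
    obtain ⟨m, rfl⟩ : ∃ m, n = m + 1 := ⟨n - 1, by lia⟩
    rw [Finset.Nat.sum_antidiagonal_succ, Finset.Nat.sum_antidiagonal_eq_sum_range_succ_mk,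
      Finset.sum_range_succ] at h
    change c 0 * c (m + 1) + (∑ i ∈ Finset.range m, c (i + 1) * c (m - i) +
      c (m + 1) * c (m - m)) = _ at h
    rw [Nat.sub_self, hc0] at h
    have h3 : v (2 * c (m + 1)) ≤ 1 := by
      have : 2 * c (m + 1) = PowerSeries.coeff (m + 1) (1 + PowerSeries.X : PowerSeries K) -
          ∑ i ∈ Finset.range m, c (i + 1) * c (m - i) := by rw [← h]; ring
      rw [this]
      refine (Valuation.map_sub _ _ _).trans (max_le ?_ (Valuation.map_sum_le _ fun i hi => ?_))
      · rw [map_add, PowerSeries.coeff_one, PowerSeries.coeff_X]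
        refine (Valuation.map_add _ _ _).trans (max_le ?_ ?_) <;> split_ifs <;> simp
      · rw [map_mul]
        rw [Finset.mem_range] at hi
        exact mul_le_one' (ih _ (by lia)) (ih _ (by lia))
    rwa [map_mul, h2, one_mul] at h3

theorem val_binomSeries_neg_half_le_one [CharZero K] (h2 : v 2 = 1) (n : ℕ) :
    v (PowerSeries.coeff n (binomSeries K (-1 / 2))) ≤ 1 := by
  induction n using Nat.strong_induction_on with
  | _ n ih =>
    rcases Nat.eq_zero_or_pos n with rfl | hn
    · rw [binomSeries_coeff_zero, map_one]
    have h := congrArg (PowerSeries.coeff n) (binomSeries_half_mul (K := K))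
    obtain ⟨m, rfl⟩ : ∃ m, n = m + 1 := ⟨n - 1, by lia⟩
    rw [PowerSeries.coeff_mul, Finset.Nat.sum_antidiagonal_succ, binomSeries_coeff_zero, one_mul,
      ← eq_sub_iff_add_eq] at h
    rw [h]
    refine (Valuation.map_sub _ _ _).trans (max_le ?_ (Valuation.map_sum_le _ fun i hi => ?_))
    · rw [PowerSeries.coeff_one]
      split_ifs <;> simp
    · rw [map_mul]
      have := Finset.HasAntidiagonal.mem_antidiagonal.1 hi
      exact mul_le_one' (val_binomSeries_half_le_one h2 _) (ih _ (by lia))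

end Binomial

section Ring

variable {K : Type*} [Field K] (v : Valuation K ℤᵐ⁰)

/-- The ring `K⟨x, y, z⟩†` of overconvergent power series in three variables; the third variable
stands for `y⁻¹`. -/
def OC : Subalgebra K (MvPowerSeries (Fin 3) K) where
  carrier := {f | IsOverconvergent v f}
  mul_mem' hf hg := hf.mul hg
  add_mem' hf hg := hf.add hg
  algebraMap_mem' c := by
    rw [MvPowerSeries.algebraMap_apply]
    exact IsOverconvergent.C c

/-- The variables `x`, `y`, `z` of `K⟨x, y, z⟩†`. -/
def OC.X (i : Fin 3) : OC v := ⟨MvPowerSeries.X i, IsOverconvergent.X i⟩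

/-- The ideal `(y z - 1, y² - Q(x))` of `K⟨x, y, z⟩†`. -/
def relIdeal (Q : K[X]) : Ideal (OC v) :=
  Ideal.span {OC.X v 1 * OC.X v 2 - 1, OC.X v 1 ^ 2 - Polynomial.aeval (OC.X v 0) Q}

/-- The ring `A† ⊗ K`, where `A†` is the weak completion of `A = R[x, y, y⁻¹] / (y² - Q(x))` and
`K` is the fraction field of the discrete valuation ring `R`: overconvergent series in
`x`, `y`, `z = y⁻¹` over `K` modulo the relations `y z = 1` and `y² = Q(x)`. -/
def Dagger (Q : K[X]) := OC v ⧸ relIdeal v Q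

variable (Q : K[X])

instance : CommRing (Dagger v Q) := inferInstanceAs (CommRing (OC v ⧸ relIdeal v Q))

instance : Algebra K (Dagger v Q) := inferInstanceAs (Algebra K (OC v ⧸ relIdeal v Q))

/-- The quotient map onto `A† ⊗ K`. -/
def toDagger : OC v →ₐ[K] Dagger v Q := Ideal.Quotient.mkₐ K (relIdeal v Q)

theorem toDagger_eq_zero_iff (f : OC v) : toDagger v Q f = 0 ↔ f ∈ relIdeal v Q :=
  Ideal.Quotient.eq_zero_iff_mem

theorem toDagger_surjective : Function.Surjective (toDagger v Q) :=
  Ideal.Quotient.mk_surjective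

theorem toDagger_y_mul_z : toDagger v Q (OC.X v 1) * toDagger v Q (OC.X v 2) = 1 := by
  have h : OC.X v 1 * OC.X v 2 - 1 ∈ relIdeal v Q := Ideal.subset_span (Set.mem_insert _ _)
  rw [← toDagger_eq_zero_iff, map_sub, map_mul, map_one, sub_eq_zero] at h
  exact h

/-- The function `x`. -/
def xA : Dagger v Q := toDagger v Q (OC.X v 0)

/-- The invertible function `y`. -/
def yA : (Dagger v Q)ˣ where
  val := toDagger v Q (OC.X v 1)
  inv := toDagger v Q (OC.X v 2)
  val_inv := toDagger_y_mul_z v Q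
  inv_val := by rw [mul_comm]; exact toDagger_y_mul_z v Q

theorem yA_sq : (yA v Q : Dagger v Q) ^ 2 = Polynomial.aeval (xA v Q) Q := by
  have h : OC.X v 1 ^ 2 - Polynomial.aeval (OC.X v 0) Q ∈ relIdeal v Q :=
    Ideal.subset_span (Set.mem_insert_of_mem _ rfl)
  rw [← toDagger_eq_zero_iff, map_sub, map_pow, sub_eq_zero] at h
  refine h.trans ?_
  exact (Polynomial.aeval_algHom_apply (toDagger v Q) _ _).symm

/-- The endomorphism of `K⟨x, y, z⟩†` that applies `φ` to the coefficients and substitutes `G i`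
for the `i`-th variable. -/
def OC.substHom (φ : K →+* K) (hφ : ∀ a, v (φ a) ≤ v a) (G : Fin 3 → MvPowerSeries (Fin 3) K)
    (hG : MvPowerSeries.HasSubst G) (hGo : ∀ i, IsOverconvergent v (G i))
    (hGi : ∀ i, IsIntegralSeries v (G i)) : OC v →+* OC v :=
  (((MvPowerSeries.substAlgHom (R := K) hG).toRingHom.comp (MvPowerSeries.map φ)).comp
    (OC v).val.toRingHom).codRestrict (OC v) fun f => by
      have h := ((show IsOverconvergent v f.1 from f.2).map φ hφ).subst hG hGo hGi
      rw [← MvPowerSeries.coe_substAlgHom hG] at h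
      exact h

theorem OC.substHom_X (φ : K →+* K) (hφ : ∀ a, v (φ a) ≤ v a)
    (G : Fin 3 → MvPowerSeries (Fin 3) K) (hG : MvPowerSeries.HasSubst G)
    (hGo : ∀ i, IsOverconvergent v (G i)) (hGi : ∀ i, IsIntegralSeries v (G i)) (i : Fin 3) :
    OC.substHom v φ hφ G hG hGo hGi (OC.X v i) = ⟨G i, hGo i⟩ := by
  refine Subtype.ext ?_
  change MvPowerSeries.substAlgHom (R := K) hG (MvPowerSeries.map φ (MvPowerSeries.X i)) = G i
  rw [MvPowerSeries.map_X, MvPowerSeries.substAlgHom_X]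

theorem OC.substHom_algebraMap (φ : K →+* K) (hφ : ∀ a, v (φ a) ≤ v a)
    (G : Fin 3 → MvPowerSeries (Fin 3) K) (hG : MvPowerSeries.HasSubst G)
    (hGo : ∀ i, IsOverconvergent v (G i)) (hGi : ∀ i, IsIntegralSeries v (G i)) (a : K) :
    OC.substHom v φ hφ G hG hGo hGi (algebraMap K (OC v) a) = algebraMap K (OC v) (φ a) := by
  refine Subtype.ext ?_
  change MvPowerSeries.substAlgHom (R := K) hG (MvPowerSeries.map φ (algebraMap K _ a)) =
    algebraMap K _ (φ a)
  rw [MvPowerSeries.algebraMap_apply, Algebra.algebraMap_self_apply, MvPowerSeries.map_C,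
    MvPowerSeries.c_eq_algebraMap, AlgHom.commutes]

theorem OC.substHom_aeval (φ : K →+* K) (hφ : ∀ a, v (φ a) ≤ v a)
    (G : Fin 3 → MvPowerSeries (Fin 3) K) (hG : MvPowerSeries.HasSubst G)
    (hGo : ∀ i, IsOverconvergent v (G i)) (hGi : ∀ i, IsIntegralSeries v (G i)) (f : OC v)
    (P : K[X]) :
    OC.substHom v φ hφ G hG hGo hGi (Polynomial.aeval f P) =
      Polynomial.aeval (OC.substHom v φ hφ G hG hGo hGi f) (P.map φ) := by
  have h : (OC.substHom v φ hφ G hG hGo hGi).comp (algebraMap K (OC v)) =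
      (algebraMap K (OC v)).comp φ := RingHom.ext fun a =>
    OC.substHom_algebraMap v φ hφ G hG hGo hGi a
  rw [Polynomial.aeval_def, Polynomial.hom_eval₂, h, Polynomial.aeval_def, Polynomial.eval₂_map]

end Ring

section Differentials

variable {K : Type*} [Field K] (v : Valuation K ℤᵐ⁰)

/-- The partial derivatives on `K⟨x, y, z⟩†`. -/
def OC.pderiv (i : Fin 3) : Derivation K (OC v) (OC v) :=
  Derivation.mk'
    { toFun := fun f => ⟨MvPowerSeries.pderiv K i f.1, IsOverconvergent.pderiv f.2 i⟩
      map_add' := fun f g => Subtype.ext (map_add (MvPowerSeries.pderiv K i) f.1 g.1)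
      map_smul' := fun c f => Subtype.ext ((MvPowerSeries.pderiv K i).map_smul c f.1) }
    fun f g => Subtype.ext ((MvPowerSeries.pderiv K i).leibniz f.1 g.1)

theorem OC.pderiv_X_self (i : Fin 3) : OC.pderiv v i (OC.X v i) = 1 :=
  Subtype.ext MvPowerSeries.pderiv_X_self

theorem OC.pderiv_X_of_ne {i j : Fin 3} (h : j ≠ i) : OC.pderiv v i (OC.X v j) = 0 :=
  Subtype.ext (MvPowerSeries.pderiv_X_of_ne h)

variable (Q : K[X])

/-- The derivation `f ↦ y ∂f/∂x + (Q'(x)/2) (∂f/∂y - z² ∂f/∂z)` of `K⟨x, y, z⟩†`. -/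
def derOC : Derivation K (OC v) (OC v) :=
  OC.X v 1 • OC.pderiv v 0 +
    ((2⁻¹ : K) • Polynomial.aeval (OC.X v 0) (Polynomial.derivative Q)) •
      (OC.pderiv v 1 - OC.X v 2 ^ 2 • OC.pderiv v 2)

theorem derOC_x : derOC v Q (OC.X v 0) = OC.X v 1 := by
  simp [derOC, OC.pderiv_X_self, OC.pderiv_X_of_ne]

theorem derOC_y : derOC v Q (OC.X v 1) =
    (2⁻¹ : K) • Polynomial.aeval (OC.X v 0) (Polynomial.derivative Q) := by
  simp [derOC, OC.pderiv_X_self, OC.pderiv_X_of_ne]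

theorem derOC_z : derOC v Q (OC.X v 2) = -(OC.X v 2 ^ 2 * derOC v Q (OC.X v 1)) := by
  have h0 : OC.pderiv v 0 (OC.X v 2) = 0 := OC.pderiv_X_of_ne v (by decide)
  have h1 : OC.pderiv v 1 (OC.X v 2) = 0 := OC.pderiv_X_of_ne v (by decide)
  have h2 : OC.pderiv v 2 (OC.X v 2) = 1 := OC.pderiv_X_self v 2
  rw [derOC_y, derOC]
  simp only [Derivation.add_apply, Derivation.smul_apply, Derivation.sub_apply, h0, h1, h2,
    smul_eq_mul]
  ring

theorem derOC_mem [CharZero K] {f : OC v} (hf : f ∈ relIdeal v Q) : derOC v Q f ∈ relIdeal v Q := by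
  have h1 : OC.X v 1 * OC.X v 2 - 1 ∈ relIdeal v Q := Ideal.subset_span (Set.mem_insert _ _)
  have h2 : OC.X v 1 ^ 2 - Polynomial.aeval (OC.X v 0) Q ∈ relIdeal v Q :=
    Ideal.subset_span (Set.mem_insert_of_mem _ rfl)
  have h3 : derOC v Q (OC.X v 1 * OC.X v 2 - 1) ∈ relIdeal v Q := by
    have : derOC v Q (OC.X v 1 * OC.X v 2 - 1) =
        -(OC.X v 2 * derOC v Q (OC.X v 1)) * (OC.X v 1 * OC.X v 2 - 1) := by
      rw [map_sub, Derivation.leibniz, Derivation.map_one_eq_zero, derOC_z, smul_eq_mul,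
        smul_eq_mul]
      ring
    rw [this]
    exact Ideal.mul_mem_left _ _ h1
  have h4 : derOC v Q (OC.X v 1 ^ 2 - Polynomial.aeval (OC.X v 0) Q) ∈ relIdeal v Q := by
    have : derOC v Q (OC.X v 1 ^ 2 - Polynomial.aeval (OC.X v 0) Q) = 0 := by
      rw [map_sub, pow_two, Derivation.leibniz, Derivation.map_aeval, derOC_x, derOC_y,
        ← add_smul, smul_eq_mul, smul_eq_mul, mul_smul_comm, ← two_mul, mul_assoc,
        ← smul_mul_assoc, ← mul_assoc]
      have h : (2⁻¹ : K) • (2 : OC v) = 1 := by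
        rw [Algebra.smul_def, ← map_ofNat (algebraMap K (OC v)) 2, ← map_mul,
          inv_mul_cancel₀ two_ne_zero, map_one]
      simp only [smul_mul_assoc]
      rw [mul_assoc, ← smul_mul_assoc, h, one_mul, mul_comm, sub_self]
    rw [this]
    exact zero_mem _
  obtain ⟨a, b, rfl⟩ := Ideal.mem_span_pair.1 hf
  rw [map_add, Derivation.leibniz, Derivation.leibniz]
  simp only [smul_eq_mul]
  refine add_mem (add_mem (Ideal.mul_mem_left _ _ h3) (Ideal.mul_mem_right _ _ h1))
    (add_mem (Ideal.mul_mem_left _ _ h4) (Ideal.mul_mem_right _ _ h2))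

/-- The module of differentials of `A† ⊗ K` over `K`: it is free of rank one with generator
`dx/y`. The differential `f dx/y` is represented by the function `f`. -/
def DaggerForm := Dagger v Q

instance : AddCommGroup (DaggerForm v Q) := inferInstanceAs (AddCommGroup (Dagger v Q))

instance : Module (Dagger v Q) (DaggerForm v Q) :=
  inferInstanceAs (Module (Dagger v Q) (Dagger v Q))

instance : Module K (DaggerForm v Q) := inferInstanceAs (Module K (Dagger v Q))

instance : IsScalarTower K (Dagger v Q) (DaggerForm v Q) :=
  inferInstanceAs (IsScalarTower K (Dagger v Q) (Dagger v Q))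

/-- The function `f` in `ω = f dx/y`, as an isomorphism of modules. -/
def DaggerForm.coef : DaggerForm v Q ≃ₗ[Dagger v Q] Dagger v Q := LinearEquiv.refl _ _

/-- The differential `dx/y`. -/
def dxOverY : DaggerForm v Q := (DaggerForm.coef v Q).symm 1

variable [CharZero K]

/-- The map `d` on functions, lifted to `K⟨x, y, z⟩†`; see `dA_toDagger`. -/
def dFun (f : Dagger v Q) : DaggerForm v Q :=
  (DaggerForm.coef v Q).symm
    (toDagger v Q (derOC v Q (Function.surjInv (toDagger_surjective v Q) f)))

theorem dFun_toDagger (f : OC v) :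
    dFun v Q (toDagger v Q f) = (DaggerForm.coef v Q).symm (toDagger v Q (derOC v Q f)) := by
  rw [dFun, EmbeddingLike.apply_eq_iff_eq, ← sub_eq_zero, ← map_sub, ← map_sub,
    toDagger_eq_zero_iff]
  refine derOC_mem v Q ?_
  rw [← toDagger_eq_zero_iff, map_sub, Function.surjInv_eq (toDagger_surjective v Q), sub_self]

/-- The universal derivation `d : A† ⊗ K → Ω`. It is induced by
`f ↦ (y ∂f/∂x + (Q'(x)/2) (∂f/∂y - z² ∂f/∂z)) dx/y`, that is, `dx = y (dx/y)`,
`dy = (Q'(x)/2) (dx/y)` and `dz = -z² dy` for `z = y⁻¹`. -/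
def dA : Derivation K (Dagger v Q) (DaggerForm v Q) :=
  Derivation.mk'
    { toFun := dFun v Q
      map_add' := fun f g => by
        obtain ⟨f, rfl⟩ := toDagger_surjective v Q f
        obtain ⟨g, rfl⟩ := toDagger_surjective v Q g
        rw [← map_add, dFun_toDagger, dFun_toDagger, dFun_toDagger, map_add, map_add, map_add]
      map_smul' := fun c f => by
        obtain ⟨f, rfl⟩ := toDagger_surjective v Q f
        rw [← map_smul, dFun_toDagger, dFun_toDagger, Derivation.map_smul, map_smul]
        rfl }
    fun f g => by
      obtain ⟨f, rfl⟩ := toDagger_surjective v Q f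
      obtain ⟨g, rfl⟩ := toDagger_surjective v Q g
      change dFun v Q _ = _ • dFun v Q _ + _ • dFun v Q _
      rw [← map_mul, dFun_toDagger, dFun_toDagger, dFun_toDagger, ← LinearEquiv.map_smul,
        ← LinearEquiv.map_smul, ← map_add, Derivation.leibniz, map_add, smul_eq_mul, smul_eq_mul,
        smul_eq_mul, smul_eq_mul, map_mul, map_mul]

theorem dA_toDagger (f : OC v) :
    dA v Q (toDagger v Q f) = (DaggerForm.coef v Q).symm (toDagger v Q (derOC v Q f)) :=
  dFun_toDagger v Q f

variable {v Q} in
/-- Two differentials are cohomologous if they differ by `df` for some `f ∈ A† ⊗ K`. -/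
def Cohomologous (ω η : DaggerForm v Q) : Prop := ∃ f : Dagger v Q, ω - η = dA v Q f

variable {v Q} in
/-- `B(x) dx/y` is a reduction of `ω`: it is cohomologous to `ω`, and `deg B ≤ 2g - 1`. -/
def IsReduction (g : ℕ) (ω : DaggerForm v Q) (B : K[X]) : Prop :=
  B.degree < ((2 * g : ℕ) : WithBot ℕ) ∧
    Cohomologous ω (Polynomial.aeval (xA v Q) B • dxOverY v Q)

end Differentials

section Frobenius

open MvPowerSeries WithZero

variable (p : ℕ) [Fact p.Prime] (k : Type*) [Field k] [CharP k p] [PerfectRing k p]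

/-- `ℤ_q`: for `k = 𝔽_q` the ring of Witt vectors of `k` is the ring of integers of the unramified
extension `ℚ_q` of `ℚ_p` with residue field `k`. -/
abbrev Zq := WittVector p k

/-- `ℚ_q`, the fraction field of `ℤ_q`. -/
abbrev Qq := FractionRing (Zq p k)

instance charZero_Zq : CharZero (Zq p k) := by
  refine charZero_of_inj_zero fun n hn => ?_
  by_contra hne
  obtain ⟨a, m, hm, rfl⟩ := Nat.exists_eq_pow_mul_and_not_dvd hne p
    (Fact.out : p.Prime).ne_one
  have hp0 : (p : Zq p k) ≠ 0 := WittVector.p_nonzero p k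
  push_cast at hn
  rcases mul_eq_zero.1 hn with h | h
  · exact hp0 (eq_zero_of_pow_eq_zero h)
  · apply hm
    have := congrArg (WittVector.constantCoeff (p := p) (R := k)) h
    rw [map_natCast, map_zero] at this
    exact (CharP.cast_eq_zero_iff k p m).1 this

variable (K : Type*) [Field K] [Algebra (Zq p k) K] [IsFractionRing (Zq p k) K]

/-- The `p`-adic valuation of `K = ℚ_q`, written multiplicatively: `val a = exp (-v_p(a))`. -/
def val : Valuation K ℤᵐ⁰ :=
  (IsDiscreteValuationRing.maximalIdeal (Zq p k)).valuation K

/-- The Witt vector Frobenius on `K = ℚ_q`. -/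
def phi : K →+* K :=
  (IsFractionRing.ringEquivOfRingEquiv (K := K) (L := K) (WittVector.frobeniusEquiv p k) : K ≃+* K)

theorem phi_algebraMap (a : Zq p k) :
    phi p k K (algebraMap (Zq p k) K a) = algebraMap (Zq p k) K (WittVector.frobenius a) :=
  IsFractionRing.ringEquivOfRingEquiv_algebraMap (K := K) (L := K) _ a

theorem val_algebraMap_le_one (a : Zq p k) : val p k K (algebraMap (Zq p k) K a) ≤ 1 :=
  IsDedekindDomain.HeightOneSpectrum.valuation_le_one _ a

theorem val_phi_le_one {a : K} (h : val p k K a ≤ 1) : val p k K (phi p k K a) ≤ 1 := by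
  obtain ⟨b, rfl⟩ := IsDiscreteValuationRing.exists_lift_of_le_one h
  rw [phi_algebraMap]
  exact val_algebraMap_le_one _ _ _ _

theorem val_p : val p k K (p : K) = exp (-1 : ℤ) := by
  rw [← map_natCast (algebraMap (Zq p k) K), val,
    IsDedekindDomain.HeightOneSpectrum.valuation_of_algebraMap]
  exact IsDedekindDomain.HeightOneSpectrum.intValuation_singleton _
    (WittVector.p_nonzero p k) (WittVector.irreducible p).maximalIdeal_eq

theorem val_phi_le (a : K) : val p k K (phi p k K a) ≤ val p k K a := by
  rcases eq_or_ne a 0 with rfl | ha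
  · simp
  have hv : val p k K a ≠ 0 := (Valuation.ne_zero_iff _).2 ha
  obtain ⟨n, hn⟩ : ∃ n : ℤ, val p k K a = exp n := ⟨log (val p k K a), (exp_log hv).symm⟩
  have h1 : val p k K (a * (p : K) ^ n) ≤ 1 := by
    rw [map_mul, map_zpow₀, val_p, hn, ← exp_zsmul, ← exp_add]
    simp
  have h2 := val_phi_le_one p k K h1
  rw [map_mul, map_zpow₀, map_natCast, map_mul, map_zpow₀, val_p, ← exp_zsmul] at h2
  rw [hn]
  have h3 := mul_le_mul_left h2 (exp n)
  rw [mul_assoc, ← exp_add] at h3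
  simpa using h3

theorem val_two (hp : 3 ≤ p) : val p k K 2 = 1 := by
  have h2 : (2 : K) = algebraMap (Zq p k) K 2 := (map_ofNat (algebraMap (Zq p k) K) 2).symm
  refine le_antisymm (h2 ▸ val_algebraMap_le_one p k K 2) (not_lt.1 fun h => ?_)
  rw [h2] at h
  have h3 := (IsDedekindDomain.HeightOneSpectrum.valuation_lt_one_iff_mem _ _).1 h
  change (2 : Zq p k) ∈ IsLocalRing.maximalIdeal _ at h3
  rw [(WittVector.irreducible p).maximalIdeal_eq, ← WittVector.ker_constantCoeff,
    RingHom.mem_ker, map_ofNat] at h3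
  have h4 : ((2 : ℕ) : k) = 0 := by exact_mod_cast h3
  have := Nat.le_of_dvd two_pos ((CharP.cast_eq_zero_iff k p 2).1 h4)
  lia

variable {p k}
variable (Q : (Zq p k)[X])

/-- The polynomial `Q(x)^σ - Q(x)^p`, where `Q(x)^σ` is obtained from `Q(x)` by applying the Witt
vector Frobenius to the coefficients and replacing `x` by `x^p`. -/
def frobDefect : (Zq p k)[X] :=
  Polynomial.expand (Zq p k) p (Q.map WittVector.frobenius) - Q ^ p

theorem frobDefect_coeff (n : ℕ) : (p : Zq p k) ∣ (frobDefect Q).coeff n := by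
  rw [← Ideal.mem_span_singleton, ← WittVector.ker_constantCoeff, RingHom.mem_ker,
    ← Polynomial.coeff_map]
  have h : (frobDefect Q).map (WittVector.constantCoeff (p := p) (R := k)) = 0 := by
    rw [frobDefect, Polynomial.map_sub, Polynomial.map_pow, Polynomial.map_expand,
      Polynomial.map_map, sub_eq_zero, ← Polynomial.map_frobenius_expand, Polynomial.map_expand,
      Polynomial.map_map]
    congr 2
    ext a
    simp [frobenius_def, WittVector.coeff_frobenius_charP]
  rw [h, Polynomial.coeff_zero]

/-- The series `(Q(x)^σ - Q(x)^p) z^{2p}`, where `z = y⁻¹`. -/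
def frobArg : MvPowerSeries (Fin 3) K :=
  Polynomial.aeval (MvPowerSeries.X 0) ((frobDefect Q).map (algebraMap (Zq p k) K)) *
    MvPowerSeries.X 2 ^ (2 * p)

theorem hasSubst_frobArg : PowerSeries.HasSubst (frobArg K Q) := by
  refine PowerSeries.HasSubst.of_constantCoeff_zero ?_
  have : 2 * p ≠ 0 := by have := (Fact.out : p.Prime).pos; lia
  simp [frobArg, this]

theorem growthBound_frobArg :
    GrowthBound (val p k K) ((frobDefect Q).natDegree + 2 * p) 0 (frobArg K Q) := by
  classical
  have hM : 0 < (frobDefect Q).natDegree + 2 * p := by have := (Fact.out : p.Prime).pos; lia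
  intro s
  rw [frobArg, Polynomial.aeval_eq_sum_range, Finset.sum_mul, map_sum]
  refine val_sum_pow_le _ _ _ hM _ fun n hn => ?_
  rw [Finset.mem_range, Nat.lt_succ_iff] at hn
  replace hn := hn.trans (Polynomial.natDegree_map_le)
  rw [smul_mul_assoc, MvPowerSeries.coeff_smul, MvPowerSeries.X_pow_eq, MvPowerSeries.X_pow_eq,
    MvPowerSeries.monomial_mul_monomial, MvPowerSeries.coeff_monomial]
  split_ifs with hs
  · subst hs
    rw [mul_one, mul_one, Polynomial.coeff_map]
    obtain ⟨a, ha⟩ := frobDefect_coeff Q n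
    rw [ha, map_mul, map_mul, map_natCast, val_p]
    refine (pow_le_pow_left₀ zero_le
      (mul_le_of_le_one_right' (val_algebraMap_le_one p k K a)) _).trans ?_
    rw [← exp_nsmul, exp_le_exp, map_add, Finsupp.degree_single, Finsupp.degree_single]
    simp only [nsmul_eq_mul]
    push_cast
    have : (n : ℤ) ≤ (frobDefect Q).natDegree := by exact_mod_cast hn
    linarith
  · rw [mul_zero, map_zero, zero_pow hM.ne']
    exact zero_le

theorem growthBound_subst_frobArg (c : PowerSeries K)
    (hc : ∀ n, val p k K (PowerSeries.coeff n c) ≤ 1) :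
    ∃ M, 0 < M ∧ GrowthBound (val p k K) M 0 (PowerSeries.subst (frobArg K Q) c) := by
  have hM : 0 < (frobDefect Q).natDegree + 2 * p := by have := (Fact.out : p.Prime).pos; lia
  refine ⟨_, hM, fun s => ?_⟩
  rw [PowerSeries.coeff_subst (hasSubst_frobArg K Q)]
  refine val_finsum_pow_le _ _ hM _ fun n => ?_
  rw [smul_eq_mul, map_mul]
  refine (pow_le_pow_left₀ zero_le (mul_le_of_le_one_left' (hc n)) _).trans ?_
  simpa using (growthBound_frobArg K Q).pow hM n s

/-- The images of the variables `x`, `y`, `z = y⁻¹` under the lift of Frobenius: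
`x ↦ x^p`, `z ↦ z^p ∑ₙ binom(-1/2, n) (Q(x)^σ - Q(x)^p)^n z^{2pn}`, and `y` is sent to
`y^p ∑ₙ binom(1/2, n) (Q(x)^σ - Q(x)^p)^n z^{2pn}`, the inverse of the image of `z`. -/
def frobVar : Fin 3 → MvPowerSeries (Fin 3) K :=
  ![MvPowerSeries.X 0 ^ p,
    MvPowerSeries.X 1 ^ p * PowerSeries.subst (frobArg K Q) (binomSeries K (1 / 2)),
    MvPowerSeries.X 2 ^ p * PowerSeries.subst (frobArg K Q) (binomSeries K (-1 / 2))]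

theorem hasSubst_frobVar : MvPowerSeries.HasSubst (frobVar K Q) := by
  have hp := (Fact.out : p.Prime).ne_zero
  refine MvPowerSeries.hasSubst_of_constantCoeff_zero fun i => ?_
  fin_cases i <;> simp [frobVar, hp]

variable [CharZero K]

theorem subst_half_overconvergent (hp : 3 ≤ p) :
    ∃ M, 0 < M ∧
      GrowthBound (val p k K) M 0 (PowerSeries.subst (frobArg K Q) (binomSeries K (1 / 2))) :=
  growthBound_subst_frobArg K Q _ fun n => val_binomSeries_half_le_one (val_two p k K hp) n

theorem subst_neg_half_overconvergent (hp : 3 ≤ p) :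
    ∃ M, 0 < M ∧
      GrowthBound (val p k K) M 0 (PowerSeries.subst (frobArg K Q) (binomSeries K (-1 / 2))) :=
  growthBound_subst_frobArg K Q _ fun n => val_binomSeries_neg_half_le_one (val_two p k K hp) n

theorem frobVar_spec (hp : 3 ≤ p) (i : Fin 3) :
    IsOverconvergent (val p k K) (frobVar K Q i) ∧
      IsIntegralSeries (val p k K) (frobVar K Q i) := by
  obtain ⟨M, hM, h⟩ := subst_half_overconvergent K Q hp
  obtain ⟨L, hL, h'⟩ := subst_neg_half_overconvergent K Q hp
  have hX : ∀ j : Fin 3, IsOverconvergent (val p k K) (MvPowerSeries.X j ^ p) :=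
    fun j => (IsOverconvergent.X j).pow p
  have hX' : ∀ j : Fin 3, IsIntegralSeries (val p k K) (MvPowerSeries.X j ^ p) :=
    fun j => (IsIntegralSeries.X j).pow p
  fin_cases i
  · exact ⟨hX 0, hX' 0⟩
  · exact ⟨(hX 1).mul ⟨M, 0, hM, h⟩, (hX' 1).mul (h.isIntegralSeries hM)⟩
  · exact ⟨(hX 2).mul ⟨L, 0, hL, h'⟩, (hX' 2).mul (h'.isIntegralSeries hL)⟩

/-- The lift of Frobenius on `K⟨x, y, z⟩†`: apply the Witt vector Frobenius to the coefficients
and substitute the images of the variables. -/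
def frobOC (hp : 3 ≤ p) : OC (val p k K) →+* OC (val p k K) :=
  OC.substHom (val p k K) (phi p k K) (val_phi_le p k K) (frobVar K Q) (hasSubst_frobVar K Q)
    (fun i => (frobVar_spec K Q hp i).1) (fun i => (frobVar_spec K Q hp i).2)

/-- The polynomial `Q` over `ℚ_q`. -/
abbrev QK : K[X] := Q.map (algebraMap (Zq p k) K)

/-- `A† ⊗ ℚ_q`, where `A†` is the weak completion of `A = ℤ_q[x, y, y⁻¹] / (y² - Q(x))`. -/
abbrev ADagger := Dagger (val p k K) (QK K Q)

/-- The differentials of `A†` over `ℚ_q`. -/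
abbrev Omega := DaggerForm (val p k K) (QK K Q)

theorem relIdeal_le_comap (hp : 3 ≤ p) :
    relIdeal (val p k K) (QK K Q) ≤ (relIdeal (val p k K) (QK K Q)).comap (frobOC K Q hp) := by
  obtain ⟨M, hM, h⟩ := subst_half_overconvergent K Q hp
  obtain ⟨L, hL, h'⟩ := subst_neg_half_overconvergent K Q hp
  set O := OC (val p k K) with hO
  set x : O := OC.X (val p k K) 0
  set y : O := OC.X (val p k K) 1
  set z : O := OC.X (val p k K) 2
  let s : O := ⟨PowerSeries.subst (frobArg K Q) (binomSeries K (1 / 2)), ⟨M, 0, hM, h⟩⟩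
  let t : O := ⟨PowerSeries.subst (frobArg K Q) (binomSeries K (-1 / 2)), ⟨L, 0, hL, h'⟩⟩
  have hsub := hasSubst_frobArg K Q
  have hst : s * t = 1 := by
    refine Subtype.ext ?_
    change PowerSeries.subst _ _ * PowerSeries.subst _ _ = (1 : MvPowerSeries (Fin 3) K)
    rw [← PowerSeries.subst_mul hsub, binomSeries_half_mul, ← PowerSeries.coe_substAlgHom hsub,
      map_one]
  have hss : s ^ 2 = 1 + Polynomial.aeval x (QK K (frobDefect Q)) * z ^ (2 * p) := by
    refine Subtype.ext ?_
    have hx : ((Polynomial.aeval x (QK K (frobDefect Q)) : O) : MvPowerSeries (Fin 3) K) =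
        Polynomial.aeval (MvPowerSeries.X 0) (QK K (frobDefect Q)) :=
      (Polynomial.aeval_algHom_apply O.val x _).symm
    change PowerSeries.subst _ _ ^ 2 =
      1 + ((Polynomial.aeval x (QK K (frobDefect Q)) : O) : MvPowerSeries (Fin 3) K) *
        MvPowerSeries.X 2 ^ (2 * p)
    rw [hx, ← PowerSeries.subst_pow hsub, binomSeries_half_sq, PowerSeries.subst_add hsub,
      PowerSeries.subst_X hsub, ← PowerSeries.coe_substAlgHom hsub, map_one]
    rfl
  have hfx : frobOC K Q hp x = x ^ p :=
    (OC.substHom_X _ _ _ _ _ _ _ 0).trans (Subtype.ext rfl)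
  have hfy : frobOC K Q hp y = y ^ p * s :=
    (OC.substHom_X _ _ _ _ _ _ _ 1).trans (Subtype.ext rfl)
  have hfz : frobOC K Q hp z = z ^ p * t :=
    (OC.substHom_X _ _ _ _ _ _ _ 2).trans (Subtype.ext rfl)
  have hfQ : frobOC K Q hp (Polynomial.aeval x (QK K Q)) =
      Polynomial.aeval x (QK K (Polynomial.expand _ p (Q.map WittVector.frobenius))) := by
    have hcomp : (phi p k K).comp (algebraMap (Zq p k) K) =
        (algebraMap (Zq p k) K).comp WittVector.frobenius :=
      RingHom.ext fun a => phi_algebraMap p k K a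
    rw [frobOC, OC.substHom_aeval, ← frobOC, hfx, QK, QK, Polynomial.map_map, hcomp,
      Polynomial.map_expand, Polynomial.expand_aeval, Polynomial.map_map]
    exact hp
  have hE : Polynomial.aeval x (QK K (frobDefect Q)) =
      Polynomial.aeval x (QK K (Polynomial.expand _ p (Q.map WittVector.frobenius))) -
        Polynomial.aeval x (QK K Q) ^ p := by
    simp only [QK, frobDefect, Polynomial.map_sub, Polynomial.map_pow, map_sub, map_pow]
  set π := toDagger (val p k K) (QK K Q)
  have hyz : π y * π z = 1 := toDagger_y_mul_z _ _
  have hyQ : π y ^ 2 = π (Polynomial.aeval x (QK K Q)) := by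
    have := toDagger_eq_zero_iff (val p k K) (QK K Q)
      (y ^ 2 - Polynomial.aeval x (QK K Q)) |>.2 (Ideal.subset_span (Set.mem_insert_of_mem _ rfl))
    rwa [map_sub, map_pow, sub_eq_zero] at this
  rw [relIdeal, Ideal.span_le]
  rintro f (rfl | rfl)
  · change frobOC K Q hp (y * z - 1) ∈ relIdeal _ _
    rw [← toDagger_eq_zero_iff, map_sub, map_mul, map_one, hfy, hfz,
      show y ^ p * s * (z ^ p * t) = (y * z) ^ p * (s * t) by ring, hst, mul_one, map_sub,
      map_pow, map_mul, map_one]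
    change (π y * π z) ^ p - 1 = 0
    rw [hyz, one_pow, sub_self]
  · change frobOC K Q hp (y ^ 2 - Polynomial.aeval x (QK K Q)) ∈ relIdeal _ _
    rw [← toDagger_eq_zero_iff, map_sub, map_pow, hfy, mul_pow, hss, hE, hfQ]
    set R := Polynomial.aeval x (QK K (Polynomial.expand _ p (Q.map WittVector.frobenius)))
    change π _ = 0
    simp only [map_sub, map_mul, map_add, map_pow, map_one]
    rw [← hyQ]
    have h1 : π y ^ (2 * p) * π z ^ (2 * p) = 1 := by rw [← mul_pow, hyz, one_pow]
    linear_combination (π R - (π y ^ 2) ^ p) * h1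

/-- The lift `σ` of the `p`-power Frobenius, as an endomorphism of `A† ⊗ ℚ_q`. -/
def frobA (hp : 3 ≤ p) : ADagger K Q →+* ADagger K Q :=
  Ideal.quotientMap (relIdeal (val p k K) (QK K Q)) (frobOC K Q hp) (relIdeal_le_comap K Q hp)

/-- The action of `σ` on differentials: `σ(f dg) = f^σ d(g^σ)`, so that a differential
`f dx/y = f y⁻¹ dx` is sent to `f^σ (y⁻¹)^σ d(x^σ)`. -/
def frobForm (hp : 3 ≤ p) (ω : Omega K Q) : Omega K Q :=
  (frobA K Q hp (DaggerForm.coef _ _ ω) *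
      frobA K Q hp ((yA (val p k K) (QK K Q))⁻¹ : (ADagger K Q)ˣ)) •
    dA _ _ (frobA K Q hp (xA _ _))

/-- The differential `x^i dx/y`. -/
def basisForm (i : ℕ) : Omega K Q :=
  xA (val p k K) (QK K Q) ^ i • dxOverY (val p k K) (QK K Q)

/-- The coefficients `B_{j,r} = p C_{j,r}^σ ∑_{j ≤ m < N} (-1)^{m+j} binom(-1/2, m) binom(m, j)`,
where `C_{j,r}` is the coefficient of `x^r` in `Q(x)^j`. -/
def coeffB (N j r : ℕ) : K :=
  p * algebraMap (Zq p k) K (WittVector.frobenius ((Q ^ j).coeff r)) *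
    ∑ m ∈ Finset.Ico j N, (-1) ^ (m + j) * ((Ring.choose (-1 / 2 : ℚ) m : ℚ) : K) * (m.choose j : K)

/-- The pairs `(j, r)` with `0 ≤ j < N` and `0 ≤ r ≤ (2g+1)j`. -/
def termIndex (g N : ℕ) : Finset (Σ _ : ℕ, ℕ) :=
  (Finset.range N).sigma fun j => Finset.range ((2 * g + 1) * j + 1)

/-- `T_i = ∑_{j < N} ∑_{r ≤ (2g+1)j} B_{j,r} x^{p(i+r+1)-1} y^{-p(2j+1)+1} dx/y`. -/
def approxT (g N i : ℕ) : Omega K Q :=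
  ∑ t ∈ termIndex g N,
    (algebraMap K (ADagger K Q) (coeffB K Q N t.1 t.2) *
      xA (val p k K) (QK K Q) ^ (p * (i + t.2 + 1) - 1) *
      ((yA (val p k K) (QK K Q) ^ (-(p : ℤ) * (2 * t.1 + 1) + 1) : (ADagger K Q)ˣ) :
        ADagger K Q)) • dxOverY (val p k K) (QK K Q)

end Frobenius

end HyperellipticMW

end

open HyperellipticMW

/-! Write β_n = binom(-1/2, n) and m = (p-1)/2 + pn. By definition of σ, the form σ(x^i dx/y) is the
sum over n ≥ 0 of the terms p β_n x^(p(i+1)-1) (Q^σ - Q^p)^n y^(-2m) dx/y (`exists_frobForm_eq`).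
Since Q^p = y^(2p), the binomial theorem identifies T_i with the part n < N of this sum
(`approxT_eq`). It remains to show that the part n ≥ N has a reduction divisible by p^N. As p
divides Q^σ - Q^p, the n-th term is p^(n+1) times an integral form A(x) y^(-2m) dx/y, and the
question is how large the denominators in its reduction are.

Lowering the pole order one step at a time divides by 2j - 1 at a zero of Q and by 2j + deg Q at
infinity, and would seem to accumulate the product of these numbers. Only a common multiple is
needed, because d becomes diagonal in suitable expansions: at the zeros of Q, expansions in powers
of Q whose coefficients are functions of an approximate root τ of Q near x, with negligible
derivative (`exists_exactNum_vertical_aux`); at infinity, powers of an approximate root of Q of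
order deg Q (`exists_exactNum_horizontal_step`). Over ℤ_q the common multiple is a power of p whose
exponent is logarithmic in the pole orders (`exists_exactNum_add_Zq`). For the n-th term the
exponent is 1 + l with l about log_p(2n+1), so p^(n-l) survives (`exists_reduction_frobTerm`), and n
- l ≥ N for n ≥ N because p > 2N + 1.

Two points concern infinite series. Existence: the reductions of the single terms are summed to a
reduction in the weak completion, the primitive being overconvergent because n - l grows linearly
(`exists_isReduction`). Uniqueness: reduction defines a linear functional on polynomials in x, y, z
= y⁻¹ that kills relations and exact forms and loses only logarithmic precision; applied to
truncations of overconvergent series, it shows that an exact B(x) dx/y with deg B < 2g is zero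
(`eq_zero_of_exact`). -/

noncomputable section

namespace HyperellipticMW

/-! ### Reduction of A(x) / Q(x)^m dx/y over a commutative ring, with few denominators. -/

section AlgebraicReduction

open Polynomial

variable {R : Type*} [CommRing R]

/-- With `y² = Q(x)`, the numerator of `d(2 U(x) y / Q(x)^m)` with respect to
`Q(x)^(-m) dx/y`. -/
def exactNum (Q : R[X]) (m : ℕ) (U : R[X]) : R[X] :=
  2 * Q * derivative U - (2 * (m : R[X]) - 1) * derivative Q * U

theorem exactNum_add (Q : R[X]) (m : ℕ) (U V : R[X]) :
    exactNum Q m (U + V) = exactNum Q m U + exactNum Q m V := by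
  simp only [exactNum, map_add]
  ring

theorem exactNum_C_mul (Q : R[X]) (m : ℕ) (c : R) (U : R[X]) :
    exactNum Q m (C c * U) = C c * exactNum Q m U := by
  simp only [exactNum, derivative_C_mul]
  ring

theorem exactNum_sub (Q : R[X]) (m : ℕ) (U V : R[X]) :
    exactNum Q m (U - V) = exactNum Q m U - exactNum Q m V := by
  simp only [exactNum, map_sub]
  ring

/-- U y / Q^m and Q^n U y / Q^(m+n) are the same function, so they have the same differential. -/
theorem exactNum_pow_mul (Q : R[X]) (m n : ℕ) (U : R[X]) :
    exactNum Q (m + n) (Q ^ n * U) = Q ^ n * exactNum Q m U := by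
  simp only [exactNum, derivative_mul, derivative_pow, map_natCast]
  rcases n with _ | n
  · simp
  · push_cast
    ring

theorem exactNum_map {S : Type*} [CommRing S] (φ : R →+* S) (Q : R[X]) (m : ℕ) (U : R[X]) :
    (exactNum Q m U).map φ = exactNum (Q.map φ) m (U.map φ) := by
  simp [exactNum, derivative_map]

/-- An approximate root `τ` of `Q` near `x`, modulo `Q ^ n`. -/
theorem exists_approx_root (Q : R[X]) (hQ : IsCoprime Q (derivative Q)) (n : ℕ) :
    ∃ τ : R[X], Q ∣ τ - X ∧ Q ^ n ∣ Q.comp τ := by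
  obtain ⟨S, T, hST⟩ := hQ
  induction n with
  | zero => exact ⟨X, by simp, by simp⟩
  | succ n ih =>
    rcases Nat.eq_zero_or_pos n with rfl | hn
    · exact ⟨X, by simp, by simp⟩
    obtain ⟨τ, ⟨a, ha⟩, ⟨b, hb⟩⟩ := ih
    obtain ⟨e, he⟩ := binomExpansion (Q.map C) τ (-(T * Q.comp τ))
    obtain ⟨f, hf⟩ := evalSubFactor ((derivative Q).map C) τ X
    have hev : ∀ P s : R[X], (P.map C).eval s = P.comp s := fun P s => by
      rw [eval_map, comp]
    rw [derivative_map] at he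
    simp only [hev] at he hf
    obtain ⟨l, rfl⟩ : ∃ l, n = l + 1 := ⟨n - 1, by lia⟩
    -- Newton step with T, the inverse of Q' modulo Q, in place of 1 / Q'(τ). This gains just one
    -- factor Q per step. The quadratic error Q^(2n) is at least that good only for n ≥ 1, hence the
    -- separate start.
    refine ⟨τ - T * Q.comp τ, ?_, ?_⟩
    · refine ⟨a - T * Q ^ l * b, ?_⟩
      rw [hb]
      linear_combination ha
    · rw [sub_eq_add_neg, he]
      rw [comp_X] at hf
      refine ⟨b * S - T * b * f * a + e * T ^ 2 * Q ^ l * b ^ 2, ?_⟩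
      have h1 : (derivative Q).comp τ = derivative Q + f * (Q * a) := by
        rw [← ha]; linear_combination hf
      rw [h1, hb]
      linear_combination (-b * Q ^ (l + 1)) * hST

/-- For τ an approximate root of Q, functions A(τ) are constants of the derivation Q d/dx modulo
Q^m. Hence Q^l A(τ) y / Q^m has, modulo Q^m, the differential -(2(m-l) - 1) Q^l Q' A(τ): in an
expansion in powers of Q with such coefficients, d is diagonal. Each level l divides c itself by one
number 2(m-l) - 1, so c need not be divisible by the product. -/
theorem exists_exactNum_vertical_aux (Q : R[X]) (hQ : IsCoprime Q (derivative Q)) (m : ℕ) (c : R)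
    (hc : ∀ j, 1 ≤ j → j ≤ m → (2 * (j : R) - 1) ∣ c) (A : R[X]) :
    ∃ U : R[X], Q ^ m ∣ C c * A - exactNum Q m U := by
  obtain ⟨τ, hτ, hτ'⟩ := exists_approx_root Q hQ m
  -- Differentiating Q(τ) ≡ 0 costs one power of Q, which the factor Q restores; Q'(τ) is prime to Q
  -- and can be cancelled.
  have hd : Q ^ m ∣ Q * derivative τ := by
    rcases m with _ | m
    · simp
    have h1 : Q ^ m ∣ derivative (Q.comp τ) := by
      obtain ⟨b, hb⟩ := hτ'
      rw [hb, derivative_mul, derivative_pow]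
      refine ⟨C ((m + 1 : ℕ) : R) * derivative Q * b + Q * derivative b, ?_⟩
      rw [Nat.add_sub_cancel]
      ring
    rw [derivative_comp] at h1
    have h2 : IsCoprime (Q ^ m) ((derivative Q).comp τ) := by
      refine IsCoprime.pow_left ?_
      obtain ⟨f, hf⟩ := evalSubFactor ((derivative Q).map C) τ X
      rw [eval_map, eval_map, ← comp, ← comp, comp_X] at hf
      obtain ⟨a, ha⟩ := hτ
      have : (derivative Q).comp τ = derivative Q + Q * (f * a) := by
        linear_combination hf + f * ha
      rw [this]
      exact hQ.add_mul_left_right _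
    rw [pow_succ']
    exact mul_dvd_mul_left _ (h2.dvd_of_dvd_mul_right h1)
  -- Descending induction on the level l: A is replaced by A(τ), and the difference, a multiple of
  -- Q, is passed on to level l + 1 before anything is divided.
  have key : ∀ n l, l + n = m → ∀ A : R[X],
      ∃ U : R[X], Q ^ m ∣ C c * (Q ^ l * derivative Q * A) - exactNum Q m U := by
    intro n
    induction n with
    | zero =>
      rintro l rfl A
      exact ⟨0, ⟨C c * (derivative Q * A), by simp [exactNum]; ring⟩⟩
    | succ n ih =>
      intro l hl A
      obtain ⟨f, hf⟩ := evalSubFactor (A.map C) τ X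
      rw [eval_map, eval_map, ← comp, ← comp, comp_X] at hf
      obtain ⟨a, ha⟩ := hτ
      obtain ⟨U, hU⟩ := ih (l + 1) (by lia) (-(f * a))
      obtain ⟨d, hd'⟩ := hc (m - l) (by lia) (by lia)
      have hml : ((m - l : ℕ) : R) = m - l := by rw [Nat.cast_sub (by lia)]
      rw [hml] at hd'
      refine ⟨U + C (-d) * (Q ^ l * A.comp τ), ?_⟩
      obtain ⟨b, hb⟩ := hd
      obtain ⟨e, he⟩ := hU
      refine ⟨e + 2 * C d * Q ^ l * (derivative A).comp τ * b, ?_⟩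
      have hCc : C c = (2 * ((m : R[X]) - l) - 1) * C d := by
        rw [hd']; simp only [map_mul, map_sub, map_natCast, map_one, map_ofNat]
      have hml' : exactNum Q m (Q ^ l * A.comp τ) =
          Q ^ l * (2 * Q * derivative τ * (derivative A).comp τ -
            (2 * ((m : R[X]) - l) - 1) * derivative Q * A.comp τ) := by
        obtain ⟨t, rfl⟩ : ∃ t, m = t + l := ⟨m - l, by lia⟩
        rw [exactNum_pow_mul, exactNum, derivative_comp]
        push_cast
        ring
      rw [exactNum_add, exactNum_C_mul, hml']
      have h1 : A = A.comp τ - f * a * Q := by linear_combination -hf - f * ha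
      nth_rewrite 1 [h1]
      rw [C_neg]
      linear_combination he + 2 * C d * Q ^ l * (derivative A).comp τ * hb +
        (Q ^ l * derivative Q * A.comp τ) * hCc
  -- Every A is Q' times something modulo Q^m, so level 0 of `key` covers all A.
  have hcop : IsCoprime (Q ^ m) (derivative Q) := hQ.pow_left
  obtain ⟨S, T, hST⟩ := hcop
  obtain ⟨U, e, he⟩ := key m 0 (by lia) (T * A)
  refine ⟨U, e + C c * S * A, ?_⟩
  linear_combination he - C c * A * hST

theorem natDegree_exactNum_le (Q : R[X]) (m : ℕ) (U : R[X]) :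
    (exactNum Q m U).natDegree ≤ Q.natDegree + U.natDegree - 1 := by
  rcases Nat.eq_zero_or_pos Q.natDegree with hQ | hQ
  · rw [natDegree_eq_zero] at hQ
    obtain ⟨a, rfl⟩ := hQ
    have : exactNum (C a) m U = C (2 * a) * derivative U := by
      simp only [exactNum, derivative_C, C_mul, map_ofNat]; ring
    rw [this]
    refine (natDegree_C_mul_le _ _).trans ((natDegree_derivative_le U).trans (by simp))
  rcases Nat.eq_zero_or_pos U.natDegree with hU | hU
  · rw [natDegree_eq_zero] at hU
    obtain ⟨a, rfl⟩ := hU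
    have : exactNum Q m (C a) = C (-((2 * (m : R) - 1) * a)) * derivative Q := by
      simp only [exactNum, derivative_C, C_mul, map_ofNat, C_neg, C_sub, map_natCast, map_one]
      ring
    rw [this]
    refine (natDegree_C_mul_le _ _).trans ((natDegree_derivative_le Q).trans (by simp))
  have h1 := natDegree_derivative_le U
  have h2 := natDegree_derivative_le Q
  have e1 : (2 * Q * derivative U).natDegree ≤ Q.natDegree + U.natDegree - 1 := by
    rw [mul_assoc, ← map_ofNat C 2]
    refine (natDegree_C_mul_le _ _).trans (natDegree_mul_le.trans (by lia))
  have e2 : ((2 * (m : R[X]) - 1) * derivative Q * U).natDegree ≤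
      Q.natDegree + U.natDegree - 1 := by
    have : (2 * (m : R[X]) - 1) * derivative Q * U =
        C (2 * (m : R) - 1) * (derivative Q * U) := by
      simp only [C_mul, map_ofNat, C_sub, map_natCast, map_one]
      ring
    rw [this]
    refine (natDegree_C_mul_le _ _).trans (natDegree_mul_le.trans (by lia))
  exact natDegree_sub_le_of_le e1 e2 |>.trans (by simp)

/-- Reduction of the pole order along the Weierstrass points. -/
theorem exists_exactNum_vertical (Q : R[X]) (hmon : Q.Monic) (hQ : IsCoprime Q (derivative Q))
    (hQd : 2 ≤ Q.natDegree) (m : ℕ) (c : R)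
    (hc : ∀ j, 1 ≤ j → j ≤ m → (2 * (j : R) - 1) ∣ c) (A : R[X])
    (hA : A.natDegree < m * Q.natDegree) :
    ∃ U B : R[X], C c * A = exactNum Q m U + Q ^ m * B ∧ U.natDegree < m * Q.natDegree ∧
      B.natDegree < Q.natDegree - 1 := by
  obtain ⟨U, b, hb⟩ := exists_exactNum_vertical_aux Q hQ m c hc A
  have hm : (Q ^ m).Monic := hmon.pow m
  have hdm : (Q ^ m).natDegree = m * Q.natDegree := by
    nontriviality R
    rw [hmon.natDegree_pow]
  have h1 := modByMonic_add_div U (Q ^ m)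
  set V := U %ₘ (Q ^ m)
  set W := U /ₘ (Q ^ m)
  have hV : V.natDegree < m * Q.natDegree := by
    rw [← hdm]
    refine natDegree_modByMonic_lt _ hm ?_
    intro h
    rw [h, natDegree_one] at hdm
    lia
  -- The part Q^m W of U contributes d(2 W y), which has no pole at the zeros of Q. It can be moved
  -- into B, so that U may be taken of degree less than that of Q^m.
  have hW : exactNum Q m (Q ^ m * W) = Q ^ m * exactNum Q 0 W := by
    have := exactNum_pow_mul Q 0 m W
    rwa [zero_add] at this
  have h2 : C c * A - exactNum Q m V = Q ^ m * (b + exactNum Q 0 W) := by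
    have : exactNum Q m U = exactNum Q m V + exactNum Q m (Q ^ m * W) := by
      rw [← exactNum_add, h1]
    linear_combination hb + this + hW
  refine ⟨V, b + exactNum Q 0 W, by linear_combination h2, hV, ?_⟩
  -- Division by the monic Q^m leaves degree at most deg Q - 2.
  have h3 : (Q ^ m * (b + exactNum Q 0 W)).natDegree ≤ Q.natDegree + m * Q.natDegree - 2 := by
    rw [← h2]
    refine (natDegree_sub_le _ _).trans (max_le ?_ ?_)
    · refine (natDegree_C_mul_le _ _).trans (by lia)
    · refine (natDegree_exactNum_le _ _ _).trans (by lia)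
  rcases eq_or_ne (b + exactNum Q 0 W) 0 with h0 | h0
  · rw [h0, natDegree_zero]; lia
  · rw [hm.natDegree_mul' h0, hdm] at h3
    lia

/-- Newton's method at the root 1 of η^r = 1, which is simple because r is a unit: each further
coefficient of η solves a linear equation with leading coefficient r. -/
theorem exists_approx_power_root (q : R[X]) (h0 : q.coeff 0 = 1) (r : ℕ) (hr : IsUnit (r : R))
    (M : ℕ) : ∃ η : R[X], η.coeff 0 = 1 ∧ X ^ M ∣ q - η ^ r := by
  rcases r with _ | r
  · have : Subsingleton R := by
      rw [Nat.cast_zero, isUnit_zero_iff] at hr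
      exact subsingleton_of_zero_eq_one hr
    exact ⟨1, by simp, ⟨0, Subsingleton.elim _ _⟩⟩
  induction M with
  | zero => exact ⟨1, by simp, by simp⟩
  | succ M ih =>
    rcases Nat.eq_zero_or_pos M with rfl | hM
    · refine ⟨1, by simp, ?_⟩
      rw [zero_add, pow_one, X_dvd_iff]
      simp [h0]
    obtain ⟨η, hη, b, hb⟩ := ih
    obtain ⟨u, hu⟩ := hr.exists_right_inv
    obtain ⟨k, hk⟩ := binomExpansion (X ^ (r + 1) : R[X][X]) η (C (u * b.coeff 0) * X ^ M)
    simp only [derivative_X_pow, eval_mul, eval_pow, eval_X, eval_natCast, map_natCast,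
      Nat.add_sub_cancel] at hk
    have h1 : X ∣ b - ((r + 1 : ℕ) : R[X]) * η ^ r * C (u * b.coeff 0) := by
      rw [X_dvd_iff, coeff_sub, coeff_mul_C, mul_coeff_zero, coeff_zero_eq_eval_zero (η ^ r),
        eval_pow, ← coeff_zero_eq_eval_zero, hη, coeff_natCast_ite]
      simp only [if_true, one_pow, mul_one, ← mul_assoc, hu, one_mul, sub_self]
    obtain ⟨d, hd⟩ := h1
    obtain ⟨l, rfl⟩ : ∃ l, M = l + 1 := ⟨M - 1, by lia⟩
    refine ⟨η + C (u * b.coeff 0) * X ^ (l + 1), by simp [hη], ?_⟩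
    rw [hk]
    refine ⟨d - k * C (u * b.coeff 0) ^ 2 * X ^ l, ?_⟩
    linear_combination hb + X ^ (l + 1) * hd

/-- The Euler operator x d/dx changes sign under x ↦ 1/x, and the factor x^n of the reflection adds
n. -/
theorem reflect_X_mul_derivative (n : ℕ) (U : R[X]) (hU : U.natDegree ≤ n) :
    reflect n (X * derivative U) = C (n : R) * reflect n U - X * derivative (reflect n U) := by
  have hX : ∀ (P : R[X]) (i : ℕ), (X * derivative P).coeff i = i * P.coeff i := by
    intro P i
    rcases i with _ | i
    · simp
    · rw [coeff_X_mul, coeff_derivative]; push_cast; ring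
  ext i
  rw [coeff_reflect, coeff_sub, coeff_C_mul, hX, hX, coeff_reflect]
  rcases le_or_gt i n with h | h
  · rw [revAt_le h, Nat.cast_sub h]; ring
  · rw [revAt_eq_self_of_lt h, coeff_eq_zero_of_natDegree_lt (by lia : U.natDegree < i)]; ring

theorem natDegree_X_mul_derivative_le (P : R[X]) : (X * derivative P).natDegree ≤ P.natDegree := by
  rcases Nat.eq_zero_or_pos P.natDegree with hP | hP
  · rw [natDegree_eq_zero] at hP
    obtain ⟨a, rfl⟩ := hP
    simp
  · refine natDegree_mul_le.trans ((Nat.add_le_add_right natDegree_X_le _).trans ?_)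
    have := natDegree_derivative_le P
    lia

theorem degree_C_mul_lt {P : R[X]} {n : WithBot ℕ} (c : R) (h : P.degree < n) :
    (C c * P).degree < n := by
  rw [← smul_eq_C_mul]
  exact (degree_smul_le c P).trans_lt h

/-- The truncation of a polynomial. -/
theorem exists_truncation (f : R[X]) (n : ℕ) :
    ∃ u : R[X], u.natDegree ≤ n ∧ X ^ (n + 1) ∣ f - u := by
  nontriviality R
  refine ⟨f %ₘ X ^ (n + 1), ?_, f /ₘ X ^ (n + 1), ?_⟩
  · have := natDegree_modByMonic_lt f (monic_X_pow (n + 1) : (X ^ (n + 1) : R[X]).Monic)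
      (by intro h; simpa using congrArg natDegree h)
    rw [natDegree_X_pow] at this
    lia
  · linear_combination -(modByMonic_add_div f (X ^ (n + 1)))

/-- For every `n` there is an exact form at infinity with leading terms
`(2n + r) (x ^ (n + r - 1) + ...)`, up to terms of degree less than `r - 1`. -/
theorem exists_exactNum_horizontal_step (Q : R[X]) (hmon : Q.Monic) (hr : 0 < Q.natDegree)
    (hu : IsUnit (Q.natDegree : R)) (n : ℕ) :
    ∃ U P B : R[X], U.natDegree ≤ n ∧ P.natDegree ≤ n + Q.natDegree - 1 ∧
      P.coeff (n + Q.natDegree - 1) = 1 ∧ B.degree < (Q.natDegree - 1 : ℕ) ∧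
      exactNum Q 0 U = C (2 * (n : R) + Q.natDegree) * P + B := by
  set r := Q.natDegree with hrdef
  set q := reflect r Q
  have hq0 : q.coeff 0 = 1 := by
    rw [coeff_reflect, revAt_zero]; exact hmon
  -- Put w = x η(1/x), so that w^r agrees with Q to high order at infinity. The U below is the
  -- polynomial part of w^n. With U = w^n and Q = w^r, the expression 2QU' + Q'U is exactly (2n + r)
  -- w^(n+r-1) w', which explains the single factor 2n + r.
  obtain ⟨η, hη, b, hb⟩ := exists_approx_power_root q hq0 r hu (n + 1)
  obtain ⟨u, hudeg, a, ha⟩ := exists_truncation (η ^ n) n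
  -- This is x w^(n+r-1) w' written in the coordinate 1/x, without its factor x^(r+n).
  set h := η ^ (r + n) - X * η ^ (r + n - 1) * derivative η
  obtain ⟨t, ht⟩ : ∃ t, r = t + 1 := ⟨r - 1, by lia⟩
  set U := reflect n u
  have hUd : U.natDegree ≤ n := natDegree_reflect_le.trans (by simp [hudeg])
  have hUu : reflect n U = u := reflect_reflect
  have hX : (X * exactNum Q 0 U).natDegree ≤ r + n := by
    refine natDegree_mul_le.trans ((Nat.add_le_add_right natDegree_X_le _).trans ?_)
    have := natDegree_exactNum_le Q 0 U
    lia
  have hG : reflect (r + n) (X * exactNum Q 0 U) =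
      2 * q * (C (n : R) * u - X * derivative u) + (C (r : R) * q - X * derivative q) * u := by
    have : X * exactNum Q 0 U = C 2 * (Q * (X * derivative U)) + (X * derivative Q) * U := by
      simp only [exactNum, map_ofNat, Nat.cast_zero]; ring
    rw [this, reflect_add, reflect_C_mul, reflect_mul Q _ le_rfl ((natDegree_X_mul_derivative_le U).trans hUd),
      reflect_mul _ U (natDegree_X_mul_derivative_le Q) hUd, reflect_X_mul_derivative n U hUd,
      reflect_X_mul_derivative r Q le_rfl, hUu, map_ofNat]
    ring
  -- Agreement to order n + 1 at infinity controls the coefficients of x^(r-1) and above; all others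
  -- go into B.
  have hcong : X ^ (n + 1) ∣ reflect (r + n) (X * exactNum Q 0 U) -
      C (2 * (n : R) + r) * h := by
    have e1 : u = η ^ n - X ^ (n + 1) * a := by linear_combination -ha
    have e2 : q = η ^ r + X ^ (n + 1) * b := by linear_combination hb
    have e3 : X * derivative u = (n : R[X]) * η ^ (n - 1) * X * derivative η -
        X ^ (n + 1) * (((n : R[X]) + 1) * a + X * derivative a) := by
      rw [e1]
      simp only [derivative_sub, derivative_mul, derivative_pow, derivative_X, map_natCast,
        Nat.add_sub_cancel]
      push_cast
      ring
    have e4 : X * derivative q = (r : R[X]) * η ^ (r - 1) * X * derivative η +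
        X ^ (n + 1) * (((n : R[X]) + 1) * b + X * derivative b) := by
      rw [e2]
      simp only [derivative_add, derivative_mul, derivative_pow, derivative_X, map_natCast,
        Nat.add_sub_cancel]
      push_cast
      ring
    have f1 : (n : R[X]) * (η ^ r * η ^ (n - 1)) = n * η ^ (r + n - 1) := by
      rcases n with _ | n
      · simp
      · rw [← pow_add]; rfl
    have f2 : η ^ (r - 1) * η ^ n = η ^ (r + n - 1) := by
      rw [← pow_add]; congr 1; lia
    have f3 : η ^ r * η ^ n = η ^ (r + n) := (pow_add _ _ _).symm
    refine ⟨2 * b * ((n : R[X]) * u - X * derivative u) +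
      2 * η ^ r * (-((n : R[X]) * a) + (((n : R[X]) + 1) * a + X * derivative a)) +
      ((r : R[X]) * b - (((n : R[X]) + 1) * b + X * derivative b)) * u -
      ((r : R[X]) * η ^ r - (r : R[X]) * η ^ (r - 1) * X * derivative η) * a, ?_⟩
    rw [hG]
    simp only [h, map_add, map_mul, map_natCast, map_ofNat]
    linear_combination (2 * (n * u - X * derivative u) + r * u) * e2 +
      (2 * η ^ r * n + r * η ^ r - r * η ^ (r - 1) * X * derivative η) * e1 - 2 * η ^ r * e3 -
      u * e4 + (2 * n + r : R[X]) * f3 - 2 * X * derivative η * f1 - r * X * derivative η * f2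
  obtain ⟨H, hHdeg, hH⟩ := exists_truncation h n
  have hh0 : h.coeff 0 = 1 := by
    simp only [h, coeff_sub, mul_assoc, coeff_X_mul_zero, sub_zero]
    rw [coeff_zero_eq_eval_zero, eval_pow, ← coeff_zero_eq_eval_zero, hη, one_pow]
  rw [X_pow_dvd_iff] at hH hcong
  have hHc : ∀ l ≤ n, H.coeff l = h.coeff l := fun l hl => by
    have := hH l (by lia)
    rw [coeff_sub, sub_eq_zero] at this
    exact this.symm
  have hPdeg : (reflect n H * X ^ (r - 1)).natDegree ≤ n + r - 1 := by
    refine natDegree_mul_le.trans ?_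
    have h1 : (reflect n H).natDegree ≤ n := natDegree_reflect_le.trans (by simp [hHdeg])
    have h2 := natDegree_X_pow_le (R := R) (r - 1)
    lia
  refine ⟨U, reflect n H * X ^ (r - 1), _, hUd, hPdeg, ?_, ?_, (add_sub_cancel _ _).symm⟩
  · rw [show n + r - 1 = n + (r - 1) by lia, coeff_mul_X_pow, coeff_reflect, revAt_le le_rfl,
      Nat.sub_self, hHc 0 (Nat.zero_le _), hh0]
  · rw [degree_lt_iff_coeff_zero]
    intro i hi
    rw [coeff_sub, coeff_C_mul]
    rcases le_or_gt (i + 1) (r + n) with hin | hin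
    · obtain ⟨j, rfl⟩ : ∃ j, i = j + (r - 1) := ⟨i - (r - 1), by lia⟩
      have h1 := hcong (n - j) (by lia)
      rw [coeff_sub, coeff_C_mul, coeff_reflect, revAt_le (by lia),
        show r + n - (n - j) = j + (r - 1) + 1 by lia, coeff_X_mul] at h1
      rw [coeff_mul_X_pow, coeff_reflect, revAt_le (by lia), hHc _ (by lia)]
      exact h1
    · rw [coeff_eq_zero_of_natDegree_lt, coeff_eq_zero_of_natDegree_lt (hPdeg.trans_lt (by lia))]
      · simp
      · have := natDegree_exactNum_le Q 0 U
        lia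

/-- Reduction of the pole order at infinity. -/
theorem exists_exactNum_horizontal (Q : R[X]) (hmon : Q.Monic) (hr : 0 < Q.natDegree)
    (hu : IsUnit (Q.natDegree : R)) (c : R) (n : ℕ)
    (hc : ∀ j < n, (2 * (j : R) + Q.natDegree) ∣ c) (A : R[X])
    (hA : A.degree < (n + Q.natDegree - 1 : ℕ)) :
    ∃ U B : R[X], C c * A = exactNum Q 0 U + B ∧ U.natDegree ≤ n ∧
      B.degree < (Q.natDegree - 1 : ℕ) := by
  induction n generalizing A with
  | zero =>
    refine ⟨0, C c * A, by simp [exactNum], by simp, ?_⟩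
    rw [zero_add] at hA
    exact degree_C_mul_lt c hA
  | succ n ih =>
    obtain ⟨U, P, B, hU, hP, hP1, hB, h⟩ := exists_exactNum_horizontal_step Q hmon hr hu n
    set a := A.coeff (n + Q.natDegree - 1)
    have hA' : (A - C a * P).degree < (n + Q.natDegree - 1 : ℕ) := by
      rw [degree_lt_iff_coeff_zero] at hA ⊢
      intro i hi
      rw [coeff_sub, coeff_C_mul]
      rcases hi.eq_or_lt with rfl | hi
      · rw [hP1, mul_one, sub_self]
      · rw [hA i (by lia), coeff_eq_zero_of_natDegree_lt (hP.trans_lt hi), mul_zero, sub_zero]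
    obtain ⟨V, D, hV, hVd, hD⟩ := ih (fun j hj => hc j (by lia)) _ hA'
    -- The number 2n + deg Q is divided out of c only in the coefficient of U. The remainder A - aP
    -- is integral and the induction has used the whole of c for it, so no product of denominators
    -- arises.
    obtain ⟨d, hd⟩ := hc n (by lia)
    refine ⟨V + C (d * a) * U, D - C (d * a) * B, ?_, ?_, ?_⟩
    · rw [exactNum_add, exactNum_C_mul, h]
      have : C c = C (2 * (n : R) + Q.natDegree) * C d := by rw [← C_mul, hd]
      rw [C_mul]
      linear_combination hV + C a * P * this
    · refine natDegree_add_le_of_degree_le (by lia) ((natDegree_C_mul_le _ _).trans (by lia))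
    · refine (degree_sub_le _ _).trans_lt (max_lt hD (degree_C_mul_lt _ hB))

/-- The reduction of `A(x) / Q(x)^m dx/y`, with control of the denominators. -/
theorem exists_exactNum_add (Q : R[X]) (hmon : Q.Monic) (hQ : IsCoprime Q (derivative Q))
    (hQd : 2 ≤ Q.natDegree) (hu : IsUnit (Q.natDegree : R)) (m n : ℕ) (c : R)
    (hc : ∀ j, 1 ≤ j → j ≤ m → (2 * (j : R) - 1) ∣ c)
    (hc' : ∀ j < n, (2 * (j : R) + Q.natDegree) ∣ c) (A : R[X])
    (hA : A.degree < (m * Q.natDegree + n + Q.natDegree - 1 : ℕ)) :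
    ∃ U B : R[X], C c * A = exactNum Q m U + Q ^ m * B ∧ U.natDegree ≤ m * Q.natDegree + n ∧
      B.degree < (Q.natDegree - 1 : ℕ) := by
  nontriviality R
  have hm : (Q ^ m).Monic := hmon.pow m
  have hdm : (Q ^ m).natDegree = m * Q.natDegree := hmon.natDegree_pow m
  -- Division by Q^m separates the poles at the zeros of Q from the pole at infinity, and the same c
  -- serves for both.
  have h1 := modByMonic_add_div A (Q ^ m)
  set A₀ := A %ₘ Q ^ m
  set A₁ := A /ₘ Q ^ m with hA₁
  have hA₁d : A₁.degree < (n + Q.natDegree - 1 : ℕ) := by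
    rcases eq_or_ne A₁ 0 with h0 | h0
    · rw [h0, degree_zero]; exact WithBot.bot_lt_coe _
    · rcases eq_or_ne A 0 with hA0 | hA0
      · exfalso; apply h0; rw [hA₁, hA0, zero_divByMonic]
      rw [degree_eq_natDegree h0, Nat.cast_lt, hA₁, natDegree_divByMonic _ hm, hdm]
      rw [degree_eq_natDegree hA0, Nat.cast_lt] at hA
      lia
  obtain ⟨U₁, B₁, h₁, hU₁, hB₁⟩ :=
    exists_exactNum_horizontal Q hmon (by lia) hu c n hc' A₁ hA₁d
  obtain ⟨U₀, B₀, h₀, hU₀, hB₀⟩ : ∃ U B : R[X], C c * A₀ = exactNum Q m U + Q ^ m * B ∧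
      U.natDegree ≤ m * Q.natDegree ∧ B.degree < (Q.natDegree - 1 : ℕ) := by
    rcases Nat.eq_zero_or_pos m with rfl | hm0
    · refine ⟨0, 0, ?_, by simp, ?_⟩
      · simp [A₀, exactNum]
      · rw [degree_zero]; exact WithBot.bot_lt_coe _
    · have h2 : A₀.natDegree < m * Q.natDegree := by
        rw [← hdm]
        refine natDegree_modByMonic_lt A hm fun h => ?_
        rw [h, natDegree_one] at hdm
        have := Nat.mul_pos hm0 (by lia : 0 < Q.natDegree)
        lia
      obtain ⟨U, B, h, hU, hB⟩ := exists_exactNum_vertical Q hmon hQ hQd m c hc A₀ h2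
      exact ⟨U, B, h, hU.le, degree_le_natDegree.trans_lt (by exact_mod_cast hB)⟩
  refine ⟨U₀ + Q ^ m * U₁, B₀ + B₁, ?_, ?_, ?_⟩
  · have := exactNum_pow_mul Q 0 m U₁
    rw [zero_add] at this
    rw [exactNum_add, this]
    linear_combination -(C c) * h1 + h₀ + Q ^ m * h₁
  · refine natDegree_add_le_of_degree_le (by lia) (natDegree_mul_le.trans ?_)
    rw [hdm]
    lia
  · exact (degree_add_le _ _).trans_lt (max_lt hB₀ hB₁)

/-- The forms `B(x) dx/y` with `deg B < deg Q - 1` have independent classes. -/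
theorem eq_zero_of_exactNum_add_eq_zero {F : Type*} [Field F] [CharZero F] (Q : F[X])
    (hQ : IsCoprime Q (derivative Q)) (hQd : 2 ≤ Q.natDegree) (m : ℕ)
    (U B : F[X]) (h : exactNum Q m U + Q ^ m * B = 0) (hB : B.degree < (Q.natDegree - 1 : ℕ)) :
    B = 0 := by
  have hQ0 : Q ≠ 0 := by rintro rfl; simp at hQd
  induction m generalizing U with
  | zero =>
    rcases eq_or_ne U 0 with rfl | hU
    · simpa [exactNum] using h
    · exfalso
      -- The leading coefficient carries the factor 2 deg U + deg Q, nonzero in characteristic zero,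
      -- so this degree is too large for -B.
      have h1 : (X * exactNum Q 0 U).coeff (Q.natDegree + U.natDegree) =
          (2 * U.natDegree + Q.natDegree) * (Q.leadingCoeff * U.leadingCoeff) := by
        have hX : ∀ P : F[X], (X * derivative P).coeff P.natDegree =
            P.natDegree * P.leadingCoeff := by
          intro P
          rcases Nat.eq_zero_or_pos P.natDegree with h0 | h0
          · rw [h0]; simp
          · obtain ⟨i, hi⟩ : ∃ i, P.natDegree = i + 1 := ⟨P.natDegree - 1, by lia⟩
            rw [leadingCoeff, hi, coeff_X_mul, coeff_derivative]; push_cast; ring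
        have : X * exactNum Q 0 U = C 2 * (Q * (X * derivative U)) + (X * derivative Q) * U := by
          simp only [exactNum, map_ofNat, Nat.cast_zero]; ring
        rw [this, coeff_add, coeff_C_mul,
          coeff_mul_add_eq_of_natDegree_le le_rfl (natDegree_X_mul_derivative_le U),
          coeff_mul_add_eq_of_natDegree_le (natDegree_X_mul_derivative_le Q) le_rfl, hX, hX]
        simp only [coeff_natDegree]
        ring
      obtain ⟨t, ht⟩ : ∃ t, Q.natDegree = t + 1 := ⟨Q.natDegree - 1, by lia⟩
      have h2 : (X * exactNum Q 0 U).coeff (Q.natDegree + U.natDegree) = 0 := by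
        rw [pow_zero, one_mul] at h
        rw [show exactNum Q 0 U = -B by linear_combination h, ht,
          show t + 1 + U.natDegree = t + U.natDegree + 1 by ring, coeff_X_mul, coeff_neg, neg_eq_zero]
        rw [degree_lt_iff_coeff_zero] at hB
        exact hB _ (by lia)
      rw [h1] at h2
      have h3 : (2 * U.natDegree + Q.natDegree : F) ≠ 0 := by
        exact_mod_cast (by lia : 2 * U.natDegree + Q.natDegree ≠ 0)
      exact mul_ne_zero h3 (mul_ne_zero (leadingCoeff_ne_zero.2 hQ0) (leadingCoeff_ne_zero.2 hU)) h2
  | succ m ih =>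
    -- Comparing terms modulo Q forces Q to divide U, which lowers the pole order by one.
    have h1 : Q ∣ C (2 * ((m + 1 : ℕ) : F) - 1) * (derivative Q * U) := by
      refine ⟨2 * derivative U + Q ^ m * B, ?_⟩
      rw [exactNum] at h
      simp only [map_sub, map_mul, map_natCast, map_one, map_ofNat]
      linear_combination -h
    have h2 : IsUnit (C (2 * ((m + 1 : ℕ) : F) - 1)) := by
      rw [isUnit_C, isUnit_iff_ne_zero]
      have : (2 * ((m + 1 : ℕ) : F) - 1) = ((2 * m + 1 : ℕ) : F) := by push_cast; ring
      rw [this]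
      exact_mod_cast (by lia)
    rw [h2.dvd_mul_left] at h1
    obtain ⟨V, rfl⟩ := hQ.dvd_of_dvd_mul_left h1
    refine ih V ?_
    have h3 := exactNum_pow_mul Q m 1 V
    rw [pow_one] at h3
    rw [h3] at h
    refine (mul_eq_zero.1 (?_ : Q * _ = 0)).resolve_left hQ0
    linear_combination h

end AlgebraicReduction

/-! ### Denominators over ℤ_q. -/

section WittReduction

open Polynomial

variable {p : ℕ} [Fact p.Prime] {k : Type*} [Field k] [CharP k p] [PerfectRing k p]

theorem isUnit_natCast_Zq {n : ℕ} (hn : ¬ p ∣ n) : IsUnit (n : Zq p k) := by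
  rw [← not_not (a := IsUnit _), ← mem_nonunits_iff, ← IsLocalRing.mem_maximalIdeal,
    (WittVector.irreducible p).maximalIdeal_eq, ← WittVector.ker_constantCoeff, RingHom.mem_ker,
    map_natCast, CharP.cast_eq_zero_iff k p]
  exact hn

theorem natCast_dvd_pow_Zq {n e : ℕ} (hn : 0 < n) (h : n < p ^ (e + 1)) :
    (n : Zq p k) ∣ (p : Zq p k) ^ e := by
  have hp := (Fact.out : p.Prime)
  obtain ⟨v, m, hm, rfl⟩ := Nat.exists_eq_pow_mul_and_not_dvd hn.ne' p hp.ne_one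
  have hm0 : 0 < m := Nat.pos_of_ne_zero (by rintro rfl; simp at hm)
  have hv : v < e + 1 := by
    refine (Nat.pow_lt_pow_iff_right hp.one_lt).1 (lt_of_le_of_lt ?_ h)
    exact Nat.le_mul_of_pos_right _ hm0
  push_cast
  rw [(isUnit_natCast_Zq hm).mul_right_dvd]
  exact pow_dvd_pow _ (by lia)

/-- The resultant of Q and Q' is nonzero in the residue field of a local ring, hence a unit. -/
theorem isCoprime_derivative_of_separable (Q : (Zq p k)[X]) (hQ : Q.Monic)
    (hsep : (Q.map (WittVector.constantCoeff (p := p) (R := k))).Separable) :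
    IsCoprime Q (derivative Q) := by
  set φ := WittVector.constantCoeff (p := p) (R := k)
  have h1 : IsUnit (φ (resultant Q (derivative Q))) := by
    rw [← resultant_map_map, ← hQ.natDegree_map φ]
    have h2 : IsUnit (resultant (Q.map φ) (derivative (Q.map φ))) :=
      (isUnit_resultant_iff_isCoprime (hQ.map φ)).2 hsep
    rw [derivative_map] at h2
    -- Should the degree of Q' drop under reduction, the resultant changes by a power of the leading
    -- coefficient of the reduced Q, which is 1.
    have h3 : ((derivative Q).map φ).natDegree ≤ (derivative Q).natDegree := natDegree_map_le
    obtain ⟨d, hd⟩ := Nat.exists_eq_add_of_le h3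
    rw [hd, resultant_add_right_deg _ _ _ _ _ le_rfl]
    refine IsUnit.mul ?_ h2
    rw [coeff_natDegree, (hQ.map φ).leadingCoeff, one_pow]
    exact isUnit_one
  refine (isUnit_resultant_iff_isCoprime hQ).1 ?_
  rw [← not_not (a := IsUnit _), ← mem_nonunits_iff, ← IsLocalRing.mem_maximalIdeal,
    (WittVector.irreducible p).maximalIdeal_eq, ← WittVector.ker_constantCoeff, RingHom.mem_ker]
  exact h1.ne_zero

/-- The reduction of an integral form has denominators of logarithmic growth. -/
theorem exists_exactNum_add_Zq (Q : (Zq p k)[X]) (hQ : Q.Monic)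
    (hcop : IsCoprime Q (derivative Q)) (hQd : 2 ≤ Q.natDegree)
    (hQp : Q.natDegree < p) (m n e : ℕ) (hm : 2 * m ≤ p ^ (e + 1))
    (hn : 2 * n + Q.natDegree ≤ p ^ (e + 1) + 1) (A : (Zq p k)[X])
    (hA : A.degree < (m * Q.natDegree + n + Q.natDegree - 1 : ℕ)) :
    ∃ U B : (Zq p k)[X], C ((p : Zq p k) ^ e) * A = exactNum Q m U + Q ^ m * B ∧
      U.natDegree ≤ m * Q.natDegree + n ∧ B.degree < (Q.natDegree - 1 : ℕ) := by
  refine exists_exactNum_add Q hQ hcop hQd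
    (isUnit_natCast_Zq (Nat.not_dvd_of_pos_of_lt (by lia) hQp)) m n _ ?_ ?_ A hA
  · intro j hj hjm
    have : (2 * (j : Zq p k) - 1) = ((2 * j - 1 : ℕ) : Zq p k) := by
      rw [Nat.cast_sub (by lia)]; push_cast; ring
    rw [this]
    exact natCast_dvd_pow_Zq (by lia) (by lia)
  -- Here j ≤ n - 1, so 2j + deg Q is at most 2n + deg Q - 2, which explains the summand 1 in `hn`.
  · intro j hj
    have : (2 * (j : Zq p k) + Q.natDegree) = ((2 * j + Q.natDegree : ℕ) : Zq p k) := by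
      push_cast; ring
    rw [this]
    exact natCast_dvd_pow_Zq (by lia) (by lia)

end WittReduction

/-! ### The reduction functional on polynomials in x, y, z. -/

section FieldReduction

open Polynomial

variable {F : Type*} [Field F] [CharZero F]

/-- The projections `A ↦ B` onto the reduction `B dx/y` of `A / Q^m dx/y`. -/
theorem exists_reductionMap (Q : F[X]) (hmon : Q.Monic) (hcop : IsCoprime Q (derivative Q))
    (hQd : 2 ≤ Q.natDegree) :
    ∃ ρ : ℕ → F[X] →ₗ[F] F[X],
      (∀ m U, ρ m (exactNum Q m U) = 0) ∧
      (∀ m B, B.degree < ((Q.natDegree - 1 : ℕ) : WithBot ℕ) → ρ m (Q ^ m * B) = B) ∧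
      ∀ m A, ρ (m + 1) (Q * A) = ρ m A := by
  have hex : ∀ m A, ∃ B : F[X], B.degree < ((Q.natDegree - 1 : ℕ) : WithBot ℕ) ∧
      ∃ U, A = exactNum Q m U + Q ^ m * B := by
    intro m A
    obtain ⟨U, B, h, -, hB⟩ := exists_exactNum_add Q hmon hcop hQd
      (by rw [isUnit_iff_ne_zero]; exact_mod_cast (by lia)) m (A.natDegree + 1) 1
      (fun j hj _ => (IsUnit.dvd (by
        rw [isUnit_iff_ne_zero]
        have : (2 * (j : F) - 1) = ((2 * j - 1 : ℕ) : F) := by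
          rw [Nat.cast_sub (by lia)]; push_cast; ring
        rw [this]
        exact_mod_cast (by lia))))
      (fun j _ => (IsUnit.dvd (by
        rw [isUnit_iff_ne_zero]
        exact_mod_cast (by lia : 2 * j + Q.natDegree ≠ 0)))) A
      (degree_le_natDegree.trans_lt (by exact_mod_cast (by lia)))
    exact ⟨B, hB, U, by simpa using h⟩
  -- Uniqueness makes the chosen B linear in A and independent of the pole order used to write the
  -- form.
  have huniq : ∀ m A B B', (B.degree < ((Q.natDegree - 1 : ℕ) : WithBot ℕ) ∧
      ∃ U, A = exactNum Q m U + Q ^ m * B) → (B'.degree < ((Q.natDegree - 1 : ℕ) : WithBot ℕ) ∧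
      ∃ U, A = exactNum Q m U + Q ^ m * B') → B = B' := by
    rintro m A B B' ⟨hB, U, h⟩ ⟨hB', U', h'⟩
    rw [← sub_eq_zero]
    refine eq_zero_of_exactNum_add_eq_zero Q hcop hQd m (U - U') (B - B') ?_
      ((degree_sub_le _ _).trans_lt (max_lt hB hB'))
    rw [exactNum_sub]
    linear_combination h' - h
  choose r hr using hex
  refine ⟨fun m => ⟨⟨r m, fun A A' => ?_⟩, fun c A => ?_⟩, fun m U => ?_, fun m B hB => ?_,
    fun m A => ?_⟩
  · obtain ⟨h1, U, h2⟩ := hr m A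
    obtain ⟨h3, V, h4⟩ := hr m A'
    refine huniq m (A + A') _ _ (hr m _) ⟨(degree_add_le _ _).trans_lt (max_lt h1 h3), U + V, ?_⟩
    rw [exactNum_add]
    linear_combination h2 + h4
  · obtain ⟨h1, U, h2⟩ := hr m A
    refine huniq m (c • A) _ _ (hr m _) ⟨(degree_smul_le _ _).trans_lt h1, C c * U, ?_⟩
    rw [exactNum_C_mul, RingHom.id_apply, smul_eq_C_mul, smul_eq_C_mul]
    linear_combination C c * h2
  · refine huniq m (exactNum Q m U) _ 0 (hr m _) ⟨?_, U, by simp⟩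
    rw [degree_zero]
    exact WithBot.bot_lt_coe _
  · exact huniq m (Q ^ m * B) _ B (hr m _) ⟨hB, 0, by simp [exactNum]⟩
  · obtain ⟨h1, U, h2⟩ := hr m A
    refine huniq (m + 1) (Q * A) _ (r m A) (hr (m + 1) (Q * A)) ⟨h1, Q ^ 1 * U, ?_⟩
    rw [exactNum_pow_mul]
    linear_combination Q * h2

/-- The functional on Laurent polynomials: reduction of forms `f dx/y`, with `y² = Q(x)` and
`z = y⁻¹`, extended by zero to odd powers of `y`. -/
def reductionFunctional (Q : F[X]) (ρ : ℕ → F[X] →ₗ[F] F[X]) : MvPolynomial (Fin 3) F →ₗ[F] F[X] :=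
  (MvPolynomial.basisMonomials (Fin 3) F).constr (M' := F[X]) F fun s =>
    if Even (s 1 + s 2) then ρ (s 2) (X ^ s 0 * Q ^ ((s 1 + s 2) / 2)) else 0

theorem reductionFunctional_monomial (Q : F[X]) (ρ : ℕ → F[X] →ₗ[F] F[X]) (s : Fin 3 →₀ ℕ) (c : F) :
    reductionFunctional Q ρ (MvPolynomial.monomial s c) =
      c • if Even (s 1 + s 2) then ρ (s 2) (X ^ s 0 * Q ^ ((s 1 + s 2) / 2)) else 0 := by
  have : MvPolynomial.monomial s c = c • (MvPolynomial.basisMonomials (Fin 3) F) s := by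
    simp [MvPolynomial.coe_basisMonomials, MvPolynomial.smul_monomial]
  rw [this, map_smul, reductionFunctional, Module.Basis.constr_basis]

/-- For b + c even, P y^b z^c = P y^(b+c) / y^(2c) = P Q^((b+c)/2) / Q^c on the curve. -/
theorem reductionFunctional_aeval_mul (Q : F[X]) (ρ : ℕ → F[X] →ₗ[F] F[X]) (P : F[X]) (b c : ℕ) :
    reductionFunctional Q ρ (aeval (MvPolynomial.X 0) P * MvPolynomial.X 1 ^ b *
        MvPolynomial.X 2 ^ c) =
      if Even (b + c) then ρ c (P * Q ^ ((b + c) / 2)) else 0 := by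
  induction P using Polynomial.induction_on' with
  | add P P' h h' =>
    rw [map_add, add_mul, add_mul, map_add, h, h']
    split_ifs
    · rw [add_mul, map_add]
    · rw [add_zero]
  | monomial n a =>
    have : aeval (MvPolynomial.X 0 : MvPolynomial (Fin 3) F) (monomial n a) *
        MvPolynomial.X 1 ^ b * MvPolynomial.X 2 ^ c =
        MvPolynomial.monomial (Finsupp.single 0 n + Finsupp.single 1 b + Finsupp.single 2 c) a := by
      rw [aeval_monomial, MvPolynomial.algebraMap_eq, MvPolynomial.X_pow_eq_monomial,
        MvPolynomial.X_pow_eq_monomial, MvPolynomial.X_pow_eq_monomial, MvPolynomial.C_mul_monomial,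
        MvPolynomial.monomial_mul, MvPolynomial.monomial_mul]
      simp
    rw [this, reductionFunctional_monomial]
    simp only [Finsupp.add_apply, Finsupp.single_apply]
    simp only [Fin.isValue, one_ne_zero, zero_ne_one, if_true, if_false, Fin.reduceEq, zero_add,
      add_zero]
    split_ifs
    · rw [← map_smul, ← smul_mul_assoc, smul_eq_C_mul, C_mul_X_pow_eq_monomial]
    · rw [smul_zero]

theorem mvPolynomial_fin3_induction {motive : MvPolynomial (Fin 3) F → Prop}
    (add : ∀ f g, motive f → motive g → motive (f + g)) (smul : ∀ (c : F) f, motive f → motive (c • f))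
    (mon : ∀ a b c : ℕ, motive (MvPolynomial.X 0 ^ a * MvPolynomial.X 1 ^ b * MvPolynomial.X 2 ^ c))
    (f : MvPolynomial (Fin 3) F) : motive f := by
  induction f using MvPolynomial.induction_on' with
  | add f g hf hg => exact add f g hf hg
  | monomial s c =>
    have : MvPolynomial.monomial s c = c • (MvPolynomial.X 0 ^ s 0 * MvPolynomial.X 1 ^ s 1 *
        MvPolynomial.X 2 ^ s 2) := by
      rw [MvPolynomial.monomial_eq, Finsupp.prod_fintype _ _ (by simp), Fin.prod_univ_three,
        MvPolynomial.smul_eq_C_mul]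
    rw [this]
    exact smul c _ (mon _ _ _)

variable (Q : F[X]) (ρ : ℕ → F[X] →ₗ[F] F[X])

/-- A factor yz multiplies the numerator by Q and raises the pole order by one, which `hρ` declares
harmless. -/
theorem reductionFunctional_mul_yz (hρ : ∀ m A, ρ (m + 1) (Q * A) = ρ m A)
    (f : MvPolynomial (Fin 3) F) :
    reductionFunctional Q ρ (f * (MvPolynomial.X 1 * MvPolynomial.X 2 - 1)) = 0 := by
  induction f using mvPolynomial_fin3_induction with
  | add f g hf hg => rw [add_mul, map_add, hf, hg, add_zero]
  | smul c f hf => rw [smul_mul_assoc, map_smul, hf, smul_zero]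
  | mon a b c =>
    have h1 := reductionFunctional_aeval_mul Q ρ (X ^ a) (b + 1) (c + 1)
    have h2 := reductionFunctional_aeval_mul Q ρ (X ^ a) b c
    rw [map_pow, aeval_X] at h1 h2
    rw [mul_sub, mul_one, map_sub, h2]
    have h3 : (MvPolynomial.X 0 ^ a * MvPolynomial.X 1 ^ b * MvPolynomial.X 2 ^ c *
        (MvPolynomial.X 1 * MvPolynomial.X 2) : MvPolynomial (Fin 3) F) =
        MvPolynomial.X 0 ^ a * MvPolynomial.X 1 ^ (b + 1) * MvPolynomial.X 2 ^ (c + 1) := by ring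
    rw [h3, h1, show b + 1 + (c + 1) = b + c + 2 by ring, Nat.add_div_right _ two_pos]
    have h4 : Even (b + c + 2) ↔ Even (b + c) := by simp [Nat.even_add]
    simp only [h4]
    split_ifs
    · rw [pow_succ', mul_left_comm, hρ, sub_self]
    · rw [sub_self]

theorem reductionFunctional_mul_curve (f : MvPolynomial (Fin 3) F) :
    reductionFunctional Q ρ (f * (MvPolynomial.X 1 ^ 2 - aeval (MvPolynomial.X 0) Q)) = 0 := by
  induction f using mvPolynomial_fin3_induction with
  | add f g hf hg => rw [add_mul, map_add, hf, hg, add_zero]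
  | smul c f hf => rw [smul_mul_assoc, map_smul, hf, smul_zero]
  | mon a b c =>
    have h1 := reductionFunctional_aeval_mul Q ρ (X ^ a) (b + 2) c
    have h2 := reductionFunctional_aeval_mul Q ρ (X ^ a * Q) b c
    rw [map_pow, aeval_X] at h1
    rw [map_mul (aeval _), map_pow, aeval_X] at h2
    have h3 : (MvPolynomial.X 0 ^ a * MvPolynomial.X 1 ^ b * MvPolynomial.X 2 ^ c *
        (MvPolynomial.X 1 ^ 2 - aeval (MvPolynomial.X 0) Q) : MvPolynomial (Fin 3) F) =
        MvPolynomial.X 0 ^ a * MvPolynomial.X 1 ^ (b + 2) * MvPolynomial.X 2 ^ c -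
        MvPolynomial.X 0 ^ a * aeval (MvPolynomial.X 0) Q * MvPolynomial.X 1 ^ b *
          MvPolynomial.X 2 ^ c := by ring
    rw [h3, map_sub, h1, h2, show b + 2 + c = b + c + 2 by ring, Nat.add_div_right _ two_pos]
    have h4 : Even (b + c + 2) ↔ Even (b + c) := by simp [Nat.even_add]
    simp only [h4]
    split_ifs
    · rw [pow_succ', mul_assoc, sub_self]
    · rw [sub_self]

/-- The derivation `derOC` on polynomials. -/
def derPoly (f : MvPolynomial (Fin 3) F) : MvPolynomial (Fin 3) F :=
  MvPolynomial.X 1 * MvPolynomial.pderiv 0 f +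
    ((2⁻¹ : F) • aeval (MvPolynomial.X 0) (derivative Q)) *
      (MvPolynomial.pderiv 1 f - MvPolynomial.X 2 ^ 2 * MvPolynomial.pderiv 2 f)

/-- If b + c = 2j + 1, then x^a y^b z^c is x^a Q^j y / Q^c, and its differential is half of an
`exactNum`, killed by `hρ'`. If b + c is even, differentiation produces only odd powers of y, where
the functional is zero by definition. -/
theorem reductionFunctional_derPoly (hρ : ∀ m A, ρ (m + 1) (Q * A) = ρ m A)
    (hρ' : ∀ m U, ρ m (exactNum Q m U) = 0) (f : MvPolynomial (Fin 3) F) :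
    reductionFunctional Q ρ (derPoly Q f) = 0 := by
  induction f using mvPolynomial_fin3_induction with
  | add f g hf hg =>
    have : derPoly Q (f + g) = derPoly Q f + derPoly Q g := by
      simp only [derPoly, map_add]; ring
    rw [this, map_add, hf, hg, add_zero]
  | smul c f hf =>
    have : derPoly Q (c • f) = c • derPoly Q f := by
      simp only [derPoly, Derivation.map_smul]; simp only [MvPolynomial.smul_eq_C_mul]; ring
    rw [this, map_smul, hf, smul_zero]
  | mon a b c =>
    have h0 : derPoly Q (MvPolynomial.X 0 ^ a * MvPolynomial.X 1 ^ b * MvPolynomial.X 2 ^ c) =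
        aeval (MvPolynomial.X 0) (derivative (X ^ a : F[X])) * MvPolynomial.X 1 ^ (b + 1) *
          MvPolynomial.X 2 ^ c +
        (2⁻¹ * b : F) • (aeval (MvPolynomial.X 0) (X ^ a * derivative Q) *
          MvPolynomial.X 1 ^ (b - 1) * MvPolynomial.X 2 ^ c) -
        (2⁻¹ * c : F) • (aeval (MvPolynomial.X 0) (X ^ a * derivative Q) *
          MvPolynomial.X 1 ^ b * MvPolynomial.X 2 ^ (c + 1)) := by
      have e1 : (2 : Fin 3) ≠ 0 := by decide
      have e2 : (2 : Fin 3) ≠ 1 := by decide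
      have e3 : (c : MvPolynomial (Fin 3) F) * MvPolynomial.X 2 ^ (c + 1) =
          (c : MvPolynomial (Fin 3) F) * MvPolynomial.X 2 ^ (c - 1) * MvPolynomial.X 2 ^ 2 := by
        rcases c with _ | c
        · simp
        · rw [Nat.add_sub_cancel]; ring
      simp only [derPoly, Derivation.leibniz, Derivation.leibniz_pow, MvPolynomial.pderiv_X,
        Pi.single_apply, smul_eq_mul, nsmul_eq_mul, MvPolynomial.smul_eq_C_mul, map_mul,
        map_natCast, derivative_X_pow, aeval_X, map_pow]
      simp [e1, e2, e1.symm, e2.symm]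
      linear_combination (MvPolynomial.C 2⁻¹ * MvPolynomial.X 0 ^ a *
        aeval (MvPolynomial.X 0) (derivative Q) * MvPolynomial.X 1 ^ b) * e3
    rw [h0, map_sub, map_add, map_smul, map_smul]
    simp only [reductionFunctional_aeval_mul]
    rcases Nat.even_or_odd (b + c) with hbc | hbc
    · have h1 : ¬ Even (b + 1 + c) := by
        rw [show b + 1 + c = b + c + 1 by ring, Nat.even_add_one]; simpa using hbc
      have h2 : ¬ Even (b + (c + 1)) := by rw [← add_assoc, Nat.even_add_one]; simpa using hbc
      rw [if_neg h1, if_neg h2, smul_zero, sub_zero, zero_add]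
      rcases b with _ | b
      · simp
      · have h3 : ¬ Even (b + 1 - 1 + c) := by
          rw [Nat.add_sub_cancel]
          rw [show b + 1 + c = b + c + 1 by ring, Nat.even_add_one] at hbc
          exact hbc
        rw [if_neg h3, smul_zero]
    · obtain ⟨j, hj⟩ := hbc
      have h1 : b + 1 + c = (j + 1) * 2 := by lia
      have h2 : b + (c + 1) = (j + 1) * 2 := by lia
      rw [h1, h2, if_pos (by simp), Nat.mul_div_cancel _ two_pos, pow_succ', ← mul_assoc,
        show ∀ P : F[X], P * (Q * Q ^ j) = Q * (P * Q ^ j) from fun P => by ring, hρ]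
      -- For b = 0 the exponent b - 1 is meaningless, but its coefficient vanishes.
      have h3 : (2⁻¹ * b : F) • (if Even (b - 1 + c) then
          ρ c (X ^ a * derivative Q * Q ^ ((b - 1 + c) / 2)) else 0) =
          (2⁻¹ * b : F) • ρ c (X ^ a * derivative Q * Q ^ j) := by
        rcases b with _ | b
        · simp
        · rw [if_pos ⟨j, by lia⟩, show (b + 1 - 1 + c) / 2 = j by lia]
      rw [h3, if_pos (by simp), ← map_smul, ← map_smul, ← map_add, ← map_sub]
      have h4 := hρ' c (C (2⁻¹ : F) * (X ^ a * Q ^ j))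
      rw [← h4]
      congr 1
      have hbF : (b : F) = 2 * j + 1 - c := by
        have : ((b + c : ℕ) : F) = ((2 * j + 1 : ℕ) : F) := by rw [hj]
        push_cast at this
        linear_combination this
      have hC : C (2⁻¹ : F) * 2 = 1 := by
        rw [← map_ofNat C 2, ← C_mul, inv_mul_cancel₀ two_ne_zero, C_1]
      have hbC : C (b : F) = 2 * (j : F[X]) + 1 - c := by
        rw [hbF]
        simp only [map_sub, map_add, map_mul, map_natCast, map_one, map_ofNat]
      have hj' : (j : F[X]) * Q ^ j = j * (Q ^ (j - 1) * Q) := by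
        rcases j with _ | j
        · simp
        · rw [Nat.add_sub_cancel, pow_succ]
      rw [exactNum_C_mul]
      simp only [exactNum, derivative_mul, derivative_pow, derivative_X, smul_eq_C_mul, C_mul, hbC,
        map_natCast, mul_one]
      linear_combination (-(a * X ^ (a - 1) * (Q ^ j * Q))) * hC
        + (2 * C (2⁻¹ : F) * X ^ a * derivative Q) * hj'

end FieldReduction

/-! ### Growth estimates for logarithms and for truncated series. -/

theorem exists_mul_log_le {p : ℕ} (hp : 2 ≤ p) (K a : ℕ) :
    ∃ C : ℕ, ∀ t : ℕ, K * Nat.log p (a * (t + 1)) ≤ t + C := by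
  rcases Nat.eq_zero_or_pos a with rfl | ha
  · exact ⟨0, fun t => by simp⟩
  refine ⟨1 + K * K * a, fun t => ?_⟩
  set l := Nat.log p (a * (t + 1))
  have h1 : p ^ l ≤ a * (t + 1) :=
    Nat.pow_log_le_self p (Nat.mul_pos ha (Nat.succ_pos _)).ne'
  have h2 : 2 ^ l ≤ p ^ l := Nat.pow_le_pow_left hp l
  -- Halving l gives (h+1)^2 ≤ 2^l ≤ a(t+1), a quadratic lower bound. The linear term in l is then
  -- absorbed by completing the square.
  obtain ⟨h, hh⟩ : ∃ h, l = 2 * h ∨ l = 2 * h + 1 := ⟨l / 2, by lia⟩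
  have h3 : h + 1 ≤ 2 ^ h := Nat.lt_pow_self one_lt_two
  have h4 : (h + 1) * (h + 1) ≤ 2 ^ l := by
    refine (Nat.mul_le_mul h3 h3).trans ?_
    rw [← pow_add]
    exact Nat.pow_le_pow_right two_pos (by lia)
  have h5 : a * (K * l) ≤ a * (t + 1) + (K * a) * (K * a) := by
    have h6 : a * (K * l) ≤ (K * a) * (2 * h + 1) := by
      calc a * (K * l) = (K * a) * l := by ring
        _ ≤ _ := Nat.mul_le_mul_left _ (by lia)
    have h7 : (K * a) * (2 * h + 1) ≤ (h + 1) * (h + 1) + (K * a) * (K * a) := by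
      zify
      nlinarith [sq_nonneg ((h : ℤ) + 1 - K * a), Int.natCast_nonneg (K * a)]
    lia
  have h8 : a * (K * l) ≤ a * (t + (1 + K * K * a)) := by
    refine h5.trans (le_of_eq ?_)
    ring
  exact Nat.le_of_mul_le_mul_left h8 ha

section Uniqueness

open MvPowerSeries WithZero

variable {K : Type*} [Field K] {v : Valuation K ℤᵐ⁰} {ι : Type*}

/-- The growth condition satisfied by the remainder of a series truncated in degree `n`. -/
def TailBound (v : Valuation K ℤᵐ⁰) (M : ℕ) (D : ℤ) (n : ℕ) (f : MvPowerSeries ι K) : Prop :=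
  ∀ s : ι →₀ ℕ, v (coeff s f) ^ M ≤ exp (D - (max n s.degree : ℕ))

theorem TailBound.mono {M : ℕ} {D E : ℤ} {n : ℕ} {f : MvPowerSeries ι K}
    (h : TailBound v M D n f) (hDE : D ≤ E) : TailBound v M E n f := fun s =>
  (h s).trans (exp_le_exp.2 (by lia))

theorem TailBound.add {M : ℕ} {D : ℤ} {n : ℕ} {f g : MvPowerSeries ι K}
    (hf : TailBound v M D n f) (hg : TailBound v M D n g) : TailBound v M D n (f + g) := fun s => by
  rw [map_add]
  rcases le_total (v (coeff s f)) (v (coeff s g)) with h | h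
  · exact (pow_le_pow_left₀ zero_le ((Valuation.map_add _ _ _).trans (max_le h le_rfl)) M).trans
      (hg s)
  · exact (pow_le_pow_left₀ zero_le ((Valuation.map_add _ _ _).trans (max_le le_rfl h)) M).trans
      (hf s)

theorem TailBound.neg {M : ℕ} {D : ℤ} {n : ℕ} {f : MvPowerSeries ι K}
    (hf : TailBound v M D n f) : TailBound v M D n (-f) := fun s => by
  rw [map_neg, Valuation.map_neg]
  exact hf s

theorem TailBound.mul {M : ℕ} (hM : 0 < M) {D E : ℤ} {n : ℕ} {f g : MvPowerSeries ι K}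
    (hf : TailBound v M D n f) (hg : GrowthBound v M E g) : TailBound v M (D + E) n (f * g) :=
  fun s => by
  classical
  rw [coeff_mul]
  refine val_sum_pow_le _ _ M hM _ fun i hi => ?_
  rw [map_mul, mul_pow]
  refine (mul_le_mul' (hf i.1) (hg i.2)).trans ?_
  have h : i.1.degree + i.2.degree = s.degree := by
    rw [← Finset.HasAntidiagonal.mem_antidiagonal.1 hi, map_add]
  rw [← exp_add, exp_le_exp]
  lia

theorem TailBound.pderiv {M : ℕ} {D : ℤ} {n : ℕ} {f : MvPowerSeries ι K}
    (hf : TailBound v M D n f) (i : ι) : TailBound v M D n (MvPowerSeries.pderiv K i f) := fun s => by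
  rw [coeff_pderiv, map_mul]
  have h1 : v ((s i : K) + 1) ≤ 1 := by
    exact_mod_cast val_natCast_le_one (v := v) (s i + 1)
  refine (pow_le_pow_left₀ zero_le (mul_le_of_le_one_right' h1) M).trans ((hf _).trans ?_)
  rw [exp_le_exp, map_add]
  have h2 : s.degree ≤ s.degree + (Finsupp.single i (1 : ℕ)).degree := Nat.le_add_right _ _
  have h3 := max_le_max (le_refl n) h2
  lia

theorem GrowthBound.tailBound_sub_truncTotal [Finite ι] {M : ℕ} (hM : 0 < M) {D : ℤ}
    {f : MvPowerSeries ι K} (h : GrowthBound v M D f) (n : ℕ) :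
    TailBound v M D n (f - (truncTotal n f : MvPowerSeries ι K)) := fun s => by
  rw [map_sub, MvPolynomial.coeff_coe, coeff_truncTotal_eq_ite]
  split_ifs with hs
  · rw [sub_self, map_zero, zero_pow hM.ne']
    exact zero_le
  · rw [sub_zero, max_eq_right (not_lt.1 hs)]
    exact h s

theorem GrowthBound.smul {M : ℕ} {D : ℤ} {f : MvPowerSeries ι K}
    (h : GrowthBound v M D f) {c : K} (hc : v c ≤ 1) : GrowthBound v M D (c • f) := fun s => by
  rw [map_smul, smul_eq_mul, map_mul]
  exact (pow_le_pow_left₀ zero_le (mul_le_of_le_one_left' hc) M).trans (h s)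

theorem GrowthBound.neg {M : ℕ} {D : ℤ} {f : MvPowerSeries ι K}
    (h : GrowthBound v M D f) : GrowthBound v M D (-f) := fun s => by
  rw [map_neg, Valuation.map_neg]
  exact h s

theorem growthBound_aeval {M : ℕ} (hM : 0 < M) (i : ι) (P : K[X])
    (hP : ∀ n, v (P.coeff n) ≤ 1) :
    GrowthBound v M P.natDegree (Polynomial.aeval (MvPowerSeries.X i : MvPowerSeries ι K) P) := by
  rw [Polynomial.aeval_eq_sum_range]
  refine Finset.sum_induction _ (GrowthBound v M (P.natDegree : ℤ)) (fun _ _ h h' => h.add h')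
    (fun s => by simp [hM.ne']) fun n hn => ?_
  rw [Finset.mem_range, Nat.lt_succ_iff] at hn
  refine GrowthBound.smul (((GrowthBound.X hM i).pow hM n).mono ?_) (hP n)
  rw [mul_one]
  exact_mod_cast hn

end Uniqueness

/-! ### Uniqueness of reductions in the weak completion. -/

section UniquenessWitt

open MvPowerSeries WithZero

variable {p : ℕ} [Fact p.Prime] {k : Type*} [Field k] [CharP k p] [PerfectRing k p]
variable (K : Type*) [Field K] [Algebra (Zq p k) K] [IsFractionRing (Zq p k) K] [CharZero K]
variable (Q : (Zq p k)[X])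

/-- A monomial of degree |s| is an integral form whose pole orders are linear in |s|, so its
reduction has logarithmic denominators. The argument 2 deg Q (|s| + 1) of the logarithm dominates
the bounds needed both at the zeros of Q and at infinity. -/
theorem val_coeff_reductionFunctional_le (hmon : Q.Monic)
    (hcop : IsCoprime Q (Polynomial.derivative Q)) (hQd : 2 ≤ Q.natDegree) (hQp : Q.natDegree < p)
    (ρ : ℕ → K[X] →ₗ[K] K[X]) (hρ : ∀ m U, ρ m (exactNum (QK K Q) m U) = 0)
    (hρ' : ∀ m B, B.degree < (((QK K Q).natDegree - 1 : ℕ) : WithBot ℕ) →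
      ρ m ((QK K Q) ^ m * B) = B)
    (s : Fin 3 →₀ ℕ) (c : K) (i : ℕ) :
    val p k K ((reductionFunctional (QK K Q) ρ (MvPolynomial.monomial s c)).coeff i) ≤
      val p k K c * exp (Nat.log p (2 * Q.natDegree * (s.degree + 1)) : ℤ) := by
  rw [reductionFunctional_monomial, Polynomial.coeff_smul, smul_eq_mul, map_mul]
  refine mul_le_mul' le_rfl ?_
  split_ifs with hs
  swap
  · simp
  set e := Nat.log p (2 * Q.natDegree * (s.degree + 1))
  set r := Q.natDegree
  have he : 2 * r * (s.degree + 1) < p ^ (e + 1) :=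
    Nat.lt_pow_succ_log_self (Fact.out : p.Prime).one_lt _
  have hdeg : s.degree = s 0 + s 1 + s 2 := by
    rw [Finsupp.degree_eq_sum, Fin.sum_univ_three]
  set A : (Zq p k)[X] := Polynomial.X ^ s 0 * Q ^ ((s 1 + s 2) / 2)
  have hA : A.natDegree ≤ s 0 + (s 1 + s 2) / 2 * r := by
    refine Polynomial.natDegree_mul_le.trans (add_le_add (Polynomial.natDegree_X_pow_le _) ?_)
    exact Polynomial.natDegree_pow_le
  have h1 : (s 1 + s 2) / 2 * r ≤ (s 1 + s 2) * r :=
    Nat.mul_le_mul_right _ (Nat.div_le_self _ _)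
  have h2 : s 0 * 1 ≤ s 0 * r := Nat.mul_le_mul_left _ (by lia)
  have h4 : s 2 * 1 ≤ s 2 * r := Nat.mul_le_mul_left _ (by lia)
  have h3 : 2 * r * (s.degree + 1) = 2 * (s 0 * r) + 2 * ((s 1 + s 2) * r) + 2 * r := by
    rw [hdeg]; ring
  have h5 : (s 1 + s 2) * r = s 1 * r + s 2 * r := add_mul _ _ _
  obtain ⟨U, B, h, -, hB⟩ := exists_exactNum_add_Zq Q hmon hcop hQd hQp (s 2)
    (s 0 + (s 1 + s 2) * r) e (by lia) (by lia) A
    (Polynomial.degree_le_natDegree.trans_lt (by exact_mod_cast (by lia)))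
  have hinj := IsFractionRing.injective (Zq p k) K
  have hmap : Polynomial.C ((p : K) ^ e) * (Polynomial.X ^ s 0 * (QK K Q) ^ ((s 1 + s 2) / 2)) =
      exactNum (QK K Q) (s 2) (U.map (algebraMap _ K)) +
        (QK K Q) ^ s 2 * B.map (algebraMap _ K) := by
    have := congrArg (Polynomial.map (algebraMap (Zq p k) K)) h
    rw [Polynomial.map_add, Polynomial.map_mul, Polynomial.map_mul, exactNum_map] at this
    simpa [A] using this
  have h6 : Polynomial.C ((p : K) ^ e) * ρ (s 2) (Polynomial.X ^ s 0 *
      (QK K Q) ^ ((s 1 + s 2) / 2)) = B.map (algebraMap _ K) := by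
    rw [← Polynomial.smul_eq_C_mul, ← map_smul, Polynomial.smul_eq_C_mul, hmap, map_add, hρ,
      hρ', zero_add]
    rwa [Polynomial.degree_map_eq_of_injective hinj, Polynomial.natDegree_map_eq_of_injective hinj]
  rw [← Polynomial.smul_eq_C_mul] at h6
  have h7 := congrArg (fun P => val p k K (Polynomial.coeff P i)) h6
  simp only [Polynomial.coeff_smul, smul_eq_mul, Polynomial.coeff_map, map_mul, map_pow, val_p] at h7
  have h8 := val_algebraMap_le_one p k K (B.coeff i)
  rw [← h7, ← exp_nsmul] at h8
  have h9 := mul_le_mul' (le_refl (exp (e : ℤ))) h8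
  rw [← mul_assoc, ← exp_add, mul_one] at h9
  simpa using h9

/-- The derivation `derOC` on all power series. -/
def derSeries (Q : K[X]) (f : MvPowerSeries (Fin 3) K) : MvPowerSeries (Fin 3) K :=
  MvPowerSeries.X 1 * MvPowerSeries.pderiv K 0 f +
    ((2⁻¹ : K) • Polynomial.aeval (MvPowerSeries.X 0) (Polynomial.derivative Q)) *
      (MvPowerSeries.pderiv K 1 f - MvPowerSeries.X 2 ^ 2 * MvPowerSeries.pderiv K 2 f)

theorem coe_aeval_OC (v : Valuation K ℤᵐ⁰) (f : OC v) (P : K[X]) :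
    ((Polynomial.aeval f P : OC v) : MvPowerSeries (Fin 3) K) =
      Polynomial.aeval (f : MvPowerSeries (Fin 3) K) P :=
  (Polynomial.aeval_algHom_apply (OC v).val f P).symm

theorem coe_aeval_OC_X (v : Valuation K ℤᵐ⁰) (i : Fin 3) (P : K[X]) :
    ((Polynomial.aeval (OC.X v i) P : OC v) : MvPowerSeries (Fin 3) K) =
      Polynomial.aeval (MvPowerSeries.X i) P :=
  coe_aeval_OC K v (OC.X v i) P

theorem coe_aeval_X (i : Fin 3) (P : K[X]) :
    ((Polynomial.aeval (MvPolynomial.X i) P : MvPolynomial (Fin 3) K) : MvPowerSeries (Fin 3) K) =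
      Polynomial.aeval (MvPowerSeries.X i) P := by
  have := Polynomial.aeval_algHom_apply
    (MvPolynomial.coeToMvPowerSeries.algHom K : MvPolynomial (Fin 3) K →ₐ[K] _)
    (MvPolynomial.X i) P
  simpa using this.symm

theorem coe_derOC (v : Valuation K ℤᵐ⁰) (Q : K[X]) (f : OC v) :
    (derOC v Q f : MvPowerSeries (Fin 3) K) = derSeries K Q f := by
  rw [derSeries, ← coe_aeval_OC_X]
  rfl

theorem coe_derPoly (Q : K[X]) (f : MvPolynomial (Fin 3) K) :
    (derPoly Q f : MvPowerSeries (Fin 3) K) = derSeries K Q f := by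
  simp only [derPoly, derSeries, ← MvPolynomial.coeToMvPowerSeries.ringHom_apply, map_add, map_mul,
    map_sub, map_pow]
  simp only [MvPolynomial.coeToMvPowerSeries.ringHom_apply, MvPolynomial.coe_X,
    MvPolynomial.coe_smul, coe_aeval_X, MvPowerSeries.pderiv_coe]

theorem derSeries_sub (Q : K[X]) (f g : MvPowerSeries (Fin 3) K) :
    derSeries K Q (f - g) = derSeries K Q f - derSeries K Q g := by
  simp only [derSeries, map_sub]
  ring

/-- The derivation has integral polynomial coefficients, 2 being a unit, so the loss E depends on
their degrees only and is uniform in the truncation order. -/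
theorem TailBound.derSeries {K : Type*} [Field K] {v : Valuation K ℤᵐ⁰} (h2 : v 2 = 1)
    (P : K[X]) (hP : ∀ n, v (P.coeff n) ≤ 1) {M : ℕ} (hM : 0 < M) :
    ∃ E : ℤ, ∀ (D : ℤ) (n : ℕ) (f : MvPowerSeries (Fin 3) K), TailBound v M D n f →
      TailBound v M (D + E) n (HyperellipticMW.derSeries K P f) := by
  have hP' : ∀ n, v ((Polynomial.derivative P).coeff n) ≤ 1 := fun n => by
    rw [Polynomial.coeff_derivative, map_mul]
    exact mul_le_one' (hP _) (by exact_mod_cast val_natCast_le_one (v := v) (n + 1))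
  have h2' : v (2⁻¹ : K) ≤ 1 := by rw [map_inv₀, h2, inv_one]
  refine ⟨(Polynomial.derivative P).natDegree + 2, fun D n f h => ?_⟩
  refine TailBound.add ?_ ?_
  · rw [mul_comm]
    exact ((h.pderiv 0).mul hM (GrowthBound.X hM 1)).mono (by lia)
  · rw [mul_comm]
    have h3 : TailBound v M (D + 2) n
        (MvPowerSeries.pderiv K 1 f - MvPowerSeries.X 2 ^ 2 * MvPowerSeries.pderiv K 2 f) := by
      rw [sub_eq_add_neg]
      refine ((h.pderiv 1).mono (by lia)).add (TailBound.neg ?_)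
      rw [mul_comm]
      exact ((h.pderiv 2).mul hM ((GrowthBound.X hM 2).pow hM 2)).mono (by push_cast; lia)
    exact (h3.mul hM (GrowthBound.smul (growthBound_aeval hM 0 _ hP') h2')).mono (by lia)

/-- A form `B(x) dx/y` with `deg B ≤ 2g - 1` that is exact in the weak completion vanishes. -/
theorem eq_zero_of_exact (hp : 3 ≤ p) (hmon : Q.Monic)
    (hcop : IsCoprime Q (Polynomial.derivative Q)) (hQd : 2 ≤ Q.natDegree) (hQp : Q.natDegree < p)
    (B : K[X]) (hB : B.degree < ((Q.natDegree - 1 : ℕ) : WithBot ℕ)) (f : OC (val p k K))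
    (h : Polynomial.aeval (OC.X (val p k K) 0) B - derOC (val p k K) (QK K Q) f ∈
      relIdeal (val p k K) (QK K Q)) : B = 0 := by
  have hinj := IsFractionRing.injective (Zq p k) K
  have hcopK : IsCoprime (QK K Q) (Polynomial.derivative (QK K Q)) := by
    have := hcop.map (Polynomial.mapRingHom (algebraMap (Zq p k) K))
    rwa [Polynomial.coe_mapRingHom, ← Polynomial.derivative_map] at this
  have hdegK : (QK K Q).natDegree = Q.natDegree := Polynomial.natDegree_map_eq_of_injective hinj _
  obtain ⟨ρ, hρ, hρ', hρ''⟩ := exists_reductionMap (QK K Q) (hmon.map _) hcopK (by rw [hdegK]; exact hQd)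
  set φ := reductionFunctional (QK K Q) ρ
  obtain ⟨g₁, g₂, hg⟩ := Ideal.mem_span_pair.1 h
  obtain ⟨M, D, hM, hf, hg₁, hg₂⟩ : ∃ (M : ℕ) (D : ℤ), 0 < M ∧
      GrowthBound (val p k K) M D f.1 ∧ GrowthBound (val p k K) M D g₁.1 ∧
      GrowthBound (val p k K) M D g₂.1 := by
    obtain ⟨M, D, hM, h1, h2⟩ := IsOverconvergent.exists_common f.2 g₁.2
    obtain ⟨L, E, hL, h3⟩ := g₂.2
    refine ⟨M * L, max (L * D) (M * E), Nat.mul_pos hM hL, (h1.scale hL).mono (le_max_left _ _),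
      (h2.scale hL).mono (le_max_left _ _), ?_⟩
    rw [mul_comm M L]
    exact (h3.scale hM).mono (le_max_right _ _)
  have hQi : ∀ n, val p k K ((QK K Q).coeff n) ≤ 1 := fun n => by
    rw [Polynomial.coeff_map]
    exact val_algebraMap_le_one p k K _
  obtain ⟨E, hE⟩ := TailBound.derSeries (v := val p k K) (val_two p k K hp) (QK K Q) hQi hM
  -- the remainder after truncation
  set R : ℕ → MvPolynomial (Fin 3) K := fun n =>
    Polynomial.aeval (MvPolynomial.X 0) B - derPoly (QK K Q) (truncTotal n f.1) -
      truncTotal n g₁.1 * (MvPolynomial.X 1 * MvPolynomial.X 2 - 1) -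
      truncTotal n g₂.1 * (MvPolynomial.X 1 ^ 2 - Polynomial.aeval (MvPolynomial.X 0) (QK K Q))
    with hR
  -- The functional kills the exact term and the multiples of the relations, and fixes B, for every
  -- truncation order.
  have hφR : ∀ n, φ (R n) = B := fun n => by
    have h1 := reductionFunctional_aeval_mul (QK K Q) ρ B 0 0
    simp only [pow_zero, mul_one, add_zero, Nat.zero_div] at h1
    simp only [hR, map_sub φ]
    rw [reductionFunctional_derPoly _ _ hρ'' hρ, reductionFunctional_mul_yz _ _ hρ'',
      reductionFunctional_mul_curve, h1, if_pos (by simp)]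
    have h2 := hρ' 0 B (by rw [hdegK]; exact hB)
    rw [pow_zero, one_mul] at h2
    rw [h2]
    simp
  -- The untruncated expression vanishes, so R n is a combination of the tails of f, g₁ and g₂ and
  -- inherits their smallness uniformly in n.
  obtain ⟨D', hD'⟩ : ∃ D' : ℤ, ∀ n, TailBound (val p k K) M D' n (R n : MvPowerSeries (Fin 3) K) := by
    refine ⟨D + max E (max 2 (Q.natDegree + 2)), fun n => ?_⟩
    have h1 : (R n : MvPowerSeries (Fin 3) K) =
        derSeries K (QK K Q) (f.1 - (truncTotal n f.1 : MvPowerSeries (Fin 3) K)) +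
        ((g₁.1 - (truncTotal n g₁.1 : MvPowerSeries (Fin 3) K)) *
          (MvPowerSeries.X 1 * MvPowerSeries.X 2 + -1) +
        (g₂.1 - (truncTotal n g₂.1 : MvPowerSeries (Fin 3) K)) *
          (MvPowerSeries.X 1 ^ 2 + -Polynomial.aeval (MvPowerSeries.X 0) (QK K Q))) := by
      have h2 : g₁.1 * (MvPowerSeries.X 1 * MvPowerSeries.X 2 - 1) +
          g₂.1 * (MvPowerSeries.X 1 ^ 2 - Polynomial.aeval (MvPowerSeries.X 0) (QK K Q)) =
          Polynomial.aeval (MvPowerSeries.X 0) B - derSeries K (QK K Q) f.1 := by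
        rw [← coe_derOC]
        have e1 := coe_aeval_OC_X K (val p k K) 0 B
        have e2 := coe_aeval_OC_X K (val p k K) 0 (QK K Q)
        have e3 := congrArg (OC (val p k K)).val hg
        simp only [map_add, map_mul, map_sub, map_one, map_pow] at e3
        change g₁.1 * (MvPowerSeries.X 1 * MvPowerSeries.X 2 - 1) + g₂.1 *
          (MvPowerSeries.X 1 ^ 2 - ((Polynomial.aeval (OC.X (val p k K) 0) (QK K Q) :
            OC (val p k K)) : MvPowerSeries (Fin 3) K)) = _ at e3
        rw [e2] at e3
        refine e3.trans ?_
        rw [← e1]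
        rfl
      rw [derSeries_sub]
      simp only [hR, ← MvPolynomial.coeToMvPowerSeries.ringHom_apply, map_mul, map_sub, map_pow,
        map_one]
      simp only [MvPolynomial.coeToMvPowerSeries.ringHom_apply, MvPolynomial.coe_X, coe_aeval_X,
        coe_derPoly]
      linear_combination -h2
    rw [h1]
    have t₁ := hg₁.tailBound_sub_truncTotal hM n
    have t₂ := hg₂.tailBound_sub_truncTotal hM n
    refine ((hE D n _ (hf.tailBound_sub_truncTotal hM n)).mono (by lia)).add (TailBound.add ?_ ?_)
    · refine (t₁.mul hM (E := 2) (GrowthBound.add ?_ ?_)).mono (by lia)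
      · exact (GrowthBound.X hM 1).mul hM (GrowthBound.X hM 2)
      · exact (GrowthBound.one hM).neg.mono (by lia)
    · refine (t₂.mul hM (E := Q.natDegree + 2) (GrowthBound.add ?_ ?_)).mono (by lia)
      · exact ((GrowthBound.X hM 1).pow hM 2).mono (by push_cast; lia)
      · refine (growthBound_aeval hM 0 _ hQi).neg.mono ?_
        rw [hdegK]
        lia
  -- The factor 2M makes the logarithmic loss of the functional cost at most half of the linear gain
  -- in max(n, |s|), up to a constant. The other half, for n large, contradicts a nonzero
  -- coefficient of B.
  obtain ⟨C, hC⟩ := exists_mul_log_le (Fact.out : p.Prime).two_le (2 * M) (2 * Q.natDegree)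
  refine Polynomial.ext fun i => ?_
  rw [Polynomial.coeff_zero]
  by_contra hne
  set t := log (val p k K (B.coeff i))
  have ht : val p k K (B.coeff i) = exp t := (exp_log ((Valuation.ne_zero_iff _).2 hne)).symm
  set n := (2 * D' + C - 2 * (M * t)).toNat + 1
  have h1 : val p k K (B.coeff i) ^ M ≤ exp (M * t - 1) := by
    rw [← hφR n, (R n).as_sum, map_sum, Polynomial.finsetSum_coeff]
    refine val_sum_pow_le _ _ M hM _ fun s _ => ?_
    refine (pow_le_pow_left₀ zero_le (val_coeff_reductionFunctional_le K Q hmon hcop hQd hQp ρ hρ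
      hρ' s _ i) M).trans ?_
    have h2 := hD' n s
    rw [MvPolynomial.coeff_coe] at h2
    rw [mul_pow, ← exp_nsmul]
    refine (mul_le_mul' h2 le_rfl).trans ?_
    rw [← exp_add, exp_le_exp, nsmul_eq_mul]
    have h3 := hC s.degree
    zify at h3
    have h4 : (2 * D' + C - 2 * (M * t)) + 1 ≤ (n : ℤ) := by
      simp only [n]
      push_cast
      have := Int.self_le_toNat (2 * D' + C - 2 * (M * t))
      lia
    have h5 : (n : ℤ) ≤ (max n s.degree : ℕ) := by exact_mod_cast le_max_left _ _
    have h6 : (s.degree : ℤ) ≤ (max n s.degree : ℕ) := by exact_mod_cast le_max_right _ _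
    nlinarith
  rw [ht, ← exp_nsmul, exp_le_exp, nsmul_eq_mul] at h1
  lia

end UniquenessWitt

/-! ### Tails of convergent sums over ℤ_q. -/

section Tails

variable {p : ℕ} [Fact p.Prime] {k : Type*} [Field k] [CharP k p] [PerfectRing k p]

/-- The tails of a convergent series of Witt vectors. -/
theorem exists_tails (b : ℕ → Zq p k) (L : ℕ) (hL : 0 < L)
    (hb : ∀ j, (p : Zq p k) ^ (j / L) ∣ b j) :
    ∃ τ : ℕ → Zq p k, (∀ j, τ j = b j + τ (j + 1)) ∧
      ∀ j M, (∀ i, j ≤ i → (p : Zq p k) ^ M ∣ b i) → (p : Zq p k) ^ M ∣ τ j := by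
  have hsum : ∀ M j n, j ≤ n → (∀ i, j ≤ i → (p : Zq p k) ^ M ∣ b i) →
      (p : Zq p k) ^ M ∣ ∑ i ∈ Finset.range n, b i - ∑ i ∈ Finset.range j, b i := by
    intro M j n hjn h
    rw [← Finset.sum_Ico_eq_sub _ hjn]
    exact Finset.dvd_sum fun i hi => h i (Finset.mem_Ico.1 hi).1
  have hmod : ∀ (M : ℕ) (x y : Zq p k),
      x ≡ y [SMOD (Ideal.span {(p : Zq p k)} ^ M • ⊤ : Submodule (Zq p k) (Zq p k))] ↔
        (p : Zq p k) ^ M ∣ x - y := by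
    intro M x y
    rw [SModEq.sub_mem, smul_eq_mul, Ideal.mul_top, Ideal.span_singleton_pow,
      Ideal.mem_span_singleton]
  obtain ⟨s, hs⟩ := IsPrecomplete.prec (I := Ideal.span {(p : Zq p k)}) inferInstance
    (f := fun n => ∑ i ∈ Finset.range (n * L), b i) (fun {m n} hmn => by
      rw [hmod, ← dvd_neg, neg_sub]
      refine hsum m (m * L) (n * L) (Nat.mul_le_mul_right _ hmn) fun i hi => ?_
      exact (pow_dvd_pow _ ((Nat.le_div_iff_mul_le hL).2 hi)).trans (hb i))
  refine ⟨fun j => s - ∑ i ∈ Finset.range j, b i, fun j => ?_, fun j M h => ?_⟩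
  · simp only [Finset.sum_range_succ]
    ring
  -- Precision M + j instead of M only ensures that the partial sum of length (M + j) L reaches past
  -- j.
  · have h1 := (hmod (M + j) _ _).1 (hs (M + j))
    have h2 := hsum M j ((M + j) * L)
      ((Nat.le_add_left j M).trans (Nat.le_mul_of_pos_right _ hL)) h
    have h3 := dvd_sub h2 ((pow_dvd_pow (p : Zq p k) (Nat.le_add_right M j)).trans h1)
    convert h3 using 1
    ring

open Polynomial in
-- `exists_tails` coefficientwise; the common degree bound makes the tails polynomials.
theorem exists_polynomial_tails (B : ℕ → (Zq p k)[X]) (d L : ℕ) (hL : 0 < L)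
    (hd : ∀ j, (B j).degree < (d : WithBot ℕ)) (hB : ∀ j, C ((p : Zq p k) ^ (j / L)) ∣ B j) :
    ∃ τ : ℕ → (Zq p k)[X], (∀ j, τ j = B j + τ (j + 1)) ∧ (∀ j, (τ j).degree < (d : WithBot ℕ)) ∧
      ∀ j M, (∀ i, j ≤ i → C ((p : Zq p k) ^ M) ∣ B i) → C ((p : Zq p k) ^ M) ∣ τ j := by
  choose t ht ht' using fun n => exists_tails (fun j => (B j).coeff n) L hL
    fun j => C_dvd_iff_dvd_coeff _ _ |>.1 (hB j) n
  have hc : ∀ j n, (∑ i ∈ Finset.range d, C (t i j) * X ^ i).coeff n =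
      if n < d then t n j else 0 := by
    intro j n
    simp [finsetSum_coeff, coeff_C_mul, coeff_X_pow]
  refine ⟨fun j => ∑ i ∈ Finset.range d, C (t i j) * X ^ i, fun j => ?_, fun j => ?_,
    fun j M h => ?_⟩
  · refine Polynomial.ext fun n => ?_
    rw [coeff_add, hc, hc]
    split_ifs with hn
    · exact ht n j
    · rw [add_zero]
      exact ((degree_lt_iff_coeff_zero _ _).1 (hd j) n (not_lt.1 hn)).symm
  · rw [degree_lt_iff_coeff_zero]
    intro n hn
    rw [hc, if_neg (not_lt.2 hn)]
  · rw [C_dvd_iff_dvd_coeff]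
    intro n
    rw [hc]
    split_ifs with hn
    · exact ht' n j M fun i hi => (C_dvd_iff_dvd_coeff _ _).1 (h i hi) n
    · exact dvd_zero _

end Tails

/-! ### Series in x and y⁻². -/

section EvenSeries

open MvPowerSeries WithZero

variable {K : Type*} [Field K]

/-- The series `∑_j P_j(x) z^(2j)`. -/
def evenSeries (P : ℕ → K[X]) : MvPowerSeries (Fin 3) K := fun s =>
  if s 1 = 0 ∧ Even (s 2) then (P (s 2 / 2)).coeff (s 0) else 0

theorem coeff_evenSeries (P : ℕ → K[X]) (s : Fin 3 →₀ ℕ) :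
    coeff s (evenSeries P) = if s 1 = 0 ∧ Even (s 2) then (P (s 2 / 2)).coeff (s 0) else 0 := rfl

theorem evenSeries_add (P P' : ℕ → K[X]) :
    evenSeries (fun j => P j + P' j) = evenSeries P + evenSeries P' := by
  ext s
  simp only [map_add, coeff_evenSeries]
  split_ifs <;> simp

theorem evenSeries_smul (c : K) (P : ℕ → K[X]) :
    evenSeries (fun j => c • P j) = c • evenSeries P := by
  ext s
  simp only [map_smul, coeff_evenSeries]
  split_ifs <;> simp

theorem coeff_X_pow_mul_eq_ite {ι : Type*} (i : ι) (n : ℕ) (f : MvPowerSeries ι K) (s : ι →₀ ℕ) :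
    coeff s (MvPowerSeries.X i ^ n * f) =
      if n ≤ s i then coeff (s - Finsupp.single i n) f else 0 := by
  classical
  simp only [X_pow_eq, coeff_monomial_mul, one_mul, Finsupp.single_le_iff]

theorem coeff_X_mul_eq_ite {ι : Type*} (i : ι) (f : MvPowerSeries ι K) (s : ι →₀ ℕ) :
    coeff s (MvPowerSeries.X i * f) =
      if 1 ≤ s i then coeff (s - Finsupp.single i 1) f else 0 := by
  rw [← coeff_X_pow_mul_eq_ite, pow_one]

theorem evenSeries_X_mul (P : ℕ → K[X]) :
    evenSeries (fun j => Polynomial.X * P j) = MvPowerSeries.X 0 * evenSeries P := by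
  ext s
  rw [coeff_X_mul_eq_ite]
  rcases h : s 0 with _ | n
  · simp [coeff_evenSeries, h]
  · simp [coeff_evenSeries, h]

theorem evenSeries_aeval_mul (A : K[X]) (P : ℕ → K[X]) :
    evenSeries (fun j => A * P j) = Polynomial.aeval (MvPowerSeries.X 0) A * evenSeries P := by
  induction A using Polynomial.induction_on' with
  | add A A' h h' => simp only [add_mul, evenSeries_add, h, h', map_add]
  | monomial n c =>
    have : ∀ n, evenSeries (fun j => Polynomial.X ^ n * P j) =
        MvPowerSeries.X 0 ^ n * evenSeries P := by
      intro n
      induction n with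
      | zero => simp
      | succ n ih =>
        simp only [pow_succ', mul_assoc]
        rw [evenSeries_X_mul, ih]
    simp only [← Polynomial.C_mul_X_pow_eq_monomial, ← Polynomial.smul_eq_C_mul, map_smul, map_pow,
      Polynomial.aeval_X, smul_mul_assoc, evenSeries_smul, this]

theorem X_two_sq_mul_evenSeries (P : ℕ → K[X]) :
    MvPowerSeries.X 2 ^ 2 * evenSeries P =
      evenSeries (fun j => if j = 0 then 0 else P (j - 1)) := by
  ext s
  rw [coeff_X_pow_mul_eq_ite]
  simp only [coeff_evenSeries]
  have h0 : (s - Finsupp.single 2 2 : Fin 3 →₀ ℕ) 0 = s 0 := by simp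
  have h1 : (s - Finsupp.single 2 2 : Fin 3 →₀ ℕ) 1 = s 1 := by simp
  have h2 : (s - Finsupp.single 2 2 : Fin 3 →₀ ℕ) 2 = s 2 - 2 := by simp
  rw [h0, h1, h2]
  rcases lt_or_ge (s 2) 2 with h | h
  · have h3 : s 2 / 2 = 0 := by lia
    rw [if_neg (by lia), h3]
    simp
  · have h3 : (s 2 - 2) / 2 = s 2 / 2 - 1 := by lia
    have h4 : s 2 / 2 ≠ 0 := by lia
    have h5 : Even (s 2 - 2) ↔ Even (s 2) := by
      rw [Nat.even_sub h]
      simp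
    rw [if_pos h, if_neg h4, h3]
    simp only [h5]

theorem evenSeries_single (P : K[X]) :
    evenSeries (fun j => if j = 0 then P else 0) = Polynomial.aeval (MvPowerSeries.X 0) P := by
  classical
  have h1 : evenSeries (fun j => if j = 0 then (1 : K[X]) else 0) = 1 := by
    ext s
    rw [coeff_evenSeries, coeff_one]
    rcases eq_or_ne s 0 with rfl | hs
    · simp
    rw [if_neg hs]
    split_ifs with h h'
    · rw [Polynomial.coeff_one, if_neg]
      intro h0
      apply hs
      ext i
      have h2 : s 2 = 0 := by
        obtain ⟨⟨_, a, ha⟩⟩ := And.intro h trivial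
        lia
      fin_cases i
      · exact h0
      · exact h.1
      · exact h2
    · rw [Polynomial.coeff_zero]
    · rfl
  have := evenSeries_aeval_mul P (fun j => if j = 0 then (1 : K[X]) else 0)
  rw [h1, mul_one] at this
  rw [← this]
  congr 1
  ext1 j
  split_ifs <;> simp

theorem pderiv_zero_evenSeries (P : ℕ → K[X]) :
    MvPowerSeries.pderiv K 0 (evenSeries P) = evenSeries fun j => Polynomial.derivative (P j) := by
  ext s
  rw [coeff_pderiv]
  simp only [coeff_evenSeries, Polynomial.coeff_derivative]
  simp

theorem pderiv_one_evenSeries (P : ℕ → K[X]) :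
    MvPowerSeries.pderiv K 1 (evenSeries P) = 0 := by
  ext s
  rw [coeff_pderiv, coeff_evenSeries]
  simp

theorem coeff_X_mul_pderiv {ι : Type*} (i : ι) (f : MvPowerSeries ι K) (s : ι →₀ ℕ) :
    coeff s (MvPowerSeries.X i * MvPowerSeries.pderiv K i f) = s i * coeff s f := by
  rw [coeff_X_mul_eq_ite]
  split_ifs with h
  · rw [coeff_pderiv, tsub_add_cancel_of_le (by rwa [Finsupp.single_le_iff]), mul_comm]
    simp [Nat.cast_sub h]
  · rw [show s i = 0 by lia]; simp

theorem X_two_mul_pderiv_evenSeries (P : ℕ → K[X]) :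
    MvPowerSeries.X 2 * MvPowerSeries.pderiv K 2 (evenSeries P) =
      evenSeries fun j => ((2 * j : ℕ) : K[X]) * P j := by
  ext s
  rw [coeff_X_mul_pderiv]
  simp only [coeff_evenSeries]
  split_ifs with h
  · rw [Nat.mul_div_cancel' h.2.two_dvd, Polynomial.coeff_natCast_mul]
  · rw [mul_zero]

/-- The termwise formula for d(2 U_j y / Q^j), before passing to the quotient. The multiples of y² -
Q and yz - 1 are kept explicit so that their cofactors can be seen to be overconvergent. -/
theorem derSeries_X_one_mul_evenSeries [CharZero K] (Q : K[X]) (U : ℕ → K[X]) :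
    derSeries K Q ((2 : K) • (MvPowerSeries.X 1 * evenSeries U)) =
      evenSeries (fun j => exactNum Q j (U j)) +
      2 * (MvPowerSeries.X 1 ^ 2 - Polynomial.aeval (MvPowerSeries.X 0) Q) *
        evenSeries (fun j => Polynomial.derivative (U j)) -
      Polynomial.aeval (MvPowerSeries.X 0) (Polynomial.derivative Q) *
        (MvPowerSeries.X 1 * MvPowerSeries.X 2 - 1) *
        evenSeries (fun j => ((2 * j : ℕ) : K[X]) * U j) := by
  have h1 : evenSeries (fun j => exactNum Q j (U j)) =
      2 * Polynomial.aeval (MvPowerSeries.X 0) Q *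
        evenSeries (fun j => Polynomial.derivative (U j)) -
      Polynomial.aeval (MvPowerSeries.X 0) (Polynomial.derivative Q) *
        (evenSeries (fun j => ((2 * j : ℕ) : K[X]) * U j) - evenSeries U) := by
    have e1 := evenSeries_aeval_mul (2 * Q) (fun j => Polynomial.derivative (U j))
    have e2 := evenSeries_aeval_mul (-Polynomial.derivative Q) (fun j => ((2 * j : ℕ) : K[X]) * U j)
    have e3 := evenSeries_aeval_mul (Polynomial.derivative Q) U
    have e4 : (fun j => exactNum Q j (U j)) = fun j => 2 * Q * Polynomial.derivative (U j) +
        (-Polynomial.derivative Q * (((2 * j : ℕ) : K[X]) * U j) + Polynomial.derivative Q * U j) := by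
      ext1 j
      simp only [exactNum]
      push_cast
      ring
    rw [e4, evenSeries_add, evenSeries_add, e1, e2, e3]
    simp only [map_neg, map_mul, map_ofNat]
    ring
  have h2 : ∀ f : MvPowerSeries (Fin 3) K, derSeries K Q ((2 : K) • f) =
      2 * (MvPowerSeries.X 1 * MvPowerSeries.pderiv K 0 f) +
      Polynomial.aeval (MvPowerSeries.X 0) (Polynomial.derivative Q) *
      (MvPowerSeries.pderiv K 1 f - MvPowerSeries.X 2 ^ 2 * MvPowerSeries.pderiv K 2 f) := by
    intro f
    have h3 : ∀ x : MvPowerSeries (Fin 3) K, (2 : K) • x = 2 * x := fun x => by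
      rw [MvPowerSeries.smul_eq_C_mul, map_ofNat]
    have h4 : 2 * ((2⁻¹ : K) • Polynomial.aeval (MvPowerSeries.X 0 : MvPowerSeries (Fin 3) K)
        (Polynomial.derivative Q)) = Polynomial.aeval (MvPowerSeries.X 0)
        (Polynomial.derivative Q) := by
      rw [← h3, smul_smul, mul_inv_cancel₀ two_ne_zero, one_smul]
    simp only [derSeries, Derivation.map_smul]
    simp only [h3]
    linear_combination (MvPowerSeries.pderiv K 1 f -
      MvPowerSeries.X 2 ^ 2 * MvPowerSeries.pderiv K 2 f) * h4
  have h5 := X_two_mul_pderiv_evenSeries U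
  have n1 : MvPowerSeries.pderiv K 0 (MvPowerSeries.X 1 : MvPowerSeries (Fin 3) K) = 0 :=
    MvPowerSeries.pderiv_X_of_ne (by decide)
  have n2 : MvPowerSeries.pderiv K 2 (MvPowerSeries.X 1 : MvPowerSeries (Fin 3) K) = 0 :=
    MvPowerSeries.pderiv_X_of_ne (by decide)
  rw [h2, h1, Derivation.leibniz, Derivation.leibniz, Derivation.leibniz, n1, n2,
    MvPowerSeries.pderiv_X_self, pderiv_zero_evenSeries, pderiv_one_evenSeries]
  simp only [smul_eq_mul]
  linear_combination (-(Polynomial.aeval (MvPowerSeries.X 0) (Polynomial.derivative Q) *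
    MvPowerSeries.X 1 * MvPowerSeries.X 2)) * h5

/-- The telescoping identity behind the summation of the reductions. -/
theorem evenSeries_pow_mul_sub (Q : K[X]) (B τ : ℕ → K[X]) (hτ : ∀ j, τ j = B j + τ (j + 1)) :
    evenSeries (fun j => Q ^ j * B j) - Polynomial.aeval (MvPowerSeries.X 0) (τ 0) =
      (Polynomial.aeval (MvPowerSeries.X 0) Q * MvPowerSeries.X 2 ^ 2 - 1) *
        evenSeries (fun j => Q ^ j * τ (j + 1)) := by
  -- Summation by parts with B_j = τ_j - τ_(j+1): for j ≥ 1, Q^j τ_j z^(2j) is Q z² times the term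
  -- Q^(j-1) τ_j z^(2(j-1)) of the series on the right.
  have h1 : (fun j => Q ^ j * B j) = fun j => ((if j = 0 then τ 0 else 0) +
      Q * (if j = 0 then 0 else Q ^ (j - 1) * τ (j - 1 + 1))) +
      (-1 : K) • (Q ^ j * τ (j + 1)) := by
    ext1 j
    rcases j with _ | j
    · simp [hτ 0]
    · simp only [Nat.add_eq_zero_iff, one_ne_zero, and_false, if_false, Nat.add_sub_cancel, hτ (j + 1),
        neg_smul, one_smul]
      ring
  rw [h1, evenSeries_add, evenSeries_add, evenSeries_single, evenSeries_aeval_mul,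
    ← X_two_sq_mul_evenSeries (fun j => Q ^ j * τ (j + 1)), evenSeries_smul]
  simp only [neg_smul, one_smul]
  ring

/-- A monomial x^a z^(2j) that occurs has degree at most (C+2) j + C, and j ≤ L ⌊j/L⌋ + L; this
gives the slope (C+2) L. -/
theorem isOverconvergent_evenSeries {v : Valuation K ℤᵐ⁰} (P : ℕ → K[X]) (C L : ℕ) (hL : 0 < L)
    (hd : ∀ j, (P j).natDegree ≤ C * (j + 1))
    (hv : ∀ j i, v ((P j).coeff i) ≤ exp (-((j / L : ℕ) : ℤ))) :
    IsOverconvergent v (evenSeries P) := by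
  refine ⟨(C + 2) * L, (C + 2) * (L + 1), by positivity, fun s => ?_⟩
  rw [coeff_evenSeries]
  split_ifs with h
  swap
  · rw [map_zero, zero_pow (by positivity)]
    exact zero_le
  obtain ⟨h1, j, hj⟩ := h
  have hj' : s 2 / 2 = j := by lia
  rw [hj']
  rcases lt_or_ge (P j).natDegree (s 0) with h0 | h0
  · rw [Polynomial.coeff_eq_zero_of_natDegree_lt h0, map_zero, zero_pow (by positivity)]
    exact zero_le
  refine (pow_le_pow_left₀ zero_le (hv j _) _).trans ?_
  rw [← exp_nsmul, exp_le_exp, nsmul_eq_mul, Finsupp.degree_eq_sum, Fin.sum_univ_three, h1, hj]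
  have h2 := h0.trans (hd j)
  have h3 : j ≤ L * (j / L) + L := by
    have := Nat.div_add_mod j L
    have := Nat.mod_lt j hL
    lia
  have h4 := Nat.mul_le_mul_left (C + 2) h3
  zify at h2 h4
  push_cast
  nlinarith

end EvenSeries

/-! ### Existence of reductions by summation. -/

section Existence

open MvPowerSeries WithZero

variable {p : ℕ} [Fact p.Prime] {k : Type*} [Field k] [CharP k p] [PerfectRing k p]
variable (K : Type*) [Field K] [Algebra (Zq p k) K] [IsFractionRing (Zq p k) K]
variable (Q : (Zq p k)[X])

theorem val_coeff_map_le {P : (Zq p k)[X]} {e : ℕ} (h : Polynomial.C ((p : Zq p k) ^ e) ∣ P)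
    (i : ℕ) : val p k K ((P.map (algebraMap (Zq p k) K)).coeff i) ≤ exp (-(e : ℤ)) := by
  obtain ⟨a, ha⟩ := (Polynomial.C_dvd_iff_dvd_coeff _ _).1 h i
  rw [Polynomial.coeff_map, ha, map_mul, map_mul, map_pow, map_natCast, map_pow, val_p,
    ← exp_nsmul]
  refine (mul_le_of_le_one_right' (val_algebraMap_le_one p k K a)).trans ?_
  simp

theorem isOverconvergent_evenSeries_map (P : ℕ → (Zq p k)[X]) (D L : ℕ) (hL : 0 < L)
    (hd : ∀ j, (P j).natDegree ≤ D * (j + 1))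
    (hv : ∀ j, Polynomial.C ((p : Zq p k) ^ (j / L)) ∣ P j) :
    IsOverconvergent (val p k K) (evenSeries fun j => (P j).map (algebraMap (Zq p k) K)) :=
  isOverconvergent_evenSeries _ D L hL (fun j => Polynomial.natDegree_map_le.trans (hd j))
    fun j i => val_coeff_map_le K (hv j) i

variable [CharZero K]

/-- Transfers the question to K⟨x, y, z⟩†, where the derivation and the relations are explicit. -/
theorem isReduction_iff (g : ℕ) (h : OC (val p k K)) (B : K[X]) :
    IsReduction g ((DaggerForm.coef (val p k K) (QK K Q)).symm (toDagger _ _ h)) B ↔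
      B.degree < ((2 * g : ℕ) : WithBot ℕ) ∧ ∃ f : OC (val p k K),
        h - Polynomial.aeval (OC.X (val p k K) 0) B - derOC (val p k K) (QK K Q) f ∈
          relIdeal (val p k K) (QK K Q) := by
  have h1 : Polynomial.aeval (xA (val p k K) (QK K Q)) B • dxOverY (val p k K) (QK K Q) =
      (DaggerForm.coef (val p k K) (QK K Q)).symm
        (toDagger _ _ (Polynomial.aeval (OC.X (val p k K) 0) B)) := by
    rw [dxOverY, ← LinearEquiv.map_smul, smul_eq_mul, mul_one, xA, Polynomial.aeval_algHom_apply]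
  have h2 : ∀ f, (DaggerForm.coef (val p k K) (QK K Q)).symm (toDagger _ _ h) -
      Polynomial.aeval (xA (val p k K) (QK K Q)) B • dxOverY (val p k K) (QK K Q) =
        dA (val p k K) (QK K Q) (toDagger _ _ f) ↔
      h - Polynomial.aeval (OC.X (val p k K) 0) B - derOC (val p k K) (QK K Q) f ∈
          relIdeal (val p k K) (QK K Q) := by
    intro f
    rw [h1, dA_toDagger, ← map_sub, EmbeddingLike.apply_eq_iff_eq, ← map_sub,
      ← toDagger_eq_zero_iff, map_sub, map_sub, map_sub, sub_eq_zero]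
  rw [IsReduction, Cohomologous]
  refine and_congr_right fun _ => ⟨?_, ?_⟩
  · rintro ⟨f, hf⟩
    obtain ⟨f, rfl⟩ := toDagger_surjective _ _ f
    exact ⟨f, (h2 f).1 hf⟩
  · rintro ⟨f, hf⟩
    exact ⟨toDagger _ _ f, (h2 f).2 hf⟩

/-- Summation of reductions: a form `∑_j A_j(x) y^(-2j) dx/y` whose terms have integral reductions
tending linearly to zero has an integral reduction. -/
theorem exists_isReduction (g : ℕ) (hg : Q.natDegree = 2 * g + 1) (A : ℕ → (Zq p k)[X])
    (D L N : ℕ) (hL : 0 < L)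
    (hA : ∀ j, ∃ U B : (Zq p k)[X], A j = exactNum Q j U + Q ^ j * B ∧
      U.natDegree ≤ D * (j + 1) ∧ B.degree < ((2 * g : ℕ) : WithBot ℕ) ∧
      Polynomial.C ((p : Zq p k) ^ (j / L)) ∣ U ∧ Polynomial.C ((p : Zq p k) ^ (j / L)) ∣ B ∧
      Polynomial.C ((p : Zq p k) ^ N) ∣ B) (h : OC (val p k K))
    (hh : h.1 = evenSeries fun j => (A j).map (algebraMap (Zq p k) K)) :
    ∃ S : (Zq p k)[X],
      IsReduction g ((DaggerForm.coef (val p k K) (QK K Q)).symm (toDagger _ _ h))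
        (S.map (algebraMap (Zq p k) K)) ∧ Polynomial.C ((p : Zq p k) ^ N) ∣ S := by
  choose U B hAUB hU hB hUp hBp hBN using hA
  obtain ⟨τ, hτ, hτd, hτp⟩ := exists_polynomial_tails B (2 * g) L hL hB hBp
  set ψ : (Zq p k)[X] → K[X] := fun P => P.map (algebraMap (Zq p k) K) with hψ
  have hUo : IsOverconvergent (val p k K) (evenSeries fun j => ψ (U j)) :=
    isOverconvergent_evenSeries_map K U D L hL hU hUp
  have hU'o : IsOverconvergent (val p k K)
      (evenSeries fun j => Polynomial.derivative (ψ (U j))) := by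
    simp only [hψ, Polynomial.derivative_map]
    refine isOverconvergent_evenSeries_map K (fun j => Polynomial.derivative (U j)) D L hL
      (fun j => ?_) fun j => ?_
    · exact (Polynomial.natDegree_derivative_le _).trans ((Nat.sub_le _ _).trans (hU j))
    · obtain ⟨a, ha⟩ := hUp j
      exact ⟨Polynomial.derivative a, by rw [ha, Polynomial.derivative_C_mul]⟩
  have hjU : IsOverconvergent (val p k K) (evenSeries fun j => ((2 * j : ℕ) : K[X]) * ψ (U j)) := by
    have : (fun j => ((2 * j : ℕ) : K[X]) * ψ (U j)) = fun j =>
        (((2 * j : ℕ) : (Zq p k)[X]) * U j).map (algebraMap (Zq p k) K) := by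
      ext1 j
      simp [hψ]
    rw [this]
    refine isOverconvergent_evenSeries_map K (fun j => ((2 * j : ℕ) : (Zq p k)[X]) * U j) D L hL
      (fun j => ?_) fun j => (hUp j).mul_left _
    rw [← Polynomial.C_eq_natCast]
    exact (Polynomial.natDegree_C_mul_le _ _).trans (hU j)
  -- The tails have bounded degree and decay as fast as the B_i, while Q^j adds only linear growth
  -- of the degree.
  have hWo : IsOverconvergent (val p k K) (evenSeries fun j => (QK K Q) ^ j * ψ (τ (j + 1))) := by
    have : (fun j => (QK K Q) ^ j * ψ (τ (j + 1))) = fun j =>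
        (Q ^ j * τ (j + 1)).map (algebraMap (Zq p k) K) := by
      ext1 j
      simp [hψ]
    rw [this]
    refine isOverconvergent_evenSeries_map K (fun j => Q ^ j * τ (j + 1)) (4 * g + 1) L hL
      (fun j => ?_) fun j => (hτp (j + 1) _ fun i hi => ?_).mul_left _
    · refine Polynomial.natDegree_mul_le.trans ?_
      have h1 : (Q ^ j).natDegree ≤ j * (2 * g + 1) := by
        rw [← hg]; exact Polynomial.natDegree_pow_le
      have h2 : (τ (j + 1)).natDegree ≤ 2 * g := Polynomial.natDegree_le_of_degree_le (hτd _).le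
      nlinarith
    · refine dvd_trans ?_ (hBp i)
      rw [map_pow, map_pow]
      exact pow_dvd_pow _ (Nat.div_le_div_right (by lia))
  set x := OC.X (val p k K) 0
  set y := OC.X (val p k K) 1
  set z := OC.X (val p k K) 2
  let u : OC (val p k K) := ⟨_, hUo⟩
  let u' : OC (val p k K) := ⟨_, hU'o⟩
  let ju : OC (val p k K) := ⟨_, hjU⟩
  let w : OC (val p k K) := ⟨_, hWo⟩
  refine ⟨τ 0, (isReduction_iff K Q g h _).2 ⟨?_, (2 : K) • (y * u), ?_⟩,
    hτp 0 N fun i _ => hBN i⟩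
  · exact Polynomial.degree_map_le.trans_lt (hτd 0)
  · have hder := derSeries_X_one_mul_evenSeries (QK K Q) fun j => ψ (U j)
    have htel := evenSeries_pow_mul_sub (QK K Q) (fun j => ψ (B j)) (fun j => ψ (τ j)) fun j => by
      simp only [hψ]
      rw [hτ j, Polynomial.map_add]
    have hsplit : h.1 = evenSeries (fun j => exactNum (QK K Q) j (ψ (U j))) +
        evenSeries (fun j => (QK K Q) ^ j * ψ (B j)) := by
      rw [hh, ← evenSeries_add]
      congr 1
      ext1 j
      simp only [hψ]
      rw [hAUB j, Polynomial.map_add, exactNum_map, Polynomial.map_mul, Polynomial.map_pow]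
    set q := Polynomial.aeval x (QK K Q)
    set q' := Polynomial.aeval x (Polynomial.derivative (QK K Q))
    -- The primitive is 2y ∑ U_j z^(2j). The cofactors come from the derivative formula and from the
    -- telescoping identity, using Q z² - 1 = (yz + 1)(yz - 1) - z² (y² - Q).
    have key : h - Polynomial.aeval x (ψ (τ 0)) - derOC (val p k K) (QK K Q) ((2 : K) • (y * u)) =
        (q' * ju + (y * z + 1) * w) * (y * z - 1) + (-(2 * u') - z ^ 2 * w) * (y ^ 2 - q) := by
      refine Subtype.ext ?_
      have e1 : ((derOC (val p k K) (QK K Q) ((2 : K) • (y * u)) : OC (val p k K)) :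
          MvPowerSeries (Fin 3) K) = _ := (coe_derOC K _ _ _).trans hder
      have e2 := coe_aeval_OC_X K (val p k K) 0 (ψ (τ 0))
      have e3 := coe_aeval_OC_X K (val p k K) 0 (QK K Q)
      have e4 := coe_aeval_OC_X K (val p k K) 0 (Polynomial.derivative (QK K Q))
      rw [← e2, ← e3] at htel
      rw [← e3, ← e4] at e1
      have c1 : (y : MvPowerSeries (Fin 3) K) = MvPowerSeries.X 1 := rfl
      have c2 : (z : MvPowerSeries (Fin 3) K) = MvPowerSeries.X 2 := rfl
      simp only [Subalgebra.coe_sub, Subalgebra.coe_add, Subalgebra.coe_mul, Subalgebra.coe_pow,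
        Subalgebra.coe_neg, Subalgebra.coe_one, e1, c1, c2]
      have c3 : ((2 : OC (val p k K)) : MvPowerSeries (Fin 3) K) = 2 := rfl
      rw [c3]
      linear_combination hsplit + htel
    rw [key]
    exact Ideal.mem_span_pair.2 ⟨_, _, rfl⟩

end Existence

/-! ### Expansion of σ(x^i dx/y) and reduction of its terms. -/

section FrobeniusSeries

open MvPowerSeries WithZero

theorem X_two_pow_mul_evenSeries {K : Type*} [Field K] (n : ℕ) (P : ℕ → K[X]) :
    MvPowerSeries.X 2 ^ (2 * n) * evenSeries P =
      evenSeries (fun j => if n ≤ j then P (j - n) else 0) := by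
  induction n with
  | zero => simp
  | succ n ih =>
    rw [mul_add, mul_one, add_comm, pow_add, mul_assoc, ih, X_two_sq_mul_evenSeries]
    congr 1
    ext1 j
    rcases j with _ | j
    · simp
    · simp only [Nat.add_eq_zero_iff, one_ne_zero, and_false, if_false, Nat.add_sub_cancel,
        Nat.add_le_add_iff_right, Nat.add_sub_add_right]

theorem evenSeries_ite_eq {K : Type*} [Field K] (n : ℕ) (P : K[X]) :
    evenSeries (fun j => if j = n then P else 0) =
      Polynomial.aeval (MvPowerSeries.X 0) P * MvPowerSeries.X 2 ^ (2 * n) := by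
  rw [← evenSeries_single, mul_comm, X_two_pow_mul_evenSeries]
  congr 1
  ext1 j
  split_ifs <;> first | rfl | lia

variable {p : ℕ} [Fact p.Prime] {k : Type*} [Field k] [CharP k p] [PerfectRing k p]
variable (K : Type*) [Field K] [Algebra (Zq p k) K] [IsFractionRing (Zq p k) K]
variable (Q : (Zq p k)[X])

/-- The n-th power of `frobArg` lives in z-degree 2pn alone, so at most one n contributes to each
level j. -/
theorem subst_frobArg_eq_evenSeries (c : PowerSeries K) :
    PowerSeries.subst (frobArg K Q) c = evenSeries fun j =>
      if p ∣ j then PowerSeries.coeff (j / p) c • (QK K (frobDefect Q)) ^ (j / p) else 0 := by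
  have hp := (Fact.out : p.Prime).pos
  have hpow : ∀ n, frobArg K Q ^ n =
      evenSeries (fun j => if j = p * n then (QK K (frobDefect Q)) ^ n else 0) := fun n => by
    rw [evenSeries_ite_eq, frobArg, mul_pow, map_pow, ← pow_mul, mul_assoc]
  ext s
  rw [PowerSeries.coeff_subst (hasSubst_frobArg K Q)]
  simp only [hpow, coeff_evenSeries]
  by_cases hs : s 1 = 0 ∧ Even (s 2)
  · simp only [if_pos hs]
    rw [finsum_eq_single _ (s 2 / 2 / p)]
    · by_cases hd : p ∣ s 2 / 2
      · rw [if_pos (Nat.mul_div_cancel' hd).symm, if_pos hd, Polynomial.coeff_smul]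
      · rw [if_neg, if_neg hd, Polynomial.coeff_zero, smul_zero]
        exact fun h => hd ⟨_, h⟩
    · intro n hn
      rw [if_neg, Polynomial.coeff_zero, smul_zero]
      intro h
      exact hn (by rw [h, Nat.mul_div_cancel_left _ hp])
  · simp only [if_neg hs, smul_zero, finsum_zero]

/-- The polynomial `p β_n x^(p(i+1)-1) (Q^σ - Q^p)^n`. -/
def frobTerm (β : ℕ → Zq p k) (i n : ℕ) : (Zq p k)[X] :=
  Polynomial.C (p * β n) * Polynomial.X ^ (p * (i + 1) - 1) * frobDefect Q ^ n

/-- The numerators of the expansion of `σ(x^i dx/y)`, without the first `T` terms. -/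
def frobSeq (β : ℕ → Zq p k) (i T j : ℕ) : (Zq p k)[X] :=
  if (p - 1) / 2 ≤ j ∧ p ∣ j - (p - 1) / 2 ∧ T ≤ (j - (p - 1) / 2) / p then
    frobTerm Q β i ((j - (p - 1) / 2) / p) else 0

theorem frobSeq_eq_add (β : ℕ → Zq p k) (i T j : ℕ) :
    frobSeq Q β i T j = frobSeq Q β i (T + 1) j +
      if j = (p - 1) / 2 + p * T then frobTerm Q β i T else 0 := by
  have hp := (Fact.out : p.Prime).pos
  simp only [frobSeq]
  by_cases h : (p - 1) / 2 ≤ j ∧ p ∣ j - (p - 1) / 2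
  · obtain ⟨h1, n, hn⟩ := h
    have h2 : j = (p - 1) / 2 + p * n := by lia
    have h3 : (j - (p - 1) / 2) / p = n := by rw [hn, Nat.mul_div_cancel_left _ hp]
    have h4 : j = (p - 1) / 2 + p * T ↔ n = T := by
      rw [h2]
      simp [hp.ne']
    have h5 : p ∣ j - (p - 1) / 2 := ⟨n, hn⟩
    simp only [h1, h5, h3, h4, true_and]
    rcases lt_trichotomy n T with h | rfl | h
    · rw [if_neg (by lia), if_neg (by lia), if_neg (by lia), add_zero]
    · simp
    · rw [if_pos (by lia), if_pos (by lia), if_neg (by lia), add_zero]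
  · rw [if_neg (fun h' => h ⟨h'.1, h'.2.1⟩), if_neg (fun h' => h ⟨h'.1, h'.2.1⟩), if_neg, add_zero]
    rintro rfl
    exact h ⟨by lia, T, by lia⟩

theorem evenSeries_frobSeq (β : ℕ → Zq p k) (i T : ℕ) :
    evenSeries (fun j => QK K (frobSeq Q β i 0 j)) =
      evenSeries (fun j => QK K (frobSeq Q β i T j)) +
      ∑ n ∈ Finset.range T, Polynomial.aeval (MvPowerSeries.X 0) (QK K (frobTerm Q β i n)) *
        MvPowerSeries.X 2 ^ (2 * ((p - 1) / 2 + p * n)) := by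
  induction T with
  | zero => simp
  | succ T ih =>
    rw [ih, Finset.sum_range_succ, ← evenSeries_ite_eq, add_comm (Finset.sum _ _), ← add_assoc]
    congr 1
    rw [← evenSeries_add]
    congr 1
    ext1 j
    rw [frobSeq_eq_add, QK, QK, Polynomial.map_add]
    split_ifs <;> simp

/-- Bounds the loss l in the n-th term by n - ⌊n/2⌋, so that p^⌊n/2⌋ survives: the linear decay
needed for convergence. -/
theorem two_mul_add_one_lt_pow_half {p : ℕ} (hp : 3 ≤ p) (n : ℕ) :
    2 * n + 1 < p ^ (n - n / 2 + 1) := by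
  have h : ∀ c, 4 * c + 3 ≤ p ^ (c + 1) := fun c => by
    induction c with
    | zero => simpa using hp
    | succ c ih =>
      rw [pow_succ]
      nlinarith
  have := h (n - n / 2)
  lia

/-- Bounds the loss by n - N, so that p^N survives in every omitted term. The case n = N is the
condition 2N + 1 < p itself. -/
theorem two_mul_add_one_lt_pow_sub {p N : ℕ} (hp : 3 ≤ p) (hN : 2 * N + 1 < p) (n : ℕ)
    (hn : N ≤ n) : 2 * n + 1 < p ^ (n - N + 1) := by
  obtain ⟨t, rfl⟩ := Nat.exists_eq_add_of_le hn
  rw [Nat.add_sub_cancel_left]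
  induction t with
  | zero => simpa using hN
  | succ t ih =>
    have := ih (by lia)
    rw [pow_succ]
    nlinarith

/-- The reductions of the terms of the expansion of `σ(x^i dx/y)`. -/
theorem exists_reduction_frobTerm (hp : 3 ≤ p) (g : ℕ) (hg : 1 ≤ g) (hmon : Q.Monic)
    (hdeg : Q.natDegree = 2 * g + 1) (hcop : IsCoprime Q (Polynomial.derivative Q))
    (hgp : 2 * g + 1 < p) (β : ℕ → Zq p k) (i : ℕ) (hi : i < 2 * g) (n : ℕ) :
    ∃ l : ℕ, (∀ t, 2 * n + 1 < p ^ (t + 1) → l ≤ t) ∧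
      ∃ U B : (Zq p k)[X], frobTerm Q β i n =
        exactNum Q ((p - 1) / 2 + p * n) U + Q ^ ((p - 1) / 2 + p * n) * B ∧
      U.natDegree ≤ ((p - 1) / 2 + p * n) * (2 * g + 1) + (2 * g - 1) * ((p - 1) / 2) ∧
      B.degree < ((2 * g : ℕ) : WithBot ℕ) ∧
      Polynomial.C ((p : Zq p k) ^ (n - l)) ∣ U ∧ Polynomial.C ((p : Zq p k) ^ (n - l)) ∣ B := by
  have hpp := (Fact.out : p.Prime)
  -- The entry 2n + 1 covers the denominators at the zeros of Q and 2g those at infinity, each after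
  -- removing one factor p. Since 2g < p, the second never spoils the bounds on l.
  set l := Nat.log p (max (2 * n + 1) (2 * g)) with hl
  have hlt : ∀ t, 2 * n + 1 < p ^ (t + 1) → l ≤ t := by
    intro t ht
    refine Nat.lt_succ_iff.1 (Nat.log_lt_of_lt_pow (by lia) (max_lt ht ?_))
    calc 2 * g < p ^ 1 := by lia
      _ ≤ _ := Nat.pow_le_pow_right hpp.pos (by lia)
  have hln : l ≤ n := (hlt _ (two_mul_add_one_lt_pow_half hp n)).trans (Nat.sub_le _ _)
  refine ⟨l, hlt, ?_⟩
  obtain ⟨h₀, hh₀⟩ : ∃ h, p = 2 * h + 1 := (hpp.eq_two_or_odd'.resolve_left (by lia))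
  have hh : (p - 1) / 2 = h₀ := by lia
  obtain ⟨E, hE⟩ : Polynomial.C (p : Zq p k) ∣ frobDefect Q :=
    (Polynomial.C_dvd_iff_dvd_coeff _ _).2 (frobDefect_coeff Q)
  have hEd : E.natDegree ≤ p * (2 * g + 1) := by
    have h1 : (frobDefect Q).natDegree ≤ p * (2 * g + 1) := by
      refine (Polynomial.natDegree_sub_le _ _).trans (max_le ?_ ?_)
      · rw [Polynomial.natDegree_expand, mul_comm]
        exact Nat.mul_le_mul_left _ (Polynomial.natDegree_map_le.trans hdeg.le)
      · rw [← hdeg]; exact Polynomial.natDegree_pow_le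
    have h2 := Polynomial.natDegree_C_mul (p := E) (WittVector.p_nonzero p k)
    rw [← h2, ← hE]
    exact h1
  -- The numerator of the term without its factor p^(n+1).
  set A : (Zq p k)[X] := Polynomial.C (β n) * Polynomial.X ^ (p * (i + 1) - 1) * E ^ n
  have hA : A.natDegree ≤ p * (2 * g) - 1 + n * (p * (2 * g + 1)) := by
    refine Polynomial.natDegree_mul_le.trans (add_le_add ?_ ?_)
    · refine (Polynomial.natDegree_C_mul_X_pow_le _ _).trans (Nat.sub_le_sub_right ?_ 1)
      exact Nat.mul_le_mul_left _ (by lia)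
    · exact Polynomial.natDegree_pow_le.trans (Nat.mul_le_mul_left _ hEd)
  have hpow : max (2 * n + 1) (2 * g) < p ^ (l + 1) := Nat.lt_pow_succ_log_self hpp.one_lt _
  have hp1 : p ^ (1 + l + 1) = p * p ^ (l + 1) := by rw [add_assoc, pow_add, pow_one]
  have hmax1 : p * (2 * n + 1) ≤ p * p ^ (l + 1) :=
    Nat.mul_le_mul_left _ ((le_max_left _ _).trans hpow.le)
  have hmax2 : p * (2 * g + 1) ≤ p * p ^ (l + 1) :=
    Nat.mul_le_mul_left _ (Nat.succ_le_of_lt ((le_max_right _ _).trans_lt hpow))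
  obtain ⟨G, rfl⟩ : ∃ G, g = G + 1 := ⟨g - 1, by lia⟩
  have hG : 2 * (G + 1) - 1 = 2 * G + 1 := by lia
  -- With p = 2h₀ + 1 and pole order m = h₀ + pn, the excess (2g-1) h₀ at infinity is exactly what
  -- deg A < 2gp + np(2g+1) requires. The exponent 1 + l suffices because 2m < p(2n+1) and 2(2g-1)h₀
  -- + 2g + 1 = (2g-1)p + 2.
  obtain ⟨U, B, h, hU, hB⟩ := exists_exactNum_add_Zq Q hmon hcop (by lia) (by lia)
    (h₀ + p * n) ((2 * (G + 1) - 1) * h₀) (1 + l)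
    (by
      rw [hp1]
      refine le_trans ?_ hmax1
      have h3 : p * (2 * n + 1) = 2 * (p * n) + p := by ring
      lia)
    (by
      rw [hp1, hdeg, hG]
      refine le_trans ?_ (Nat.add_le_add_right hmax2 1)
      rw [hh₀]
      nlinarith)
    A (by
      refine Polynomial.degree_le_natDegree.trans_lt ?_
      rw [hdeg, hG]
      have h1 : 0 < p * (2 * (G + 1)) := by positivity
      have h2 : (h₀ + p * n) * (2 * (G + 1) + 1) + (2 * G + 1) * h₀ + (2 * (G + 1) + 1) - 1 =
          p * (2 * (G + 1)) + n * (p * (2 * (G + 1) + 1)) := by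
        rw [Nat.add_sub_assoc (by lia), Nat.add_sub_cancel]
        generalize hX : p * n * (2 * (G + 1) + 1) = X
        have : n * (p * (2 * (G + 1) + 1)) = X := by rw [← hX]; ring
        rw [this, add_mul, hX, hh₀]
        ring
      rw [h2]
      exact_mod_cast (by lia))
  rw [hh]
  refine ⟨Polynomial.C ((p : Zq p k) ^ (n - l)) * U, Polynomial.C ((p : Zq p k) ^ (n - l)) * B,
    ?_, ?_, ?_, dvd_mul_right _ _, dvd_mul_right _ _⟩
  · rw [exactNum_C_mul]
    have h1 : frobTerm Q β i n = Polynomial.C ((p : Zq p k) ^ (n - l)) *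
        (Polynomial.C ((p : Zq p k) ^ (1 + l)) * A) := by
      -- Of the available p^(n+1), the part p^(1+l) pays for the denominators and p^(n-l) is left.
      have h2 : (p : Zq p k) ^ (n - l) * (p : Zq p k) ^ (1 + l) = p * (p : Zq p k) ^ n := by
        rw [← pow_add, ← pow_succ']; congr 1; lia
      rw [← mul_assoc, ← Polynomial.C_mul, h2]
      simp only [frobTerm, A, hE, mul_pow, Polynomial.C_mul, Polynomial.C_pow]
      ring
    rw [h1, h]
    ring
  · refine (Polynomial.natDegree_C_mul_le _ _).trans ?_
    rwa [hdeg] at hU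
  · refine degree_C_mul_lt _ ?_
    rwa [hdeg, Nat.add_sub_cancel] at hB

/-- Only levels j = (p-1)/2 + pn with n ≥ T carry a term. There ⌊j/(2p)⌋ = ⌊n/2⌋, and the surviving
exponent n - l is at least ⌊n/2⌋ and, by `hT`, at least T. -/
theorem exists_reduction_frobSeq (hp : 3 ≤ p) (g : ℕ) (hg : 1 ≤ g) (hmon : Q.Monic)
    (hdeg : Q.natDegree = 2 * g + 1) (hcop : IsCoprime Q (Polynomial.derivative Q))
    (hgp : 2 * g + 1 < p) (β : ℕ → Zq p k) (i : ℕ) (hi : i < 2 * g) (T : ℕ)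
    (hT : ∀ n, T ≤ n → 2 * n + 1 < p ^ (n - T + 1)) (j : ℕ) :
    ∃ U B : (Zq p k)[X], frobSeq Q β i T j = exactNum Q j U + Q ^ j * B ∧
      U.natDegree ≤ (2 * g + 1 + (2 * g - 1) * ((p - 1) / 2)) * (j + 1) ∧
      B.degree < ((2 * g : ℕ) : WithBot ℕ) ∧
      Polynomial.C ((p : Zq p k) ^ (j / (2 * p))) ∣ U ∧
      Polynomial.C ((p : Zq p k) ^ (j / (2 * p))) ∣ B ∧
      Polynomial.C ((p : Zq p k) ^ T) ∣ B := by
  have hpos := (Fact.out : p.Prime).pos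
  rw [frobSeq]
  split_ifs with h
  · obtain ⟨h1, ⟨n, hn⟩, h3⟩ := h
    have hj : j = (p - 1) / 2 + p * n := by lia
    rw [hn, Nat.mul_div_cancel_left _ hpos] at h3 ⊢
    obtain ⟨l, hl, U, B, h4, h5, h6, h7, h8⟩ :=
      exists_reduction_frobTerm Q hp g hg hmon hdeg hcop hgp β i hi n
    have hl1 := hl _ (two_mul_add_one_lt_pow_half hp n)
    have hl2 := hl _ (hT n h3)
    have hdvd : ∀ a, a ≤ n - l → Polynomial.C ((p : Zq p k) ^ a) ∣
        Polynomial.C ((p : Zq p k) ^ (n - l)) := fun a ha => by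
      rw [map_pow, map_pow]
      exact pow_dvd_pow _ ha
    have hj2 : j / (2 * p) ≤ n - l := by
      have : j / p = n := by
        rw [hj, Nat.add_mul_div_left _ _ hpos, Nat.div_eq_of_lt (by lia), zero_add]
      rw [mul_comm, ← Nat.div_div_eq_div_mul, this]
      lia
    rw [← hj] at h4 h5
    refine ⟨U, B, h4, h5.trans ?_, h6, (hdvd _ hj2).trans h7, (hdvd _ hj2).trans h8,
      (hdvd _ (by lia)).trans h8⟩
    nlinarith [Nat.zero_le ((2 * g - 1) * ((p - 1) / 2) * j)]
  · refine ⟨0, 0, by simp [exactNum], by simp, ?_, dvd_zero _, dvd_zero _, dvd_zero _⟩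
    rw [Polynomial.degree_zero]
    exact WithBot.bot_lt_coe _

end FrobeniusSeries

/-! ### Comparison of T_i with σ(x^i dx/y). -/

section MainTheorem

open MvPowerSeries WithZero

theorem card_termIndex_le {g N : ℕ} (hg : 1 ≤ g) (hN : 1 ≤ N) :
    (termIndex g N).card ≤ 2 * N ^ 2 * g := by
  have h : ∀ N, 2 * (termIndex g (N + 1)).card = (2 * g + 1) * ((N + 1) * N) + 2 * (N + 1) := by
    intro N
    simp only [termIndex, Finset.card_sigma, Finset.card_range]
    induction N with
    | zero => simp
    | succ N ih =>
      rw [Finset.sum_range_succ, mul_add, ih]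
      ring
  obtain ⟨N, rfl⟩ := Nat.exists_eq_add_of_le' hN
  obtain ⟨g, rfl⟩ := Nat.exists_eq_add_of_le' hg
  have := h N
  nlinarith [Nat.zero_le (N * g), Nat.zero_le (N * N * g)]

variable {p : ℕ} [Fact p.Prime] {k : Type*} [Field k] [CharP k p] [PerfectRing k p]
variable (K : Type*) [Field K] [Algebra (Zq p k) K] [IsFractionRing (Zq p k) K]
variable (Q : (Zq p k)[X])

theorem exists_integral_choose_neg_half [CharZero K] (hp : 3 ≤ p) :
    ∃ β : ℕ → Zq p k, ∀ m, algebraMap (Zq p k) K (β m) = ((Ring.choose (-1 / 2 : ℚ) m : ℚ) : K) := by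
  refine Classical.axiom_of_choice (r := fun m b => algebraMap (Zq p k) K b = _) fun m => ?_
  have h := val_binomSeries_neg_half_le_one (val_two p k K hp) m
  rw [binomSeries, PowerSeries.coeff_mk] at h
  exact IsDiscreteValuationRing.exists_lift_of_le_one h

theorem coeffB_mem_range (β : ℕ → Zq p k)
    (hβ : ∀ m, algebraMap (Zq p k) K (β m) = ((Ring.choose (-1 / 2 : ℚ) m : ℚ) : K)) (N j r : ℕ) :
    ∃ b : Zq p k, algebraMap (Zq p k) K b = coeffB K Q N j r := by
  refine ⟨p * WittVector.frobenius ((Q ^ j).coeff r) *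
    ∑ m ∈ Finset.Ico j N, (-1) ^ (m + j) * β m * (m.choose j : Zq p k), ?_⟩
  simp only [coeffB, map_mul, map_sum, map_pow, map_neg, map_one, map_natCast, hβ]

variable [CharZero K]

/-- d(x^p) = p x^(p-1) y (dx/y), and the factor y cancels one of the p powers of z in (y⁻¹)^σ. The
remaining z^(p-1) is an even power, whence the shift of the levels by (p-1)/2. -/
theorem exists_frobForm_eq (hp : 3 ≤ p) (β : ℕ → Zq p k)
    (hβ : ∀ m, algebraMap (Zq p k) K (β m) = ((Ring.choose (-1 / 2 : ℚ) m : ℚ) : K)) (i : ℕ) :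
    ∃ h : OC (val p k K), h.1 = evenSeries (fun j => QK K (frobSeq Q β i 0 j)) ∧
      frobForm K Q hp (basisForm K Q i) =
        (DaggerForm.coef (val p k K) (QK K Q)).symm (toDagger _ _ h) := by
  obtain ⟨L, hL, h'⟩ := subst_neg_half_overconvergent K Q hp
  set x : OC (val p k K) := OC.X (val p k K) 0 with hx
  set y : OC (val p k K) := OC.X (val p k K) 1 with hy
  set z : OC (val p k K) := OC.X (val p k K) 2 with hz
  let t : OC (val p k K) :=
    ⟨PowerSeries.subst (frobArg K Q) (binomSeries K (-1 / 2)), ⟨L, 0, hL, h'⟩⟩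
  have hpos := (Fact.out : p.Prime).pos
  have hodd : p - 1 = 2 * ((p - 1) / 2) := by
    have := ((Fact.out : p.Prime).eq_two_or_odd).resolve_left (by lia)
    lia
  refine ⟨(p : OC (val p k K)) * x ^ (p * (i + 1) - 1) * (z ^ (p - 1) * t), ?_, ?_⟩
  · have h1 : ((p : OC (val p k K)) * x ^ (p * (i + 1) - 1) * (z ^ (p - 1) * t)).1 =
        Polynomial.aeval (MvPowerSeries.X 0)
          (Polynomial.C (p : K) * Polynomial.X ^ (p * (i + 1) - 1)) *
        (MvPowerSeries.X 2 ^ (2 * ((p - 1) / 2)) *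
          PowerSeries.subst (frobArg K Q) (binomSeries K (-1 / 2))) := by
      rw [← hodd, map_mul, map_pow, Polynomial.aeval_X, Polynomial.aeval_C, map_natCast]
      rfl
    rw [h1, subst_frobArg_eq_evenSeries, X_two_pow_mul_evenSeries, ← evenSeries_aeval_mul]
    congr 1
    ext1 j
    rw [frobSeq]
    by_cases h2 : (p - 1) / 2 ≤ j
    · by_cases h3 : p ∣ j - (p - 1) / 2
      · rw [if_pos h2, if_pos h3, if_pos ⟨h2, h3, Nat.zero_le _⟩, frobTerm, binomSeries,
          PowerSeries.coeff_mk, ← hβ, Polynomial.smul_eq_C_mul]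
        simp only [QK, Polynomial.map_mul, Polynomial.map_pow, Polynomial.map_C, Polynomial.map_X,
          Polynomial.map_natCast, map_mul, map_natCast]
        ring
      · rw [if_pos h2, if_neg h3, if_neg (fun h => h3 h.2.1)]
        simp
    · rw [if_neg h2, if_neg (fun h => h2 h.1)]
      simp
  · have hfx : frobA K Q hp (xA _ _) = toDagger _ _ (x ^ p) := by
      change toDagger _ _ (frobOC K Q hp x) = _
      exact congrArg _ ((OC.substHom_X _ _ _ _ _ _ _ 0).trans (Subtype.ext rfl))
    have hfz : frobA K Q hp ((yA (val p k K) (QK K Q))⁻¹ : (ADagger K Q)ˣ) =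
        toDagger _ _ (z ^ p * t) := by
      change toDagger _ _ (frobOC K Q hp z) = _
      exact congrArg _ ((OC.substHom_X _ _ _ _ _ _ _ 2).trans (Subtype.ext rfl))
    have hb : DaggerForm.coef _ _ (basisForm K Q i) = xA (val p k K) (QK K Q) ^ i := by
      rw [basisForm, LinearEquiv.map_smul, dxOverY, LinearEquiv.apply_symm_apply, smul_eq_mul,
        mul_one]
    rw [frobForm, hb, map_pow, hfx, hfz, dA_toDagger, ← LinearEquiv.map_smul, smul_eq_mul,
      Derivation.leibniz_pow, derOC_x]
    congr 1
    have hyz : toDagger (val p k K) (QK K Q) y * toDagger _ _ z = 1 := toDagger_y_mul_z _ _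
    have e1 : z ^ p = z ^ (p - 1) * z := by rw [← pow_succ, Nat.sub_add_cancel hpos]
    have e2 : x ^ (p * (i + 1) - 1) = (x ^ p) ^ i * x ^ (p - 1) := by
      rw [← pow_mul, ← pow_add]
      congr 1
      rw [mul_add, mul_one, Nat.add_sub_assoc hpos]
    rw [e1, e2]
    simp only [map_mul, map_pow, map_natCast, nsmul_eq_mul, smul_eq_mul, ← hy]
    linear_combination ((p : ADagger K Q) * (toDagger (val p k K) (QK K Q) x ^ p) ^ i *
      toDagger _ _ x ^ (p - 1) * toDagger _ _ z ^ (p - 1) * toDagger _ _ t) * hyz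

theorem aeval_expand_frobenius_pow (x : ADagger K Q) (j : ℕ) {d : ℕ} (hd : (Q ^ j).natDegree < d) :
    Polynomial.aeval x (QK K (Polynomial.expand _ p (Q.map WittVector.frobenius))) ^ j =
      ∑ r ∈ Finset.range d, algebraMap K (ADagger K Q)
        (algebraMap (Zq p k) K (WittVector.frobenius ((Q ^ j).coeff r))) * x ^ (p * r) := by
  rw [← map_pow, ← Polynomial.map_pow, ← map_pow, ← Polynomial.map_pow, Polynomial.map_expand,
    Polynomial.expand_aeval, Polynomial.aeval_eq_sum_range' (n := d)]
  · simp only [Polynomial.coeff_map, Algebra.smul_def, ← pow_mul]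
  · exact (Polynomial.natDegree_map_le.trans Polynomial.natDegree_map_le).trans_lt hd

/-- In (Q^σ - y^(2p))^n the powers of y cancel against z^(2pn), so the j-th binomial term has a
power of z depending on j only. Exchanging the sums over j ≤ n < N collects the inner sum of
B_{j,r}, and (Q^σ)^j = ∑ C_{j,r}^σ x^(pr) gives the sum over r. -/
theorem approxT_eq (hp : 3 ≤ p) (g N : ℕ) (hdeg : Q.natDegree = 2 * g + 1) (β : ℕ → Zq p k)
    (hβ : ∀ m, algebraMap (Zq p k) K (β m) = ((Ring.choose (-1 / 2 : ℚ) m : ℚ) : K)) (i : ℕ) :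
    approxT K Q g N i = (DaggerForm.coef (val p k K) (QK K Q)).symm (toDagger _ _
      (∑ n ∈ Finset.range N, Polynomial.aeval (OC.X (val p k K) 0) (QK K (frobTerm Q β i n)) *
        OC.X (val p k K) 2 ^ (2 * ((p - 1) / 2 + p * n)))) := by
  have hpos := (Fact.out : p.Prime).pos
  have hodd : p = 2 * ((p - 1) / 2) + 1 := by
    have := ((Fact.out : p.Prime).eq_two_or_odd).resolve_left (by lia)
    lia
  set x := xA (val p k K) (QK K Q) with hx
  set y := yA (val p k K) (QK K Q) with hy
  set W : ℕ → ADagger K Q := fun j => ((y⁻¹ : (ADagger K Q)ˣ) : ADagger K Q) ^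
    (2 * ((p - 1) / 2 + p * j)) with hW
  set F : ADagger K Q :=
    Polynomial.aeval x (QK K (Polynomial.expand _ p (Q.map WittVector.frobenius))) with hF
  set c : ℕ → ℕ → ADagger K Q := fun j m => (-1) ^ (m + j) *
    algebraMap K (ADagger K Q) ((Ring.choose (-1 / 2 : ℚ) m : ℚ) : K) * (m.choose j : ADagger K Q)
    with hc
  have hWy : ∀ j m, j ≤ m → ((y : ADagger K Q) ^ (2 * p)) ^ (m - j) * W m = W j := by
    intro j m hjm
    obtain ⟨d, rfl⟩ := Nat.exists_eq_add_of_le hjm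
    have h1 : (y : ADagger K Q) * ((y⁻¹ : (ADagger K Q)ˣ) : ADagger K Q) = 1 := Units.mul_inv y
    have h2 : 2 * ((p - 1) / 2 + p * (j + d)) = 2 * p * d + 2 * ((p - 1) / 2 + p * j) := by ring
    rw [hW, Nat.add_sub_cancel_left, ← pow_mul]
    simp only [h2]
    rw [pow_add, ← mul_assoc, ← mul_pow, h1, one_pow, one_mul]
  have hE : Polynomial.aeval x (QK K (frobDefect Q)) = F - (y : ADagger K Q) ^ (2 * p) := by
    simp only [QK, frobDefect, Polynomial.map_sub, Polynomial.map_pow, map_sub, map_pow]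
    rw [pow_mul, yA_sq]
  have hterm : ∀ n, toDagger (val p k K) (QK K Q)
      (Polynomial.aeval (OC.X (val p k K) 0) (QK K (frobTerm Q β i n)) *
        OC.X (val p k K) 2 ^ (2 * ((p - 1) / 2 + p * n))) =
      ∑ j ∈ Finset.range (n + 1), (p : ADagger K Q) * x ^ (p * (i + 1) - 1) * (c j n * F ^ j * W j) := by
    intro n
    rw [map_mul, map_pow, ← Polynomial.aeval_algHom_apply]
    change Polynomial.aeval x _ * W n = _
    have hQK : QK K (frobTerm Q β i n) = Polynomial.C (p * ((Ring.choose (-1 / 2 : ℚ) n : ℚ) : K)) *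
        Polynomial.X ^ (p * (i + 1) - 1) * QK K (frobDefect Q) ^ n := by
      simp only [QK, frobTerm, Polynomial.map_mul, Polynomial.map_pow, Polynomial.map_X,
        Polynomial.map_C, Polynomial.map_natCast, map_mul, map_natCast, hβ]
    rw [hQK, map_mul, map_mul, map_pow, map_pow, Polynomial.aeval_X, Polynomial.aeval_C, map_mul,
      map_natCast]
    change _ * _ * Polynomial.aeval x (QK K (frobDefect Q)) ^ n * _ = _
    rw [hE, sub_eq_add_neg, add_pow, Finset.mul_sum, Finset.sum_mul]
    refine Finset.sum_congr rfl fun j hj => ?_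
    have hjn : j ≤ n := by rw [Finset.mem_range] at hj; lia
    have h3 : (-1 : ADagger K Q) ^ (n - j) = (-1) ^ (n + j) := by
      obtain ⟨d, rfl⟩ := Nat.exists_eq_add_of_le hjn
      rw [Nat.add_sub_cancel_left, show j + d + j = 2 * j + d by ring, pow_add, pow_mul]
      simp
    rw [← hWy j n hjn, neg_pow, h3]
    simp only [hc]
    ring
  have hcoef : ∀ ω : Omega K Q, ω = (DaggerForm.coef (val p k K) (QK K Q)).symm
      (DaggerForm.coef _ _ ω) := fun ω => (LinearEquiv.symm_apply_apply _ _).symm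
  rw [hcoef (approxT K Q g N i)]
  congr 1
  rw [map_sum, Finset.sum_congr rfl fun n _ => hterm n,
    Finset.sum_comm' (t' := Finset.range N) (s' := fun j => Finset.Ico j N)
      (by intro a b; simp only [Finset.mem_range, Finset.mem_Ico]; lia),
    approxT, map_sum, termIndex, Finset.sum_sigma]
  refine Finset.sum_congr rfl fun j hj => ?_
  rw [← Finset.mul_sum, ← Finset.sum_mul, ← Finset.sum_mul, hF,
    aeval_expand_frobenius_pow K Q x j (d := (2 * g + 1) * j + 1)
      (Nat.lt_succ_of_le (Polynomial.natDegree_pow_le.trans (by rw [hdeg, mul_comm]))),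
    Finset.mul_sum, Finset.sum_mul, Finset.mul_sum]
  refine Finset.sum_congr rfl fun r hr => ?_
  have hyW : ((y ^ (-(p : ℤ) * (2 * j + 1) + 1) : (ADagger K Q)ˣ) : ADagger K Q) = W j := by
    have h4 : (-(p : ℤ) * (2 * j + 1) + 1) = -((2 * ((p - 1) / 2 + p * j) : ℕ) : ℤ) := by
      have h5 : p * (2 * j + 1) = 2 * ((p - 1) / 2 + p * j) + 1 := by
        rw [mul_add, mul_add, mul_one, ← mul_assoc, mul_comm p 2, mul_assoc]
        lia
      have h6 : (p : ℤ) * (2 * j + 1) = ((2 * ((p - 1) / 2 + p * j) : ℕ) : ℤ) + 1 := by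
        exact_mod_cast h5
      linarith
    rw [h4, zpow_neg, zpow_natCast, ← inv_pow, Units.val_pow_eq_pow_val]
  have hxr : p * (i + r + 1) - 1 = p * (i + 1) - 1 + p * r := by
    rw [show p * (i + r + 1) = p * (i + 1) + p * r by ring]
    have : 0 < p * (i + 1) := by positivity
    lia
  have hB : algebraMap K (ADagger K Q) (coeffB K Q N j r) = p * algebraMap K (ADagger K Q)
      (algebraMap (Zq p k) K (WittVector.frobenius ((Q ^ j).coeff r))) *
        ∑ m ∈ Finset.Ico j N, c j m := by
    simp only [coeffB, hc, map_mul, map_sum, map_pow, map_neg, map_one, map_natCast]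
  rw [LinearEquiv.map_smul, dxOverY, LinearEquiv.apply_symm_apply, smul_eq_mul, mul_one, hyW, hB,
    hxr, pow_add]
  ring

theorem isReduction_unique (hp : 3 ≤ p) (g : ℕ) (hg : 1 ≤ g) (hmon : Q.Monic)
    (hdeg : Q.natDegree = 2 * g + 1) (hcop : IsCoprime Q (Polynomial.derivative Q))
    (hgp : 2 * g + 1 < p) {ω : Omega K Q} {P R : K[X]} (hP : IsReduction g ω P)
    (hR : IsReduction g ω R) : P = R := by
  obtain ⟨h, hh⟩ := toDagger_surjective _ _ (DaggerForm.coef (val p k K) (QK K Q) ω)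
  have hω : ω = (DaggerForm.coef (val p k K) (QK K Q)).symm (toDagger _ _ h) := by
    rw [hh, LinearEquiv.symm_apply_apply]
  rw [hω, isReduction_iff] at hP hR
  obtain ⟨hPd, f, hf⟩ := hP
  obtain ⟨hRd, f', hf'⟩ := hR
  rw [← sub_eq_zero]
  refine eq_zero_of_exact K Q hp hmon hcop (by lia) (by lia) (P - R) ?_ (f' - f) ?_
  · rw [hdeg, Nat.add_sub_cancel]
    exact (Polynomial.degree_sub_le _ _).trans_lt (max_lt hPd hRd)
  · have := sub_mem hf' hf
    rw [map_sub, map_sub]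
    convert this using 1
    ring

theorem isReduction_sub (g : ℕ) {h h' : OC (val p k K)} {P R : K[X]}
    (hP : IsReduction g ((DaggerForm.coef (val p k K) (QK K Q)).symm (toDagger _ _ h)) P)
    (hR : IsReduction g ((DaggerForm.coef (val p k K) (QK K Q)).symm (toDagger _ _ h')) R) :
    IsReduction g ((DaggerForm.coef (val p k K) (QK K Q)).symm (toDagger _ _ (h - h')))
      (P - R) := by
  rw [isReduction_iff] at *
  obtain ⟨hPd, f, hf⟩ := hP
  obtain ⟨hRd, f', hf'⟩ := hR
  refine ⟨(Polynomial.degree_sub_le _ _).trans_lt (max_lt hPd hRd), f - f', ?_⟩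
  rw [map_sub, map_sub]
  convert sub_mem hf hf' using 1
  ring

/-- Both σ(x^i dx/y) and its tail n ≥ N have reductions, the latter divisible by p^N; their
difference is a reduction of T_i, and uniqueness turns this into the congruence. -/
theorem exists_reduction_approxT_frobForm (hp : 3 ≤ p) (g N : ℕ) (hg : 1 ≤ g) (hN : 1 ≤ N)
    (hpN : (2 * N - 1) * (2 * g + 1) < p) (hmon : Q.Monic) (hdeg : Q.natDegree = 2 * g + 1)
    (hcop : IsCoprime Q (Polynomial.derivative Q)) (β : ℕ → Zq p k)
    (hβ : ∀ m, algebraMap (Zq p k) K (β m) = ((Ring.choose (-1 / 2 : ℚ) m : ℚ) : K)) (i : ℕ)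
    (hi : i < 2 * g) : ∃ R S : K[X],
      (∀ P, IsReduction g (approxT K Q g N i) P ↔ P = R) ∧
      (∀ P, IsReduction g (frobForm K Q hp (basisForm K Q i)) P ↔ P = S) ∧
      ∀ m, ∃ c : Zq p k, R.coeff m - S.coeff m = (p : K) ^ N * algebraMap (Zq p k) K c := by
  obtain ⟨N, rfl⟩ := Nat.exists_eq_add_of_le' hN
  have hN2 : 2 * (N + 1) - 1 = 2 * N + 1 := by lia
  rw [hN2] at hpN
  -- The two bounds on p behind the estimates: deg Q < p, and 2N + 1 < p for the original N.
  have hgp : 2 * g + 1 < p := by nlinarith [Nat.zero_le (N * g)]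
  have hNp : 2 * (N + 1) + 1 < p := by nlinarith [Nat.zero_le (N * g)]
  obtain ⟨h, hh, hω⟩ := exists_frobForm_eq K Q hp β hβ i
  set h' := ∑ n ∈ Finset.range (N + 1),
    Polynomial.aeval (OC.X (val p k K) 0) (QK K (frobTerm Q β i n)) *
      OC.X (val p k K) 2 ^ (2 * ((p - 1) / 2 + p * n)) with hh'
  have hT : (h - h').1 = evenSeries fun j => QK K (frobSeq Q β i (N + 1) j) := by
    have h1 : h'.1 = ∑ n ∈ Finset.range (N + 1),
        Polynomial.aeval (MvPowerSeries.X 0) (QK K (frobTerm Q β i n)) *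
          MvPowerSeries.X 2 ^ (2 * ((p - 1) / 2 + p * n)) := by
      rw [hh']
      simp only [AddSubmonoidClass.coe_finsetSum, MulMemClass.coe_mul, coe_aeval_OC_X,
        SubmonoidClass.coe_pow]
      rfl
    change h.1 - h'.1 = _
    rw [hh, h1, evenSeries_frobSeq K Q β i (N + 1), add_sub_cancel_right]
  have hpos := (Fact.out : p.Prime).pos
  -- The full series, T = 0: here only existence matters.
  obtain ⟨S, hS, -⟩ := exists_isReduction K Q g hdeg _ _ (2 * p) 0 (by lia)
    (exists_reduction_frobSeq Q hp g hg hmon hdeg hcop hgp β i hi 0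
      fun n _ => two_mul_add_one_lt_pow_sub hp (by lia) n (Nat.zero_le _)) h hh
  obtain ⟨D, hD, E, rfl⟩ := exists_isReduction K Q g hdeg _ _ (2 * p) (N + 1) (by lia)
    (exists_reduction_frobSeq Q hp g hg hmon hdeg hcop hgp β i hi (N + 1)
      fun n hn => two_mul_add_one_lt_pow_sub hp hNp n hn) (h - h') hT
  have hR := isReduction_sub K Q g hS hD
  rw [sub_sub_cancel, hh', ← approxT_eq K Q hp g (N + 1) hdeg β hβ i] at hR
  rw [← hω] at hS
  refine ⟨_, _, fun P => ⟨fun hP => isReduction_unique K Q hp g hg hmon hdeg hcop hgp hP hR, ?_⟩,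
    fun P => ⟨fun hP => isReduction_unique K Q hp g hg hmon hdeg hcop hgp hP hS, ?_⟩, fun m => ?_⟩
  · rintro rfl
    exact hR
  · rintro rfl
    exact hS
  · refine ⟨-E.coeff m, ?_⟩
    rw [Polynomial.coeff_sub, Polynomial.coeff_map, Polynomial.coeff_map, Polynomial.coeff_C_mul]
    simp

end MainTheorem

end HyperellipticMW

end

theorem mainTheorem2 (p : ℕ) [Fact p.Prime] (hp : 3 ≤ p) (k : Type*) [Field k] [Finite k]
    [CharP k p] (g N : ℕ) (hg : 1 ≤ g) (hN : 1 ≤ N) (hpN : (2 * N - 1) * (2 * g + 1) < p)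
    (Q : (Zq p k)[X]) (hQ : Q.Monic) (hdeg : Q.natDegree = 2 * g + 1)
    (hsep : (Q.map (WittVector.constantCoeff (p := p) (R := k))).Separable) :
    (∀ j < N, ∀ r, ∃ b : Zq p k, algebraMap (Zq p k) (Qq p k) b = coeffB (Qq p k) Q N j r) ∧
    (termIndex g N).card ≤ 2 * N ^ 2 * g ∧
    ∀ i < 2 * g, ∃ R S : (Qq p k)[X],
      (∀ P : (Qq p k)[X], IsReduction g (approxT (Qq p k) Q g N i) P ↔ P = R) ∧
      (∀ P : (Qq p k)[X],
        IsReduction g (frobForm (Qq p k) Q hp (basisForm (Qq p k) Q i)) P ↔ P = S) ∧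
      ∀ m, ∃ c : Zq p k,
        R.coeff m - S.coeff m = (p : Qq p k) ^ N * algebraMap (Zq p k) (Qq p k) c := by
  obtain ⟨β, hβ⟩ := exists_integral_choose_neg_half (p := p) (k := k) (Qq p k) hp
  exact ⟨fun j _ r => coeffB_mem_range (Qq p k) Q β hβ N j r, card_termIndex_le hg hN,
    fun i hi => exists_reduction_approxT_frobForm (Qq p k) Q hp g N hg hN hpN hQ hdeg
      (isCoprime_derivative_of_separable Q hQ hsep) β hβ i hi⟩
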